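/- **Theorem (Christoffel–Darboux formula for $\beta=4$).** Let $V$ be a real polynomial of even degree $D\ge 2$ with positive leading coefficient, and let $n\in\mathbb N=\{0,1,2,\dots\}$. *Skew-orthogonal polynomials.* For real polynomials $P,Q$ put $$\langle P,Q\rangle_4=\tfrac12\int_{\mathbb R}\bigl(P(x)Q'(x)-P'(x)Q(x)\bigr)e^{-2V(x)}\,dx .$$ A sequence $(P_m)_{m\ge0}$ of monic real polynomials with $\deg P_m=m$ is skew-orthogonal if $\langle P_{2k},P_{2l}\rangle_4=\langle P_{2k+1},P_{2l+1}\rangle_4=0$ for all $k,l$ and $\langle P_{2k},P_{2l+1}\rangle_4=0$ for $k\ne l$. Such sequences exist, and their skew norms $h_k=\langle P_{2k},P_{2k+1}\rangle_4$ are all positive. For such a sequence the pre-kernel is $$S_n(x,y)=\sum_{k=0}^{n-1}\frac{P_{2k}(x)e^{-V(x)}\frac{d}{dy}\bigl(P_{2k+1}(y)e^{-V(y)}\bigr)-P_{2k+1}(x)e^{-V(x)}\frac{d}{dy}\bigl(P_{2k}(y)e^{-V(y)}\bigr)}{2h_k},$$ for real $x,y$, and by the same expression for complex $x,y$. *The even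 Riemann–Hilbert problem.* Let $C_k=e^{2\pi i k/D}[0,\infty)$ for $0\le k\le D-1$, with $C_0$ oriented away from the origin and $C_1,\dots,C_{D-1}$ oriented towards it. Let $\Gamma_j=C_0\cup C_j$ for $1\le j\le D-1$, and $\Gamma=\bigcup_{j=1}^{D-1}\Gamma_j$. The problem is to find $A_n:\mathbb C\setminus\Gamma\to\mathcal M_{D+1}(\mathbb C)$ such that 1. $A_n$ is analytic on $\mathbb C\setminus\Gamma$; 2. $A_n$ extends continuously to $\Gamma\setminus\{0\}$ from the left ($+$) and from the right ($-$) side, with continuous boundary values $A_n^{\pm}$; 3. $A_n$ is bounded near $0$; 4. $A_n^+(x)=A_n^-(x)J(x)$ for $x\in\Gamma\setminus\{0\}$, where $J$ is the identity matrix with its first row replaced by $(1,\ e^{-2V}\chi_{\mathbb R},\ e^{-V}\chi_{\Gamma_1},\dots,e^{-V}\chi_{\Gamma_{D-1}})$; 5. $A_n(z)=\bigl(\mathbb I+\mathcal O(z^{-1})\bigr)\,\mathrm{diag}\bigl(z^{2n+D-1},z^{-2n},z^{-1},\dots,z^{-1}\bigr)$ as $z\to\infty$ in $\mathbb C\setminus\Gamma$.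 *Conclusion.* This problem has exactly one solution $A_n$, the matrix $A_n(z)$ is invertible for every $z\in\mathbb C\setminus\Gamma$, and for every skew-orthogonal sequence $$S_n(x,y)=-\frac1{4\pi i}\,e^{-V(x)-V(y)}\,\frac{\bigl(A_n^{-1}(x)A_n(y)\bigr)_{21}}{x-y}\qquad(x\ne y),$$ in the following sense. It holds for all complex $x\neq y$ in $\mathbb C\setminus\Gamma$. It holds for all nonzero real $x\ne y$ when $A_n(x)$ and $A_n(y)$ are each replaced by either of the boundary values $A_n^{\pm}$ at that point (which are invertible). And for all real $x\neq y$, zero included, the right-hand side evaluated at $(x',y')$ tends to $S_n(x,y)$ as $(x',y')\to(x,y)$ in $(\mathbb C\setminus\Gamma)^2$. -/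

import Mathlib

open Polynomial Filter Topology MeasureTheory

noncomputable section

namespace SkewRH

/-! ### Skew-orthogonal polynomials of symplectic type -/

/-- The skew-symmetric form `⟨P, Q⟩₄ = ½ ∫ (P Q' - P' Q) e^{-2V} dx` on real polynomials. -/
def skewInner (V P Q : ℝ[X]) : ℝ :=
  (1 / 2) * ∫ x : ℝ, (P.eval x * (derivative Q).eval x - (derivative P).eval x * Q.eval x)
    * Real.exp (-2 * V.eval x)

/-- `P 0, P 1, …` is a sequence of monic polynomials, `P n` of degree `n`, skew-orthogonal with
respect to `⟨·,·⟩₄`. (The odd members are only determined up to `P (2k+1) ↦ P (2k+1) + α P (2k)`.) -/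
structure IsSkewOrthogonal (V : ℝ[X]) (P : ℕ → ℝ[X]) : Prop where
  monic : ∀ m, (P m).Monic
  natDegree_eq : ∀ m, (P m).natDegree = m
  even_even : ∀ k l, skewInner V (P (2 * k)) (P (2 * l)) = 0
  odd_odd : ∀ k l, skewInner V (P (2 * k + 1)) (P (2 * l + 1)) = 0
  even_odd : ∀ k l, k ≠ l → skewInner V (P (2 * k)) (P (2 * l + 1)) = 0

/-- The skew norms `h_k = ⟨P_{2k}, P_{2k+1}⟩₄`. -/
def skewNorm (V : ℝ[X]) (P : ℕ → ℝ[X]) (k : ℕ) : ℝ :=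
  skewInner V (P (2 * k)) (P (2 * k + 1))

/-- The pre-kernel `S_n(x, y)` for real `x, y`. -/
def preKernel (V : ℝ[X]) (P : ℕ → ℝ[X]) (n : ℕ) (x y : ℝ) : ℝ :=
  ∑ k ∈ Finset.range n,
    ((P (2 * k)).eval x * Real.exp (-V.eval x)
        * deriv (fun t : ℝ => (P (2 * k + 1)).eval t * Real.exp (-V.eval t)) y
      - (P (2 * k + 1)).eval x * Real.exp (-V.eval x)
        * deriv (fun t : ℝ => (P (2 * k)).eval t * Real.exp (-V.eval t)) y)
      / (2 * skewNorm V P k)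

/-- The pre-kernel `S_n(x, y)` for complex `x, y`, given by the same expression. -/
def preKernelC (V : ℝ[X]) (P : ℕ → ℝ[X]) (n : ℕ) (x y : ℂ) : ℂ :=
  ∑ k ∈ Finset.range n,
    (aeval x (P (2 * k)) * Complex.exp (-aeval x V)
        * deriv (fun t : ℂ => aeval t (P (2 * k + 1)) * Complex.exp (-aeval t V)) y
      - aeval x (P (2 * k + 1)) * Complex.exp (-aeval x V)
        * deriv (fun t : ℂ => aeval t (P (2 * k)) * Complex.exp (-aeval t V)) y)
      / (2 * (skewNorm V P k : ℂ))

/-! ### The contours -/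

/-- The direction `e^{2πik/D}`. -/
def dir (D k : ℕ) : ℂ := Complex.exp (2 * Real.pi * Complex.I * k / D)

/-- The closed ray `C_k = e^{2πik/D} [0, ∞)`. -/
def ray (D k : ℕ) : Set ℂ := {z | ∃ t : ℝ, 0 ≤ t ∧ z = t * dir D k}

/-- `Γ_j = C_0 ∪ C_j`. -/
def arc (D j : ℕ) : Set ℂ := ray D 0 ∪ ray D j

/-- `Γ = Γ_1 ∪ … ∪ Γ_{D-1}`. -/
def contour (D : ℕ) : Set ℂ := {z | ∃ j, 1 ≤ j ∧ j < D ∧ z ∈ arc D j}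

/-- The direction in which `C_k` is traversed: `C_0` goes out to infinity, the other rays
come in towards the origin. -/
def tangent (D k : ℕ) : ℂ := if k = 0 then dir D k else -dir D k

/-- The open half-plane to the left of the oriented ray `C_k`. -/
def leftSide (D k : ℕ) : Set ℂ := {z | 0 < (z / tangent D k).im}

/-- The open half-plane to the right of the oriented ray `C_k`. -/
def rightSide (D k : ℕ) : Set ℂ := {z | (z / tangent D k).im < 0}

/-! ### The even Riemann-Hilbert problem -/

/-- `M` is the boundary value of `A` at the point `x` of `C_k`, from the `+` (left) side. -/
def IsPlusValue (D k : ℕ) (A : ℂ → Matrix (Fin (D + 1)) (Fin (D + 1)) ℂ) (x : ℂ)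
    (M : Matrix (Fin (D + 1)) (Fin (D + 1)) ℂ) : Prop :=
  Tendsto A (𝓝[leftSide D k \ contour D] x) (𝓝 M)

/-- `M` is the boundary value of `A` at the point `x` of `C_k`, from the `-` (right) side. -/
def IsMinusValue (D k : ℕ) (A : ℂ → Matrix (Fin (D + 1)) (Fin (D + 1)) ℂ) (x : ℂ)
    (M : Matrix (Fin (D + 1)) (Fin (D + 1)) ℂ) : Prop :=
  Tendsto A (𝓝[rightSide D k \ contour D] x) (𝓝 M)

/-- `M` is one of the two boundary values of `A` at the point `x ∈ Γ \ {0}`. -/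
def IsBoundaryValue (D : ℕ) (A : ℂ → Matrix (Fin (D + 1)) (Fin (D + 1)) ℂ) (x : ℂ)
    (M : Matrix (Fin (D + 1)) (Fin (D + 1)) ℂ) : Prop :=
  ∃ k < D, x ∈ ray D k ∧ x ≠ 0 ∧ (IsPlusValue D k A x M ∨ IsMinusValue D k A x M)

/-- The jump matrix: the identity except for the first row, which is
`(1, e^{-2V} χ_ℝ, e^{-V} χ_{Γ_1}, …, e^{-V} χ_{Γ_{D-1}})`. Rows and columns are counted from `0`,
so `Γ_j` belongs to column `j + 1`. -/
def jump (V : ℝ[X]) (D : ℕ) (x : ℂ) : Matrix (Fin (D + 1)) (Fin (D + 1)) ℂ :=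
  Matrix.of fun i j =>
    if i = j then 1
    else if i = 0 then
      if j = 1 then
        Set.indicator {w : ℂ | w.im = 0} (fun w => Complex.exp (-2 * aeval w V)) x
      else Set.indicator (arc D (j.val - 1)) (fun w => Complex.exp (-aeval w V)) x
    else 0

/-- `diag (z^{2n+D-1}, z^{-2n}, z^{-1}, …, z^{-1})`. -/
def growth (D n : ℕ) (z : ℂ) : Matrix (Fin (D + 1)) (Fin (D + 1)) ℂ :=
  Matrix.diagonal fun i =>
    if i = 0 then z ^ (2 * (n : ℤ) + D - 1) else if i = 1 then z ^ (-2 * (n : ℤ)) else z ^ (-1 : ℤ)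

/-- `A` solves the even Riemann-Hilbert problem with potential `V` of degree `D` and index `n`.
Only the values of `A` on `ℂ \ Γ` matter. -/
structure IsEvenSolution (V : ℝ[X]) (D n : ℕ)
    (A : ℂ → Matrix (Fin (D + 1)) (Fin (D + 1)) ℂ) : Prop where
  analytic : ∀ i j, DifferentiableOn ℂ (fun z => A z i j) (contour D)ᶜ
  boundary : ∃ Ap Am : ℂ → Matrix (Fin (D + 1)) (Fin (D + 1)) ℂ,
    ContinuousOn Ap (contour D \ {0}) ∧ ContinuousOn Am (contour D \ {0}) ∧
    (∀ k < D, ∀ x ∈ ray D k, x ≠ 0 →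
      IsPlusValue D k A x (Ap x) ∧ IsMinusValue D k A x (Am x)) ∧
    ∀ x ∈ contour D \ {0}, Ap x = Am x * jump V D x
  bounded_near_zero : ∃ r > (0 : ℝ), ∃ C : ℝ,
    ∀ z, z ∉ contour D → ‖z‖ < r → ∀ i j, ‖A z i j‖ ≤ C
  normalised : ∃ E : ℂ → Matrix (Fin (D + 1)) (Fin (D + 1)) ℂ,
    (∀ i j, (fun z => E z i j)
      =O[Bornology.cobounded ℂ ⊓ 𝓟 (contour D)ᶜ] (fun z : ℂ => z⁻¹)) ∧
    ∀ᶠ z in Bornology.cobounded ℂ ⊓ 𝓟 (contour D)ᶜ, A z = (1 + E z) * growth D n z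

/-- The right-hand side of the Christoffel-Darboux formula, with `M`, `N` in the places of
`A_n(x)` and `A_n(y)`; the `(2,1)` entry is the entry `1 0` when counting from `0`. -/
def cdRHS (V : ℝ[X]) (D : ℕ) (x y : ℂ) (M N : Matrix (Fin (D + 1)) (Fin (D + 1)) ℂ) : ℂ :=
  -(1 / (4 * Real.pi * Complex.I)) * Complex.exp (-aeval x V - aeval y V)
    * ((M⁻¹ * N) 1 0 / (x - y))

end SkewRH

end

/-!
A row of a solution has no jump in its first column, so that column is a polynomial `p`, and the
other columns are Cauchy transforms of `p e^{-2V}` and `p e^{-V}`. The behaviour at infinity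
prescribes the leading coefficient of `p` and finitely many of its moments, so a solution exists as
soon as the moment map is injective. If the arc moments of `p` vanish, then `p = q' - V' q` for a
polynomial `q`, and the moments on the line are the values of the skew form at `q`; its
non-degeneracy, which comes from `h_k > 0`, gives `q = 0`.

A row of one solution times the adjugate of another has no jump at all, hence is entire, and
Liouville's theorem yields uniqueness and `det A = 1`.

For the formula, the same argument shows that, for fixed `y`, `(A⁻¹(x) A(y))₂₁ / (x - y)` is a
polynomial in `x` of degree less than `2n`. Its skew product with `q` is a multiple of the value at
`y` of `q' - V' q`, a property that also characterises `e^{V(x) + V(y)} S_n(x, y)`.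
-/

noncomputable section

namespace SkewRH

/-! ### Removability of a line, and Liouville's theorem off a thin set -/

section Removability

variable {E : Type*} [NormedAddCommGroup E] [NormedSpace ℂ E] {f : ℂ → E}

/-- The integral of `f` along the boundary of the rectangle with opposite corners `z` and `w`. -/
def rectangleIntegral (f : ℂ → E) (z w : ℂ) : E :=
  (∫ x : ℝ in z.re..w.re, f (x + z.im * Complex.I))
    - (∫ x : ℝ in z.re..w.re, f (x + w.im * Complex.I))
    + Complex.I • (∫ y : ℝ in z.im..w.im, f (w.re + y * Complex.I))
    - Complex.I • (∫ y : ℝ in z.im..w.im, f (z.re + y * Complex.I))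

theorem rectangle_subset_rectangle {z w : ℂ} {s t : ℝ} (hs : s ∈ Set.uIcc z.im w.im)
    (ht : t ∈ Set.uIcc z.im w.im) :
    Complex.Rectangle ⟨z.re, s⟩ ⟨w.re, t⟩ ⊆ Complex.Rectangle z w :=
  Set.inter_subset_inter_right _ (Set.preimage_mono (Set.uIcc_subset_uIcc hs ht))

theorem rectangleIntegral_add_rectangleIntegral {z w : ℂ} {t : ℝ} (ht : t ∈ Set.uIcc z.im w.im)
    (hf : ContinuousOn f (Complex.Rectangle z w)) :
    rectangleIntegral f z ⟨w.re, t⟩ + rectangleIntegral f ⟨z.re, t⟩ w =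
      rectangleIntegral f z w := by
  have side_integrable : ∀ a ∈ Set.uIcc z.re w.re, ∀ b ∈ Set.uIcc z.im w.im,
      IntervalIntegrable (fun y : ℝ => f (a + y * Complex.I)) volume b t := by
    refine fun a ha b hb => (hf.comp (by fun_prop) fun y hy => ?_).intervalIntegrable
    exact Complex.mem_reProdIm.2 ⟨by simpa using ha, by simpa using Set.uIcc_subset_uIcc hb ht hy⟩
  have side_add : ∀ a ∈ Set.uIcc z.re w.re,
      (∫ y in z.im..t, f (a + y * Complex.I)) + ∫ y in t..w.im, f (a + y * Complex.I) =
        ∫ y in z.im..w.im, f (a + y * Complex.I) := fun a ha =>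
    intervalIntegral.integral_add_adjacent_intervals
      (side_integrable a ha _ Set.left_mem_uIcc) (side_integrable a ha _ Set.right_mem_uIcc).symm
  simp only [rectangleIntegral, ← side_add _ Set.left_mem_uIcc, ← side_add _ Set.right_mem_uIcc,
    smul_add]
  abel

theorem rectangleIntegral_eq_zero_of_differentiableAt_of_im_ne_zero {z w : ℂ}
    (hf : ContinuousOn f (Complex.Rectangle z w))
    (hd : ∀ u ∈ Complex.Rectangle z w, u.im ≠ 0 → DifferentiableAt ℂ f u) :
    rectangleIntegral f z w = 0 := by
  have off_axis : ∀ z w : ℂ, ContinuousOn f (Complex.Rectangle z w) →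
      (∀ u ∈ Complex.Rectangle z w, u.im ≠ 0 → DifferentiableAt ℂ f u) →
      (0 : ℝ) ∉ Set.Ioo (min z.im w.im) (max z.im w.im) → rectangleIntegral f z w = 0 := by
    refine fun z w hf hd h0 =>
      Complex.integral_boundary_rect_eq_zero_of_continuousOn_of_differentiableOn f z w hf
        fun u hu => (hd u ?_ fun h => h0 (h ▸ hu.2)).differentiableWithinAt
    exact ⟨Set.Ioo_subset_Icc_self hu.1, Set.Ioo_subset_Icc_self hu.2⟩
  by_cases h0 : (0 : ℝ) ∈ Set.Ioo (min z.im w.im) (max z.im w.im)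
  · have h0' : (0 : ℝ) ∈ Set.uIcc z.im w.im := Set.Ioo_subset_Icc_self h0
    have lower := rectangle_subset_rectangle (z := z) (w := w) Set.left_mem_uIcc h0'
    have upper := rectangle_subset_rectangle (z := z) (w := w) h0' Set.right_mem_uIcc
    rw [← rectangleIntegral_add_rectangleIntegral h0' hf,
      off_axis z _ (hf.mono lower) (fun u hu => hd u (lower hu)) (by grind),
      off_axis _ w (hf.mono upper) (fun u hu => hd u (upper hu)) (by grind), add_zero]
  · exact off_axis z w hf hd h0

variable [CompleteSpace E] {U : Set ℂ}

theorem differentiableOn_of_continuousOn_of_im_ne_zero (hU : IsOpen U) (hc : ContinuousOn f U)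
    (hd : ∀ z ∈ U, z.im ≠ 0 → DifferentiableAt ℂ f z) : DifferentiableOn ℂ f U := by
  refine (Complex.isConservativeOn_and_continuousOn_iff_isDifferentiableOn hU).1
    ⟨fun z w hzw => ?_, hc⟩
  rw [← add_eq_zero_iff_eq_neg, Complex.wedgeIntegral_add_wedgeIntegral_eq]
  exact rectangleIntegral_eq_zero_of_differentiableAt_of_im_ne_zero (hc.mono hzw)
    fun u hu => hd u (hzw hu)

theorem differentiableOn_of_continuousOn_of_div_im_ne_zero {d : ℂ} (hd0 : d ≠ 0) (hU : IsOpen U)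
    (hc : ContinuousOn f U) (hd : ∀ z ∈ U, (z / d).im ≠ 0 → DifferentiableAt ℂ f z) :
    DifferentiableOn ℂ f U := by
  have rotated : DifferentiableOn ℂ (fun u => f (u * d)) ((fun u : ℂ => u * d) ⁻¹' U) := by
    refine differentiableOn_of_continuousOn_of_im_ne_zero (hU.preimage (by fun_prop))
      (hc.comp (by fun_prop) fun u hu => hu) fun u hu hi => ?_
    exact (hd _ hu (by rwa [mul_div_cancel_right₀ _ hd0])).fun_comp' u (by fun_prop)
  have rotated_back : DifferentiableOn ℂ ((fun u => f (u * d)) ∘ fun z => z / d) U :=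
    rotated.comp (by fun_prop) fun z hz => by simpa [hd0] using hz
  exact rotated_back.congr fun z _ => by simp [hd0]

end Removability

section DenseSet

variable {X : Type*} [PseudoMetricSpace X] {S : Set X}

theorem eventually_cobounded_of_dense (hS : Dense S) {p : X → Prop} (hp : IsClosed {x | p x})
    (h : ∀ᶠ x in Bornology.cobounded X ⊓ 𝓟 S, p x) : ∀ᶠ x in Bornology.cobounded X, p x := by
  rcases isEmpty_or_nonempty X with hX | ⟨⟨c⟩⟩
  · exact Eventually.of_forall fun x => hX.elim x
  rw [eventually_inf_principal,
    (Metric.hasBasis_cobounded_compl_closedBall c).eventually_iff] at h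
  rw [(Metric.hasBasis_cobounded_compl_closedBall c).eventually_iff]
  obtain ⟨R, -, hR⟩ := h
  exact ⟨R, trivial, fun x hx => closure_minimal (fun y hy => hR hy.1 hy.2) hp
    (hS.open_subset_closure_inter Metric.isClosed_closedBall.isOpen_compl hx)⟩

theorem tendsto_cobounded_of_dense {Y : Type*} [TopologicalSpace Y] [RegularSpace Y] (hS : Dense S)
    {g : X → Y} (hg : Continuous g) {c : Y}
    (h : Tendsto g (Bornology.cobounded X ⊓ 𝓟 S) (𝓝 c)) :
    Tendsto g (Bornology.cobounded X) (𝓝 c) := by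
  refine (closed_nhds_basis c).tendsto_right_iff.2 fun t ht => ?_
  exact eventually_cobounded_of_dense hS (ht.2.preimage hg) (h ht.1)

theorem isBigO_cobounded_of_dense {E F : Type*} [SeminormedAddCommGroup E]
    [SeminormedAddCommGroup F] (hS : Dense S) {f : X → E} {g : X → F} (hf : Continuous f)
    (hg : Continuous g) (h : f =O[Bornology.cobounded X ⊓ 𝓟 S] g) :
    f =O[Bornology.cobounded X] g := by
  obtain ⟨C, hC⟩ := h.bound
  exact .of_bound C (eventually_cobounded_of_dense hS
    (isClosed_le hf.norm (continuous_const.mul hg.norm)) hC)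

end DenseSet

theorem eq_const_of_tendsto_cobounded_inf {E : Type*} [NormedAddCommGroup E] [NormedSpace ℂ E]
    {g : ℂ → E} (hg : Differentiable ℂ g) {S : Set ℂ} (hS : Dense S) {c : E}
    (h : Tendsto g (Bornology.cobounded ℂ ⊓ 𝓟 S) (𝓝 c)) (z : ℂ) : g z = c :=
  hg.apply_eq_of_tendsto_cocompact z
    (Metric.cobounded_eq_cocompact (α := ℂ) ▸ tendsto_cobounded_of_dense hS hg.continuous h)

theorem isBigO_dslope_zero {g : ℂ → ℂ} {N : ℕ}
    (h : g =O[Bornology.cobounded ℂ] fun z => z ^ N) :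
    dslope g 0 =O[Bornology.cobounded ℂ] fun z => z ^ ((N : ℤ) - 1) := by
  have const_bound : (fun _ : ℂ => g 0) =O[Bornology.cobounded ℂ] fun z : ℂ => z ^ N := by
    refine .of_bound ‖g 0‖ ?_
    filter_upwards [tendsto_norm_cobounded_atTop.eventually_ge_atTop 1] with z hz
    rw [norm_pow]
    exact le_mul_of_one_le_right (norm_nonneg _) (one_le_pow₀ hz)
  refine ((Asymptotics.isBigO_refl (fun z : ℂ => z⁻¹) _).mul (h.sub const_bound)).congr' ?_ ?_
  · filter_upwards [Bornology.eventually_ne_cobounded 0] with z hz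
    rw [dslope_of_ne _ hz, slope_def_field, sub_zero, div_eq_inv_mul]
  · filter_upwards [Bornology.eventually_ne_cobounded 0] with z hz
    rw [zpow_sub_one₀ hz, zpow_natCast, mul_comm]

theorem exists_polynomial_of_isBigO_cobounded (N : ℕ) :
    ∀ {g : ℂ → ℂ}, Differentiable ℂ g →
      (g =O[Bornology.cobounded ℂ] fun z => z ^ ((N : ℤ) - 1)) →
      ∃ p : ℂ[X], p.degree < N ∧ ∀ z, g z = p.eval z := by
  induction N with
  | zero =>
    intro g hg hO
    have hlim : Tendsto g (Bornology.cobounded ℂ) (𝓝 0) :=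
      hO.trans_tendsto (by simpa using tendsto_inv₀_cobounded)
    exact ⟨0, by simp, fun z => by simpa using
      eq_const_of_tendsto_cobounded_inf hg dense_univ (by simpa using hlim) z⟩
  | succ N ih =>
    intro g hg hO
    have hdslope : Differentiable ℂ (dslope g 0) := by
      rw [← differentiableOn_univ] at hg ⊢
      exact (Complex.differentiableOn_dslope Filter.univ_mem).2 hg
    obtain ⟨p, hp, hpe⟩ := ih hdslope (isBigO_dslope_zero (by simpa using hO))
    refine ⟨X * p + C (g 0), ?_, fun z => ?_⟩
    · refine (degree_add_le _ _).trans_lt (max_lt ?_ (degree_C_le.trans_lt (by positivity)))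
      rw [degree_mul, degree_X, add_comm]
      exact_mod_cast WithBot.add_lt_add_right WithBot.one_ne_bot hp
    · have := sub_smul_dslope g 0 z
      rw [hpe, sub_zero, smul_eq_mul] at this
      simp [this]

theorem exists_polynomial_of_isBigO_cobounded_inf {S : Set ℂ} (hS : Dense S) {N : ℕ} {g : ℂ → ℂ}
    (hg : Differentiable ℂ g) (hO : g =O[Bornology.cobounded ℂ ⊓ 𝓟 S] fun z => z ^ N) :
    ∃ p : ℂ[X], p.natDegree ≤ N ∧ ∀ z, g z = p.eval z := by
  obtain ⟨p, hp, hpe⟩ := exists_polynomial_of_isBigO_cobounded (N + 1) hg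
    (by simpa using isBigO_cobounded_of_dense hS hg.continuous (by fun_prop) hO)
  exact ⟨p, natDegree_le_iff_coeff_eq_zero.2 ((degree_lt_iff_coeff_zero _ _).1 hp), hpe⟩

/-! ### Geometry of the contour -/

theorem dir_eq_pow (D k : ℕ) : dir D k = Complex.exp (2 * Real.pi * Complex.I / D) ^ k := by
  rw [dir, ← Complex.exp_nat_mul]
  congr 1
  ring

@[simp] theorem dir_zero (D : ℕ) : dir D 0 = 1 := by simp [dir]

@[simp] theorem dir_ne_zero (D k : ℕ) : dir D k ≠ 0 := Complex.exp_ne_zero _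

@[simp] theorem norm_dir (D k : ℕ) : ‖dir D k‖ = 1 := by
  have dir_eq : dir D k = Complex.exp ((2 * Real.pi * k / D : ℝ) * Complex.I) := by
    rw [dir]
    congr 1
    push_cast
    ring
  rw [dir_eq, Complex.norm_exp_ofReal_mul_I]

theorem dir_pow_self {D : ℕ} (hD : D ≠ 0) (k : ℕ) : dir D k ^ D = 1 := by
  rw [dir_eq_pow, ← pow_mul, Nat.mul_comm, pow_mul, (Complex.isPrimitiveRoot_exp D hD).pow_eq_one,
    one_pow]

theorem dir_inj {D : ℕ} (hD : D ≠ 0) {j k : ℕ} (hj : j < D) (hk : k < D)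
    (h : dir D j = dir D k) : j = k := by
  rw [dir_eq_pow, dir_eq_pow] at h
  exact (Complex.isPrimitiveRoot_exp D hD).pow_inj hj hk h

theorem dir_half {D : ℕ} (hD : Even D) (hD0 : D ≠ 0) : dir D (D / 2) = -1 := by
  have hD' : (D : ℂ) ≠ 0 := Nat.cast_ne_zero.2 hD0
  rw [dir, ← Complex.exp_pi_mul_I, Nat.cast_div hD.two_dvd two_ne_zero]
  congr 1
  push_cast
  field_simp

theorem mem_ray_iff {D k : ℕ} {z : ℂ} :
    z ∈ ray D k ↔ 0 ≤ (z / dir D k).re ∧ (z / dir D k).im = 0 := by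
  constructor
  · rintro ⟨t, ht, rfl⟩
    simp [ht]
  · rintro ⟨hre, him⟩
    refine ⟨(z / dir D k).re, hre, ?_⟩
    have quotient_real : ((z / dir D k).re : ℂ) = z / dir D k :=
      Complex.ext (by simp) (by simp [him])
    rw [quotient_real, div_mul_cancel₀ _ (dir_ne_zero D k)]

theorem isClosed_ray (D k : ℕ) : IsClosed (ray D k) := by
  have ray_eq : ray D k = {z | 0 ≤ (z / dir D k).re} ∩ {z | (z / dir D k).im = 0} :=
    Set.ext fun z => mem_ray_iff
  rw [ray_eq]
  exact (isClosed_le continuous_const (by fun_prop)).inter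
    (isClosed_eq (by fun_prop) continuous_const)

theorem zero_mem_ray (D k : ℕ) : (0 : ℂ) ∈ ray D k := ⟨0, le_rfl, by simp⟩

theorem mem_contour_iff {D : ℕ} (hD : 2 ≤ D) {z : ℂ} :
    z ∈ contour D ↔ ∃ k < D, z ∈ ray D k := by
  constructor
  · rintro ⟨j, -, h2, h | h⟩
    exacts [⟨0, by omega, h⟩, ⟨j, h2, h⟩]
  · rintro ⟨k, hk, h⟩
    rcases Nat.eq_zero_or_pos k with rfl | h0
    · exact ⟨1, le_rfl, by omega, Or.inl h⟩
    · exact ⟨k, h0, hk, Or.inr h⟩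

theorem isClosed_contour {D : ℕ} (hD : 2 ≤ D) : IsClosed (contour D) := by
  have contour_eq : contour D = ⋃ k ∈ Finset.range D, ray D k := by
    ext z
    simp [mem_contour_iff hD]
  exact contour_eq ▸ isClosed_biUnion_finset fun k _ => isClosed_ray D k

theorem eq_of_mem_ray {D j k : ℕ} (hD : D ≠ 0) (hj : j < D) (hk : k < D) {z : ℂ} (hz : z ≠ 0)
    (h1 : z ∈ ray D j) (h2 : z ∈ ray D k) : j = k := by
  obtain ⟨s, hs, rfl⟩ := h1
  obtain ⟨t, ht, h⟩ := h2
  have hst : s = t := by simpa [abs_of_nonneg hs, abs_of_nonneg ht] using congrArg norm h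
  have hs0 : (s : ℂ) ≠ 0 := left_ne_zero_of_mul hz
  rw [← hst] at h
  exact dir_inj hD hj hk (mul_left_cancel₀ hs0 h)

theorem div_dir_re_pos {D k : ℕ} {x : ℂ} (hx : x ∈ ray D k) (hx0 : x ≠ 0) :
    0 < (x / dir D k).re := by
  obtain ⟨h1, h2⟩ := mem_ray_iff.1 hx
  refine lt_of_le_of_ne h1 fun h => hx0 ?_
  have quotient_zero : x / dir D k = 0 := Complex.ext h.symm h2
  simpa using quotient_zero

theorem eventually_mem_contour_iff {D k : ℕ} (hD : 2 ≤ D) (hk : k < D) {x : ℂ}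
    (hx : x ∈ ray D k) (hx0 : x ≠ 0) :
    ∀ᶠ z in 𝓝 x, (z ∈ contour D ↔ (z / dir D k).im = 0) := by
  have off_other_rays : ∀ᶠ z in 𝓝 x, ∀ j ∈ (Finset.range D).erase k, z ∉ ray D j := by
    rw [Filter.eventually_all_finset]
    intro j hj
    rw [Finset.mem_erase, Finset.mem_range] at hj
    exact (isClosed_ray D j).isOpen_compl.mem_nhds fun h =>
      hj.1 (eq_of_mem_ray (by omega) hj.2 hk hx0 h hx)
  have re_pos : ∀ᶠ z in 𝓝 x, 0 < (z / dir D k).re :=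
    (isOpen_lt continuous_const (by fun_prop)).mem_nhds (div_dir_re_pos hx hx0)
  filter_upwards [off_other_rays, re_pos] with z hz hre
  rw [mem_contour_iff hD]
  refine ⟨?_, fun h => ⟨k, hk, mem_ray_iff.2 ⟨hre.le, h⟩⟩⟩
  rintro ⟨j, hj, hzj⟩
  obtain rfl : j = k := by
    by_contra hjk
    exact hz j (by simp [hjk, hj]) hzj
  exact (mem_ray_iff.1 hzj).2

theorem tangent_ne_zero (D k : ℕ) : tangent D k ≠ 0 := by
  unfold tangent
  split_ifs <;> simp

theorem im_div_tangent (D k : ℕ) (z : ℂ) :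
    (z / tangent D k).im = (if k = 0 then 1 else -1) * (z / dir D k).im := by
  unfold tangent
  split_ifs <;> simp [div_neg]

theorem im_div_tangent_eq_zero_iff {D k : ℕ} {z : ℂ} :
    (z / tangent D k).im = 0 ↔ (z / dir D k).im = 0 := by
  rw [im_div_tangent]
  split_ifs <;> simp

theorem nhdsWithin_compl_contour_le {D k : ℕ} (hD : 2 ≤ D) (hk : k < D) {x : ℂ}
    (hx : x ∈ ray D k) (hx0 : x ≠ 0) :
    𝓝[(contour D)ᶜ] x ≤ 𝓝[leftSide D k \ contour D] x ⊔ 𝓝[rightSide D k \ contour D] x := by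
  rw [← nhdsWithin_union, nhdsWithin_le_iff]
  filter_upwards [self_mem_nhdsWithin,
    (eventually_mem_contour_iff hD hk hx hx0).filter_mono nhdsWithin_le_nhds] with z hz hiff
  have him : (z / tangent D k).im ≠ 0 := fun h =>
    hz (hiff.2 (im_div_tangent_eq_zero_iff.1 h))
  rcases lt_or_gt_of_ne him with h | h
  exacts [Or.inr ⟨h, hz⟩, Or.inl ⟨h, hz⟩]

theorem isOpenMap_im_div {d : ℂ} (hd : d ≠ 0) : IsOpenMap fun z : ℂ => (z / d).im := by
  simp only [div_eq_mul_inv]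
  exact Complex.isOpenMap_im.comp (Homeomorph.mulRight₀ d⁻¹ (inv_ne_zero hd)).isOpenMap

theorem dense_compl_contour {D : ℕ} (hD : 2 ≤ D) : Dense (contour D)ᶜ := by
  have off_lines : Dense (⋂ k : Fin D, {z : ℂ | (z / dir D k).im ≠ 0}) :=
    dense_iInter_of_isOpen (fun k => isOpen_ne_fun (by fun_prop) continuous_const) fun k =>
      (dense_compl_singleton (0 : ℝ)).preimage (isOpenMap_im_div (dir_ne_zero D k))
  refine off_lines.mono fun z hz hc => ?_
  obtain ⟨k, hk, h⟩ := (mem_contour_iff hD).1 hc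
  exact Set.mem_iInter.1 hz ⟨k, hk⟩ (mem_ray_iff.1 h).2

theorem mem_closure_preimage_im_div_tangent_sdiff_contour {D k : ℕ} (hD : 2 ≤ D) (hk : k < D)
    {x : ℂ} (hx : x ∈ ray D k) (hx0 : x ≠ 0) {s : Set ℝ} (hs0 : 0 ∉ s) (hs : 0 ∈ closure s) :
    x ∈ closure ((fun z => (z / tangent D k).im) ⁻¹' s \ contour D) := by
  have hx_closure : x ∈ closure ((fun z => (z / tangent D k).im) ⁻¹' s) := by
    rw [← (isOpenMap_im_div (tangent_ne_zero D k)).preimage_closure_eq_closure_preimage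
      (by fun_prop), Set.mem_preimage, im_div_tangent_eq_zero_iff.2 (mem_ray_iff.1 hx).2]
    exact hs
  rw [mem_closure_iff_frequently] at hx_closure ⊢
  refine (hx_closure.and_eventually (eventually_mem_contour_iff hD hk hx hx0)).mono ?_
  refine fun z ⟨hz, hiff⟩ => ⟨hz, fun hc => hs0 ?_⟩
  rwa [Set.mem_preimage, im_div_tangent_eq_zero_iff.2 (hiff.1 hc)] at hz

theorem neBot_nhdsWithin_leftSide {D k : ℕ} (hD : 2 ≤ D) (hk : k < D) {x : ℂ}
    (hx : x ∈ ray D k) (hx0 : x ≠ 0) : (𝓝[leftSide D k \ contour D] x).NeBot :=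
  mem_closure_iff_nhdsWithin_neBot.1 (mem_closure_preimage_im_div_tangent_sdiff_contour hD hk hx hx0
    (s := Set.Ioi 0) (by simp) (by simp))

theorem neBot_nhdsWithin_rightSide {D k : ℕ} (hD : 2 ≤ D) (hk : k < D) {x : ℂ}
    (hx : x ∈ ray D k) (hx0 : x ≠ 0) : (𝓝[rightSide D k \ contour D] x).NeBot :=
  mem_closure_iff_nhdsWithin_neBot.1 (mem_closure_preimage_im_div_tangent_sdiff_contour hD hk hx hx0
    (s := Set.Iio 0) (by simp) (by simp))

theorem zero_mem_contour {D : ℕ} (hD : 2 ≤ D) : (0 : ℂ) ∈ contour D :=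
  (mem_contour_iff hD).2 ⟨0, by omega, zero_mem_ray D 0⟩

theorem ne_zero_of_notMem_contour {D : ℕ} (hD : 2 ≤ D) {z : ℂ} (hz : z ∉ contour D) : z ≠ 0 :=
  fun h => hz (h ▸ zero_mem_contour hD)

/-! ### Functions without a jump across the contour -/

theorem exists_entire_of_bounded_near_zero {g : ℂ → ℂ} (hg : DifferentiableOn ℂ g {0}ᶜ) {S : Set ℂ}
    (hS : Dense S) {r C : ℝ} (hr : 0 < r) (hb : ∀ z ∈ S, z ≠ 0 → ‖z‖ < r → ‖g z‖ ≤ C) :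
    ∃ G : ℂ → ℂ, Differentiable ℂ G ∧ ∀ z, z ≠ 0 → G z = g z := by
  have punctured_open : IsOpen (Metric.ball (0 : ℂ) r \ {0}) :=
    Metric.isOpen_ball.sdiff isClosed_singleton
  have bounded : ∀ z ∈ Metric.ball (0 : ℂ) r \ {0}, ‖g z‖ ≤ C := by
    intro z hz
    have : (𝓝[(Metric.ball (0 : ℂ) r \ {0}) ∩ S] z).NeBot :=
      mem_closure_iff_nhdsWithin_neBot.1 (hS.open_subset_closure_inter punctured_open hz)
    have hsub : (Metric.ball (0 : ℂ) r \ {0}) ∩ S ⊆ {0}ᶜ := fun w hw => hw.1.2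
    refine le_of_tendsto ((hg.continuousOn z hz.2).mono hsub).norm ?_
    filter_upwards [self_mem_nhdsWithin] with w hw
    exact hb w hw.2 hw.1.2 (by simpa using hw.1.1)
  have removable := Complex.differentiableOn_update_limUnder_of_bddAbove
    (Metric.ball_mem_nhds (0 : ℂ) hr) (hg.mono fun z hz => hz.2)
    ⟨C, Set.forall_mem_image.2 bounded⟩
  refine ⟨Function.update g 0 (limUnder (𝓝[≠] 0) g), fun z => ?_,
    fun z hz => Function.update_of_ne hz _ _⟩
  rcases eq_or_ne z 0 with rfl | hz
  · exact removable.differentiableAt (Metric.ball_mem_nhds 0 hr)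
  · have hn := isOpen_compl_singleton.mem_nhds hz
    exact (hg.differentiableAt hn).congr_of_eventuallyEq
      (eventually_of_mem hn fun w hw => Function.update_of_ne hw _ _)

theorem exists_continuousOn_of_no_jump {Y : Type*} [TopologicalSpace Y] [T3Space Y] {D : ℕ}
    (hD : 2 ≤ D) {f : ℂ → Y} (hf : ContinuousOn f (contour D)ᶜ)
    (hj : ∀ k < D, ∀ x ∈ ray D k, x ≠ 0 → ∃ l, Tendsto f (𝓝[leftSide D k \ contour D] x) (𝓝 l) ∧
      Tendsto f (𝓝[rightSide D k \ contour D] x) (𝓝 l)) :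
    ∃ g : ℂ → Y, ContinuousOn g {0}ᶜ ∧ Set.EqOn g f (contour D)ᶜ := by
  refine ⟨extendFrom (contour D)ᶜ f,
    continuousOn_extendFrom (fun x _ => dense_compl_contour hD x) fun x hx => ?_,
    fun z hz => extendFrom_eq (subset_closure hz) (hf z hz)⟩
  by_cases hxc : x ∈ contour D
  · obtain ⟨k, hk, hxk⟩ := (mem_contour_iff hD).1 hxc
    obtain ⟨l, hleft, hright⟩ := hj k hk x hxk hx
    exact ⟨l, (hleft.sup hright).mono_left (nhdsWithin_compl_contour_le hD hk hxk hx)⟩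
  · exact ⟨f x, hf x hxc⟩

theorem differentiableOn_compl_zero_of_continuousOn {E : Type*} [NormedAddCommGroup E]
    [NormedSpace ℂ E] [CompleteSpace E] {D : ℕ} (hD : 2 ≤ D) {f : ℂ → E}
    (hc : ContinuousOn f {0}ᶜ) (hd : DifferentiableOn ℂ f (contour D)ᶜ) :
    DifferentiableOn ℂ f {0}ᶜ := by
  have hd' : ∀ z, z ∉ contour D → DifferentiableAt ℂ f z := fun z hz =>
    hd.differentiableAt ((isClosed_contour hD).isOpen_compl.mem_nhds hz)
  intro x hx
  by_cases hxc : x ∈ contour D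
  · obtain ⟨k, hk, hxk⟩ := (mem_contour_iff hD).1 hxc
    obtain ⟨U, hU, hUo, hxU⟩ := _root_.eventually_nhds_iff.1
      ((eventually_mem_contour_iff hD hk hxk hx).and (isOpen_compl_singleton.mem_nhds hx))
    have hfU : DifferentiableOn ℂ f U :=
      differentiableOn_of_continuousOn_of_div_im_ne_zero (dir_ne_zero D k) hUo
        (hc.mono fun z hz => (hU z hz).2) fun z hz hi => hd' z fun h => hi ((hU z hz).1.1 h)
    exact (hfU.differentiableAt (hUo.mem_nhds hxU)).differentiableWithinAt
  · exact (hd' x hxc).differentiableWithinAt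

theorem exists_entire_of_no_jump {D : ℕ} (hD : 2 ≤ D) {f : ℂ → ℂ}
    (hf : DifferentiableOn ℂ f (contour D)ᶜ)
    (hj : ∀ k < D, ∀ x ∈ ray D k, x ≠ 0 → ∃ l, Tendsto f (𝓝[leftSide D k \ contour D] x) (𝓝 l) ∧
      Tendsto f (𝓝[rightSide D k \ contour D] x) (𝓝 l))
    (hb : ∃ r > (0 : ℝ), ∃ C : ℝ, ∀ z, z ∉ contour D → ‖z‖ < r → ‖f z‖ ≤ C) :
    ∃ g : ℂ → ℂ, Differentiable ℂ g ∧ ∀ z, z ∉ contour D → f z = g z := by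
  obtain ⟨g, hgc, hgf⟩ := exists_continuousOn_of_no_jump hD hf.continuousOn hj
  have hg : DifferentiableOn ℂ g {0}ᶜ :=
    differentiableOn_compl_zero_of_continuousOn hD hgc (hf.congr hgf)
  obtain ⟨r, hr, C, hC⟩ := hb
  obtain ⟨G, hG, hGg⟩ := exists_entire_of_bounded_near_zero hg (dense_compl_contour hD) hr
    fun z hz _ hzr => (hgf hz).symm ▸ hC z hz hzr
  exact ⟨G, hG, fun z hz => by rw [hGg z (ne_zero_of_notMem_contour hD hz), hgf hz]⟩

/-! ### Exponential weights on the rays -/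

theorem exists_norm_eval_le (p : ℂ[X]) {N : ℕ} (hN : p.natDegree ≤ N) :
    ∃ B, 0 ≤ B ∧ ∀ z, ‖p.eval z‖ ≤ B * (1 + ‖z‖) ^ N := by
  refine ⟨∑ i ∈ Finset.range (N + 1), ‖p.coeff i‖, by positivity, fun z => ?_⟩
  rw [eval_eq_sum_range' (Nat.lt_succ_of_le hN), Finset.sum_mul]
  refine (norm_sum_le _ _).trans (Finset.sum_le_sum fun i hi => ?_)
  rw [norm_mul, norm_pow]
  gcongr ‖p.coeff i‖ * ?_
  calc ‖z‖ ^ i ≤ (1 + ‖z‖) ^ i := by gcongr; linarith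
    _ ≤ (1 + ‖z‖) ^ N :=
      pow_le_pow_right₀ (by linarith [norm_nonneg z]) (Finset.mem_range_succ_iff.1 hi)

theorem norm_pow_sub_pow_le {R : Type*} [NormedCommRing R] [NormOneClass R] {x y : R} {M : ℝ}
    (hx : ‖x‖ ≤ M) (hy : ‖y‖ ≤ M) (n : ℕ) :
    ‖x ^ n - y ^ n‖ ≤ n * M ^ (n - 1) * ‖x - y‖ := by
  rw [← geom_sum₂_mul]
  refine (norm_mul_le _ _).trans (mul_le_mul_of_nonneg_right ?_ (norm_nonneg _))
  calc ‖∑ i ∈ Finset.range n, x ^ i * y ^ (n - 1 - i)‖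
      ≤ ∑ _i ∈ Finset.range n, M ^ (n - 1) := by
        refine norm_sum_le_of_le _ fun i hi => ?_
        calc ‖x ^ i * y ^ (n - 1 - i)‖ ≤ ‖x‖ ^ i * ‖y‖ ^ (n - 1 - i) :=
              (norm_mul_le _ _).trans (mul_le_mul (norm_pow_le _ _) (norm_pow_le _ _)
                (norm_nonneg _) (by positivity))
          _ ≤ M ^ i * M ^ (n - 1 - i) := by gcongr; exact pow_nonneg ((norm_nonneg x).trans hx) i
          _ = M ^ (n - 1) := by
              rw [← pow_add, Nat.add_sub_of_le (Nat.le_sub_one_of_lt (Finset.mem_range.1 hi))]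
    _ = n * M ^ (n - 1) := by simp

theorem exists_eval_le_eval_add {P Q : ℝ[X]} (hQ : Q.degree < P.degree) (hP : 0 < P.degree)
    (hP_lead : 0 ≤ P.leadingCoeff) : ∃ K, ∀ t, 0 ≤ t → Q.eval t ≤ P.eval t + K := by
  have top : Tendsto (fun t => (P - Q).eval t) atTop atTop :=
    (P - Q).tendsto_atTop_of_leadingCoeff_nonneg
      (by rwa [degree_sub_eq_left_of_degree_lt hQ])
      (by rwa [leadingCoeff_sub_of_degree_lt hQ])
  obtain ⟨T, hT⟩ := eventually_atTop.1 (top.eventually_ge_atTop 0)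
  obtain ⟨K, hK⟩ := isCompact_Icc.bddBelow_image (f := fun t => (P - Q).eval t)
    (K := Set.Icc 0 T) (by fun_prop)
  refine ⟨max 0 (-K), fun t ht => ?_⟩
  rcases le_total T t with h | h
  · have := hT t h
    rw [eval_sub] at this
    linarith [le_max_left 0 (-K)]
  · have := hK (Set.mem_image_of_mem _ ⟨ht, h⟩)
    rw [eval_sub] at this
    linarith [le_max_right 0 (-K)]

theorem exists_add_le_mul_pow {c : ℝ} (hc : 0 < c) (B : ℝ) {D : ℕ} (hD : 2 ≤ D) :
    ∃ K, ∀ t : ℝ, 0 ≤ t → B * (2 + t) ^ (D - 1) + 2 * t ≤ c * t ^ D + K := by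
  have degP : (C c * X ^ D).degree = (D : WithBot ℕ) := degree_C_mul_X_pow D hc.ne'
  have degQ : (C B * (C 2 + X) ^ (D - 1) + C 2 * X).degree < (C c * X ^ D).degree := by
    rw [degP]
    refine lt_of_le_of_lt (b := ((D - 1 : ℕ) : WithBot ℕ)) ?_ (by exact_mod_cast (by omega))
    refine natDegree_le_iff_degree_le.1 ?_
    compute_degree
    omega
  simpa using exists_eval_le_eval_add degQ
    (by rw [degP]; exact_mod_cast (by omega)) (by simpa using hc.le)

section HalfStrip

variable {D : ℕ} {u : ℂ}

theorem norm_sub_re_le_one (hu : |u.im| ≤ 1) : ‖u - u.re‖ ≤ 1 := by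
  have : u - u.re = u.im * Complex.I := by
    rw [sub_eq_iff_eq_add, add_comm, Complex.re_add_im]
  simpa [this] using hu

theorem norm_mul_dir_le (k : ℕ) (h0 : 0 ≤ u.re) (h1 : |u.im| ≤ 1) :
    ‖u * dir D k‖ ≤ 1 + u.re := by
  rw [norm_mul, norm_dir, mul_one]
  refine (Complex.norm_le_abs_re_add_abs_im u).trans ?_
  rw [abs_of_nonneg h0]
  linarith

theorem exists_norm_eval_mul_dir_le_exp (p : ℂ[X]) (k : ℕ) :
    ∃ K, 0 ≤ K ∧ ∀ u : ℂ, 0 ≤ u.re → |u.im| ≤ 1 →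
      ‖p.eval (u * dir D k)‖ ≤ K * Real.exp u.re := by
  obtain ⟨B, hB, hp⟩ := exists_norm_eval_le p le_rfl
  refine ⟨B * (p.natDegree.factorial * Real.exp 2), by positivity, fun u h0 h1 => ?_⟩
  have hpow := Real.pow_div_factorial_le_exp (2 + u.re) (by linarith) p.natDegree
  rw [div_le_iff₀ (by positivity), Real.exp_add] at hpow
  calc ‖p.eval (u * dir D k)‖ ≤ B * (1 + ‖u * dir D k‖) ^ p.natDegree := hp _
    _ ≤ B * (2 + u.re) ^ p.natDegree := by
      gcongr B * ?_ ^ _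
      linarith [norm_mul_dir_le (D := D) k h0 h1]
    _ ≤ B * (Real.exp 2 * Real.exp u.re * p.natDegree.factorial) := by gcongr
    _ = _ := by ring

end HalfStrip

/-- The potentials considered here: complex polynomials of degree `D` with positive leading
coefficient. -/
structure IsPotential (D : ℕ) (U : ℂ[X]) : Prop where
  natDegree_eq : U.natDegree = D
  leadingCoeff_pos : ∃ c : ℝ, 0 < c ∧ U.leadingCoeff = c

theorem IsPotential.exists_le_re_eval {D : ℕ} {U : ℂ[X]} (hU : IsPotential D U) (hD : D ≠ 0)
    (k : ℕ) :
    ∃ c > (0 : ℝ), ∃ B : ℝ, ∀ u : ℂ, 0 ≤ u.re → |u.im| ≤ 1 →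
      c * u.re ^ D - B * (2 + u.re) ^ (D - 1) ≤ (U.eval (u * dir D k)).re := by
  obtain ⟨c, hc, hlc⟩ := hU.leadingCoeff_pos
  obtain ⟨B, hB, hlower⟩ :=
    exists_norm_eval_le U.eraseLead (hU.natDegree_eq ▸ eraseLead_natDegree_le U)
  refine ⟨c, hc, c * D + B, fun u h0 h1 => ?_⟩
  have hnorm := norm_mul_dir_le (D := D) k h0 h1
  have hu : ‖u‖ ≤ 2 + u.re := by
    rw [norm_mul, norm_dir, mul_one] at hnorm
    linarith
  have split : U.eval (u * dir D k) = (c * u.re ^ D : ℝ)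
      + (c * (u ^ D - (u.re : ℂ) ^ D) + U.eraseLead.eval (u * dir D k)) := by
    have := congrArg (eval (u * dir D k)) (eraseLead_add_C_mul_X_pow U)
    rw [eval_add, eval_mul, eval_C, eval_pow, eval_X, hlc, hU.natDegree_eq, mul_pow,
      dir_pow_self hD] at this
    rw [← this]
    push_cast
    ring
  have hpow : ‖u ^ D - (u.re : ℂ) ^ D‖ ≤ D * (2 + u.re) ^ (D - 1) :=
    (norm_pow_sub_pow_le hu (by simp [abs_of_nonneg h0]) D).trans
      (mul_le_of_le_one_right (by positivity) (norm_sub_re_le_one h1))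
  have remainder : ‖c * (u ^ D - (u.re : ℂ) ^ D) + U.eraseLead.eval (u * dir D k)‖
      ≤ (c * D + B) * (2 + u.re) ^ (D - 1) := by
    refine (norm_add_le _ _).trans ?_
    rw [norm_mul, Complex.norm_real, Real.norm_of_nonneg hc.le, add_mul, mul_assoc c]
    refine add_le_add (by gcongr) ((hlower _).trans ?_)
    gcongr B * ?_ ^ _
    linarith
  rw [split, Complex.add_re, Complex.ofReal_re]
  linarith [(abs_le.1 ((Complex.abs_re_le_norm _).trans remainder)).1]

theorem IsPotential.exists_norm_mul_exp_le {D : ℕ} {U : ℂ[X]} (hU : IsPotential D U) (hD : 2 ≤ D)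
    (k : ℕ) (p : ℂ[X]) (B : ℝ) :
    ∃ K, 0 ≤ K ∧ ∀ u : ℂ, 0 ≤ u.re → |u.im| ≤ 1 →
      ‖p.eval (u * dir D k)‖ * Real.exp (-(U.eval (u * dir D k)).re + B * (2 + u.re) ^ (D - 1))
        ≤ K * Real.exp (-u.re) := by
  obtain ⟨c, hc, B', hU'⟩ := hU.exists_le_re_eval (by omega) k
  obtain ⟨Kp, hKp, hp⟩ := exists_norm_eval_mul_dir_le_exp (D := D) p k
  obtain ⟨K, hK⟩ := exists_add_le_mul_pow hc (B' + B) hD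
  refine ⟨Kp * Real.exp K, by positivity, fun u h0 h1 => ?_⟩
  calc ‖p.eval (u * dir D k)‖ * Real.exp (-(U.eval (u * dir D k)).re + B * (2 + u.re) ^ (D - 1))
      ≤ (Kp * Real.exp u.re) * Real.exp (K - 2 * u.re) := by
        gcongr
        · exact hp u h0 h1
        · linarith [hU' u h0 h1, hK u.re h0]
    _ = Kp * Real.exp K * Real.exp (-u.re) := by
        rw [mul_assoc Kp, ← Real.exp_add, mul_assoc Kp, ← Real.exp_add]
        congr 2
        ring

/-- The entire function `p e^{-U}`. -/
def weighted (U p : ℂ[X]) (z : ℂ) : ℂ := p.eval z * Complex.exp (-U.eval z)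

/-- The operator `q ↦ q' - U' q`, for which `(q e^{-U})' = (q' - U' q) e^{-U}`. -/
def twist {R : Type*} [CommRing R] (U : R[X]) : R[X] →ₗ[R] R[X] :=
  derivative - LinearMap.mulLeft R (derivative U)

theorem twist_apply {R : Type*} [CommRing R] (U q : R[X]) :
    twist U q = derivative q - derivative U * q := rfl

theorem hasDerivAt_weighted (U q : ℂ[X]) (z : ℂ) :
    HasDerivAt (weighted U q) (weighted U (twist U q) z) z := by
  have h := (q.hasDerivAt z).mul ((U.hasDerivAt z).fun_neg.cexp)
  refine h.congr_deriv ?_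
  simp only [weighted, twist_apply, eval_sub, eval_mul]
  ring

theorem differentiable_weighted (U q : ℂ[X]) : Differentiable ℂ (weighted U q) :=
  fun z => (hasDerivAt_weighted U q z).differentiableAt

theorem continuous_weighted (U q : ℂ[X]) : Continuous (weighted U q) :=
  (differentiable_weighted U q).continuous

theorem deriv_weighted (U q : ℂ[X]) : deriv (weighted U q) = weighted U (twist U q) :=
  funext fun z => (hasDerivAt_weighted U q z).deriv

theorem weighted_mul (U p q : ℂ[X]) (z : ℂ) : weighted U (p * q) z = p.eval z * weighted U q z := by
  simp [weighted, mul_assoc]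

/-- Exponential decay on the half-strip around the positive half-axis. -/
def HalfDecay (f : ℂ → ℂ) : Prop :=
  ∃ C, 0 ≤ C ∧ ∀ u : ℂ, 0 ≤ u.re → |u.im| ≤ 1 → ‖f u‖ ≤ C * Real.exp (-u.re)

/-- Exponential decay on the half-strip around the ray `C_k`. -/
def StripDecay (D k : ℕ) (f : ℂ → ℂ) : Prop := HalfDecay fun u => f (u * dir D k)

theorem IsPotential.stripDecay {D : ℕ} {U : ℂ[X]} (hU : IsPotential D U) (hD : 2 ≤ D)
    (k : ℕ) (p : ℂ[X]) : StripDecay D k (weighted U p) := by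
  obtain ⟨K, hK0, hK⟩ := hU.exists_norm_mul_exp_le hD k p 0
  refine ⟨K, hK0, fun u h0 h1 => ?_⟩
  simpa [weighted, Complex.norm_exp] using hK u h0 h1

theorem HalfDecay.norm_ofReal_le {f : ℂ → ℂ} (hf : HalfDecay f) :
    ∃ C, 0 ≤ C ∧ ∀ t : ℝ, 0 ≤ t → ‖f t‖ ≤ C * Real.exp (-t) := by
  obtain ⟨C, hC0, hC⟩ := hf
  exact ⟨C, hC0, fun t ht => by simpa using hC t (by simpa using ht) (by simp)⟩

theorem integrableOn_exp_neg : IntegrableOn (fun t : ℝ => Real.exp (-t)) (Set.Ioi 0) := by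
  simpa using exp_neg_integrableOn_Ioi 0 one_pos

theorem HalfDecay.integrableOn {f : ℂ → ℂ} (hf : HalfDecay f) (hc : Continuous f) :
    IntegrableOn (fun t : ℝ => f t) (Set.Ioi 0) := by
  obtain ⟨C, -, hC⟩ := hf.norm_ofReal_le
  refine Integrable.mono' (integrableOn_exp_neg.const_mul C)
    (Continuous.aestronglyMeasurable (by fun_prop)) ?_
  exact (ae_restrict_mem measurableSet_Ioi).mono fun t ht => hC t (Set.mem_Ioi.1 ht).le

theorem HalfDecay.tendsto_zero {f : ℂ → ℂ} (hf : HalfDecay f) :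
    Tendsto (fun t : ℝ => f t) atTop (𝓝 0) := by
  obtain ⟨C, -, hC⟩ := hf.norm_ofReal_le
  refine squeeze_zero_norm' (a := fun t => C * Real.exp (-t)) ?_ ?_
  · filter_upwards [eventually_ge_atTop 0] with t ht using hC t ht
  · simpa using (Real.tendsto_exp_neg_atTop_nhds_zero).const_mul C

theorem StripDecay.integrableOn {D k : ℕ} {f : ℂ → ℂ} (hf : StripDecay D k f)
    (hc : Continuous f) : IntegrableOn (fun t : ℝ => f (t * dir D k)) (Set.Ioi 0) :=
  HalfDecay.integrableOn hf (by fun_prop)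

/-- The integral over the ray `C_k`, traversed outwards. -/
def rayIntegral (D k : ℕ) (f : ℂ → ℂ) : ℂ :=
  ∫ t in Set.Ioi (0 : ℝ), f (t * dir D k) * dir D k

theorem rayIntegral_add {D k : ℕ} {f g : ℂ → ℂ} (hf : StripDecay D k f) (hg : StripDecay D k g)
    (hfc : Continuous f) (hgc : Continuous g) :
    rayIntegral D k (fun z => f z + g z) = rayIntegral D k f + rayIntegral D k g := by
  simp only [rayIntegral, add_mul]
  exact integral_add ((hf.integrableOn hfc).mul_const _) ((hg.integrableOn hgc).mul_const _)

theorem rayIntegral_const_mul {D k : ℕ} (c : ℂ) (f : ℂ → ℂ) :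
    rayIntegral D k (fun z => c * f z) = c * rayIntegral D k f := by
  simp only [rayIntegral, mul_assoc]
  exact integral_const_mul c _

/-- The integral of `p e^{-U}` over the ray `C_k`, as a linear functional of `p`. -/
def rayMoment {D : ℕ} {U : ℂ[X]} (hU : IsPotential D U) (hD : 2 ≤ D) (k : ℕ) : ℂ[X] →ₗ[ℂ] ℂ where
  toFun p := rayIntegral D k (weighted U p)
  map_add' p q := by
    rw [← rayIntegral_add (hU.stripDecay hD k p) (hU.stripDecay hD k q)
      (continuous_weighted U p) (continuous_weighted U q)]
    congr 1 with z
    simp [weighted, add_mul]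
  map_smul' c p := by
    rw [RingHom.id_apply, smul_eq_mul, ← rayIntegral_const_mul]
    congr 1 with z
    simp [weighted, mul_assoc]

theorem rayMoment_apply {D : ℕ} {U : ℂ[X]} (hU : IsPotential D U) (hD : 2 ≤ D) (k : ℕ) (p : ℂ[X]) :
    rayMoment hU hD k p = rayIntegral D k (weighted U p) := rfl

theorem rayMoment_twist {D : ℕ} {U : ℂ[X]} (hU : IsPotential D U) (hD : 2 ≤ D) (k : ℕ) (q : ℂ[X]) :
    rayMoment hU hD k (twist U q) = -weighted U q 0 := by
  have primitive : ∀ t : ℝ, HasDerivAt (fun t : ℝ => weighted U q (t * dir D k))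
      (weighted U (twist U q) (t * dir D k) * dir D k) t := fun t =>
    (hasDerivAt_weighted U q (t * dir D k)).comp t
      (h := fun t : ℝ => (t : ℂ) * dir D k)
      (by simpa using (Complex.ofRealCLM.hasDerivAt (x := t)).mul_const (dir D k))
  have integrable := ((hU.stripDecay hD k (twist U q)).integrableOn
    (continuous_weighted _ _)).mul_const (dir D k)
  rw [rayMoment_apply, rayIntegral, integral_Ioi_of_hasDerivAt_of_tendsto'
    (fun t _ => primitive t) integrable (HalfDecay.tendsto_zero (hU.stripDecay hD k q))]
  simp

/-! ### Non-degeneracy of the pairing between polynomials and arcs -/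

theorem map_eq_zero_of_degree_lt {R M : Type*} [Semiring R] [AddCommMonoid M] [Module R M]
    {f : R[X] →ₗ[R] M} {N : ℕ} (hf : ∀ m < N, f (X ^ m) = 0) {p : R[X]} (hp : p.degree < N) :
    f p = 0 := by
  classical
  have span_le : degreeLT R N ≤ LinearMap.ker f := by
    rw [degreeLT_eq_span_X_pow, Submodule.span_le]
    intro q hq
    obtain ⟨m, hm, rfl⟩ := Finset.mem_image.1 hq
    exact hf m (Finset.mem_range.1 hm)
  exact span_le (mem_degreeLT.2 hp)

section Twist

variable {R : Type*} [CommRing R] [NoZeroDivisors R] [CharZero R] {U : R[X]}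

theorem degree_derivative_lt_degree_derivative_mul (hU : U.natDegree ≠ 0) {q : R[X]} (hq : q ≠ 0) :
    (derivative q).degree < (derivative U * q).degree := by
  rw [degree_mul, degree_derivative hU]
  refine (degree_derivative_lt hq).trans_le ?_
  exact le_add_of_nonneg_left (WithBot.coe_nonneg.2 (Nat.zero_le _))

theorem degree_twist (hU : U.natDegree ≠ 0) (q : R[X]) :
    (twist U q).degree = (U.natDegree - 1 : ℕ) + q.degree := by
  rcases eq_or_ne q 0 with rfl | hq
  · simp
  rw [twist_apply, degree_sub_eq_right_of_degree_lt
    (degree_derivative_lt_degree_derivative_mul hU hq), degree_mul, degree_derivative hU]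

theorem leadingCoeff_twist (hU : U.natDegree ≠ 0) {q : R[X]} (hq : q ≠ 0) :
    (twist U q).leadingCoeff = -(U.leadingCoeff * U.natDegree * q.leadingCoeff) := by
  rw [twist_apply, leadingCoeff_sub_of_degree_lt'
    (degree_derivative_lt_degree_derivative_mul hU hq), leadingCoeff_mul, leadingCoeff_derivative]

theorem degree_twist_lt_iff (hU : U.natDegree ≠ 0) {q : R[X]} {N : ℕ} :
    (twist U q).degree < (N + (U.natDegree - 1) : ℕ) ↔ q.degree < N := by
  rw [degree_twist hU, add_comm, Nat.cast_add]
  exact WithBot.add_lt_add_iff_right (WithBot.natCast_ne_bot _)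

theorem exists_eq_add_twist {K : Type*} [Field K] [CharZero K] {U : K[X]} (hU : U.natDegree ≠ 0)
    (p : K[X]) : ∃ p₀ q : K[X], p₀.degree < (U.natDegree - 1 : ℕ) ∧ p = p₀ + twist U q := by
  induction p using degree_lt_wf.induction with
  | _ p ih =>
    rcases lt_or_ge p.degree (U.natDegree - 1 : ℕ) with hp | hp
    · exact ⟨p, 0, hp, by simp⟩
    have hp0 : p ≠ 0 := fun h => by simp [h] at hp
    have hpU : U.natDegree - 1 ≤ p.natDegree := by
      rwa [degree_eq_natDegree hp0, Nat.cast_le] at hp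
    have hU0 : U.leadingCoeff * U.natDegree ≠ 0 :=
      mul_ne_zero (leadingCoeff_ne_zero.2 fun h => hU (by simp [h])) (Nat.cast_ne_zero.2 hU)
    obtain ⟨a, ha⟩ : ∃ a, -(U.leadingCoeff * U.natDegree * a) = p.leadingCoeff :=
      ⟨-p.leadingCoeff / (U.leadingCoeff * U.natDegree), by rw [mul_div_cancel₀ _ hU0, neg_neg]⟩
    have ha0 : a ≠ 0 := by
      rintro rfl
      exact hp0 (leadingCoeff_eq_zero.1 (by simpa using ha.symm))
    set q := C a * X ^ (p.natDegree - (U.natDegree - 1)) with hq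
    have hq0 : q ≠ 0 := mul_ne_zero (C_ne_zero.2 ha0) (pow_ne_zero _ X_ne_zero)
    have hdegree : p.degree = (twist U q).degree := by
      rw [degree_twist hU, hq, degree_C_mul_X_pow _ ha0, ← Nat.cast_add, Nat.add_sub_cancel' hpU,
        degree_eq_natDegree hp0]
    have hlead : p.leadingCoeff = (twist U q).leadingCoeff := by
      rw [leadingCoeff_twist hU hq0, hq, leadingCoeff_C_mul_X_pow, ha]
    obtain ⟨p₀, q', hp₀, h⟩ := ih _ (degree_sub_lt_left hdegree hp0 hlead)
    exact ⟨p₀, q' + q, hp₀, by rw [map_add, ← add_assoc, ← h, sub_add_cancel]⟩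

end Twist

section Expansion

variable {D : ℕ} {U : ℂ[X]}

theorem weighted_mul_exp_eraseLead (U p : ℂ[X]) (z : ℂ) :
    weighted U p z * Complex.exp (U.eraseLead.eval z)
      = weighted (C U.leadingCoeff * X ^ U.natDegree) p z := by
  have h := congrArg (eval z) (eraseLead_add_C_mul_X_pow U)
  rw [eval_add] at h
  rw [weighted, weighted, mul_assoc, ← Complex.exp_add, ← h]
  ring_nf

theorem weighted_C_mul_mul_pow (U p q : ℂ[X]) (c : ℂ) (m : ℕ) (z : ℂ) :
    weighted U (C c * (p * q ^ m)) z = weighted U p z * (c * q.eval z ^ m) := by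
  simp only [weighted, eval_mul, eval_C, eval_pow]
  ring

theorem IsPotential.integrableOn_norm_mul_exp_eraseLead (hU : IsPotential D U) (hD : 2 ≤ D)
    (k : ℕ) (p : ℂ[X]) :
    IntegrableOn (fun t : ℝ => ‖weighted U p (t * dir D k)‖
      * Real.exp ‖U.eraseLead.eval (t * dir D k)‖) (Set.Ioi 0) := by
  obtain ⟨B, hB, hlower⟩ := exists_norm_eval_le U.eraseLead (eraseLead_natDegree_le U)
  rw [hU.natDegree_eq] at hlower
  obtain ⟨K, -, hK⟩ := hU.exists_norm_mul_exp_le hD k p B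
  refine Integrable.mono' (integrableOn_exp_neg.const_mul K)
    (Continuous.aestronglyMeasurable ?_) ?_
  · have := continuous_weighted U p
    fun_prop
  refine (ae_restrict_mem measurableSet_Ioi).mono fun t ht => ?_
  have ht0 : (0 : ℝ) ≤ t := (Set.mem_Ioi.1 ht).le
  have hbound : ‖U.eraseLead.eval (t * dir D k)‖ ≤ B * (2 + t) ^ (D - 1) := by
    refine (hlower _).trans ?_
    rw [norm_mul, norm_dir, mul_one, Complex.norm_real, Real.norm_of_nonneg ht0]
    gcongr
    norm_num
  rw [Real.norm_of_nonneg (by positivity), weighted, norm_mul, Complex.norm_exp, mul_assoc,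
    ← Real.exp_add, Complex.neg_re]
  refine le_trans ?_ (by simpa using hK t (by simpa using ht0) (by simp))
  gcongr

theorem hasSum_rayMoment_eraseLead (hU : IsPotential D U) (hD : 2 ≤ D) (k : ℕ) (p : ℂ[X]) :
    HasSum (fun m : ℕ => rayMoment hU hD k (C ((m.factorial : ℂ)⁻¹) * (p * U.eraseLead ^ m)))
      (rayIntegral D k (weighted (C U.leadingCoeff * X ^ D) p)) := by
  have term (m : ℕ) (z : ℂ) : weighted U (C ((m.factorial : ℂ)⁻¹) * (p * U.eraseLead ^ m)) z
      = weighted U p z * (U.eraseLead.eval z ^ m / m.factorial) := by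
    rw [weighted_C_mul_mul_pow, div_eq_inv_mul]
  have series (z : ℂ) :
      HasSum (fun m : ℕ => weighted U p z * (U.eraseLead.eval z ^ m / m.factorial))
      (weighted (C U.leadingCoeff * X ^ D) p z) := by
    rw [← hU.natDegree_eq, ← weighted_mul_exp_eraseLead, Complex.exp_eq_exp_ℂ]
    exact (NormedSpace.expSeries_div_hasSum_exp (U.eraseLead.eval z)).mul_left _
  refine hasSum_integral_of_dominated_convergence
    (bound := fun m t => ‖weighted U p (t * dir D k)‖ *
      (‖U.eraseLead.eval (t * dir D k)‖ ^ m / m.factorial)) (fun m => ?_) (fun m => ?_) ?_ ?_ ?_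
  · exact (((continuous_weighted _ _).comp (by fun_prop)).mul
      continuous_const).aestronglyMeasurable
  · refine ae_of_all _ fun t => le_of_eq ?_
    rw [norm_mul, norm_dir, mul_one, term, norm_mul, norm_div, norm_pow, Complex.norm_natCast]
  · exact ae_of_all _ fun t => (Real.summable_pow_div_factorial _).mul_left _
  · refine (hU.integrableOn_norm_mul_exp_eraseLead hD k p).congr (ae_of_all _ fun t => ?_)
    simp only [tsum_mul_left, Real.exp_eq_exp_ℝ, NormedSpace.exp_eq_tsum_div]
  · refine ae_of_all _ fun t => ((series (t * dir D k)).mul_right (dir D k)).congr_fun fun m => ?_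
    rw [term]

theorem rayIntegral_monomial (hD : D ≠ 0) (c : ℝ) (k i : ℕ) :
    rayIntegral D k (weighted (C (c : ℂ) * X ^ D) (X ^ i))
      = dir D k ^ i * dir D k
        * ((∫ t in Set.Ioi (0 : ℝ), t ^ i * Real.exp (-(c * t ^ D)) : ℝ) : ℂ) := by
  rw [rayIntegral, ← integral_complex_ofReal, ← integral_const_mul]
  congr 1 with t
  simp only [weighted, eval_mul, eval_pow, eval_X, eval_C, mul_pow, dir_pow_self hD]
  push_cast
  ring_nf

theorem integral_pow_mul_exp_pos (hD : 0 < D) {c : ℝ} (hc : 0 < c) (i : ℕ) :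
    0 < ∫ t in Set.Ioi (0 : ℝ), t ^ i * Real.exp (-(c * t ^ D)) := by
  have gamma := integral_rpow_mul_exp_neg_mul_rpow (p := D) (q := i) (by positivity)
    ((by norm_num : (-1 : ℝ) < 0).trans_le i.cast_nonneg) hc
  simp only [Real.rpow_natCast, neg_mul] at gamma
  have : 0 < Real.Gamma ((i + 1) / D) := Real.Gamma_pos_of_pos (by positivity)
  rw [gamma]
  positivity

theorem sum_smul_rayMoment_eq_zero (hU : IsPotential D U) (hD : 2 ≤ D) {c : Fin D → ℂ}
    (hc : ∑ k, c k = 0) (h : ∀ m < D - 1, (∑ k, c k • rayMoment hU hD k) (X ^ m) = 0) :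
    ∑ k : Fin D, c k • rayMoment hU hD k = 0 := by
  refine LinearMap.ext fun p => ?_
  obtain ⟨p₀, q, hp₀, rfl⟩ := exists_eq_add_twist (U := U) (by rw [hU.natDegree_eq]; omega) p
  rw [hU.natDegree_eq] at hp₀
  rw [map_add, map_eq_zero_of_degree_lt h hp₀]
  simp only [LinearMap.sum_apply, LinearMap.smul_apply, rayMoment_twist, ← Finset.sum_smul, hc]
  simp

/- The vanishing functional is applied to the Taylor coefficients in `s` of `X ^ i e^{s W}`, `W` the
lower order part of `U`: at `s = 1` the potential becomes the monomial `c X ^ D`, for which the ray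
integrals are powers of the directions, and the Vandermonde determinant concludes. -/
theorem eq_zero_of_rayMoment_eq_zero (hU : IsPotential D U) (hD : 2 ≤ D) {c : Fin D → ℂ}
    (hc : ∑ k, c k = 0) (h : ∀ m < D - 1, (∑ k, c k • rayMoment hU hD k) (X ^ m) = 0) :
    c = 0 := by
  have functional_zero := sum_smul_rayMoment_eq_zero hU hD hc h
  obtain ⟨a, ha, hlead⟩ := hU.leadingCoeff_pos
  have vandermonde : ∀ i : Fin D, ∑ k : Fin D, (c k * dir D k) * dir D k ^ (i : ℕ) = 0 := by
    intro i
    have expansion := hasSum_sum (s := Finset.univ) fun (k : Fin D) _ =>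
      (hasSum_rayMoment_eraseLead hU hD k (X ^ (i : ℕ))).mul_left (c k)
    have terms_zero (p : ℂ[X]) : ∑ k : Fin D, c k * rayMoment hU hD k p = 0 := by
      simpa using LinearMap.congr_fun functional_zero p
    simp only [terms_zero, hlead, rayIntegral_monomial (by omega : D ≠ 0)] at expansion
    refine (mul_eq_zero.1 ?_).resolve_right
      (Complex.ofReal_ne_zero.2 (integral_pow_mul_exp_pos (by omega : 0 < D) ha i).ne')
    rw [← expansion.unique hasSum_zero, Finset.sum_mul]
    exact Finset.sum_congr rfl fun k _ => by ring
  have hcd := Matrix.eq_zero_of_forall_pow_sum_mul_pow_eq_zero (f := fun k : Fin D => dir D k)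
    (fun j k hjk => Fin.ext (dir_inj (by omega) j.2 k.2 hjk)) vandermonde
  ext k
  simpa using congrFun hcd k

end Expansion

/-! ### The Cauchy transform on a half-line -/

theorem exists_forall_mem_ball_le_dist {X : Type*} [PseudoMetricSpace X] {S : Set X}
    (hS : IsClosed S) {u : X} (hu : u ∉ S) :
    ∃ δ > 0, ∀ v ∈ Metric.ball u δ, ∀ w ∈ S, δ ≤ dist w v := by
  obtain ⟨ε, hε, hball⟩ := Metric.isOpen_iff.1 hS.isOpen_compl u hu
  refine ⟨ε / 2, half_pos hε, fun v hv w hw => ?_⟩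
  by_contra! hlt
  refine hball (Metric.mem_ball.2 ?_) hw
  linarith [dist_triangle w v u, Metric.mem_ball.1 hv]

section CauchyKernel

variable {f : ℝ → ℂ} {s : Set ℝ} {S : Set ℂ} {u : ℂ}

theorem integrableOn_div_sub (hs : MeasurableSet s) (hf : IntegrableOn f s) (hS : IsClosed S)
    (hsS : ∀ t ∈ s, (t : ℂ) ∈ S) (hu : u ∉ S) : IntegrableOn (fun t : ℝ => f t / (t - u)) s := by
  obtain ⟨δ, hδ, hdist⟩ := exists_forall_mem_ball_le_dist hS hu
  have hm := hf.aestronglyMeasurable.aemeasurable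
  refine Integrable.mono' (hf.norm.mul_const δ⁻¹) (AEMeasurable.aestronglyMeasurable (by fun_prop))
    ((ae_restrict_mem hs).mono fun t ht => ?_)
  rw [norm_div, div_eq_mul_inv]
  have := hdist u (Metric.mem_ball_self hδ) t (hsS t ht)
  rw [dist_eq_norm] at this
  gcongr

theorem differentiableAt_integral_div_sub (hs : MeasurableSet s) (hf : IntegrableOn f s)
    (hS : IsClosed S) (hsS : ∀ t ∈ s, (t : ℂ) ∈ S) (hu : u ∉ S) :
    DifferentiableAt ℂ (fun v => ∫ t in s, f t / (t - v)) u := by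
  obtain ⟨δ, hδ, hdist⟩ := exists_forall_mem_ball_le_dist hS hu
  have hm := hf.aestronglyMeasurable.aemeasurable
  refine (hasDerivAt_integral_of_dominated_loc_of_deriv_le (Metric.ball_mem_nhds u hδ)
    (μ := volume.restrict s) (F := fun v (t : ℝ) => f t / (t - v))
    (F' := fun v (t : ℝ) => f t / (t - v) ^ 2) (bound := fun t : ℝ => ‖f t‖ * (δ ^ 2)⁻¹)
    (Eventually.of_forall fun v => AEMeasurable.aestronglyMeasurable (by fun_prop))
    (integrableOn_div_sub hs hf hS hsS hu) (AEMeasurable.aestronglyMeasurable (by fun_prop))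
    ((ae_restrict_mem hs).mono fun t ht v hv => ?_) (hf.norm.mul_const _)
    ((ae_restrict_mem hs).mono fun t ht v hv => ?_)).2.differentiableAt
  · have := hdist v hv t (hsS t ht)
    rw [dist_eq_norm] at this
    rw [norm_div, norm_pow, div_eq_mul_inv]
    gcongr
  · have hne : (t : ℂ) - v ≠ 0 := fun h => by
      have := hdist v hv t (hsS t ht)
      rw [dist_eq_norm, h, norm_zero] at this
      linarith
    refine ((hasDerivAt_const v (f t)).div
      ((hasDerivAt_id' v).const_sub (t : ℂ)) hne).congr_deriv ?_
    ring

theorem norm_integral_div_sub_le (hs : MeasurableSet s) (hf : IntegrableOn f s)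
    (h : ∀ t ∈ s, 1 ≤ ‖(t : ℂ) - u‖) : ‖∫ t in s, f t / (t - u)‖ ≤ ∫ t in s, ‖f t‖ := by
  refine norm_integral_le_of_norm_le hf.norm ((ae_restrict_mem hs).mono fun t ht => ?_)
  rw [norm_div]
  exact div_le_self (norm_nonneg _) (h t ht)

theorem integral_Ioc_div_sub (f : ℂ → ℂ) {a b : ℝ} (hab : a ≤ b)
    (hf : IntegrableOn (fun t : ℝ => f t) (Set.Ioc a b)) (hS : IsClosed S)
    (hsS : ∀ t ∈ Set.Ioc a b, (t : ℂ) ∈ S) (hu : u ∉ S) :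
    ∫ t in Set.Ioc a b, f (t : ℝ) / (t - u) =
      (∫ t in Set.Ioc a b, (f (t : ℝ) - f u) / (t - u)) + f u * ∫ t in a..b, ((t : ℂ) - u)⁻¹ := by
  have hconst : IntegrableOn (fun _ : ℝ => f u) (Set.Ioc a b) := integrableOn_const (by simp)
  rw [intervalIntegral.integral_of_le hab, ← integral_const_mul]
  simp only [sub_div, ← div_eq_mul_inv]
  rw [integral_sub (integrableOn_div_sub measurableSet_Ioc hf hS hsS hu)
    (integrableOn_div_sub measurableSet_Ioc hconst hS hsS hu), sub_add_cancel]

end CauchyKernel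

theorem norm_slope_le {f : ℂ → ℂ} (hf : Differentiable ℂ f) {S : Set ℂ} (hS : Convex ℝ S) {M : ℝ}
    (hM : ∀ z ∈ S, ‖deriv f z‖ ≤ M) {a b : ℂ} (ha : a ∈ S) (hb : b ∈ S) :
    ‖(f a - f b) / (a - b)‖ ≤ M := by
  rw [norm_div]
  exact div_le_of_le_mul₀ (norm_nonneg _) ((norm_nonneg _).trans (hM a ha))
    (hS.norm_image_sub_le_of_norm_deriv_le (fun x _ => hf x) hM hb ha)

/-- The closed positive half-axis in the complex plane. -/
def halfAxis : Set ℂ := {u | 0 ≤ u.re ∧ u.im = 0}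

/-- The Cauchy transform (without the factor `1 / 2πi`) on the positive half-axis. -/
def halfCauchy (f : ℂ → ℂ) (u : ℂ) : ℂ := ∫ t in Set.Ioi (0 : ℝ), f t / (t - u)

theorem isClosed_halfAxis : IsClosed halfAxis :=
  (isClosed_le continuous_const Complex.continuous_re).inter
    (isClosed_eq Complex.continuous_im continuous_const)

theorem ofReal_mem_halfAxis {t : ℝ} (ht : 0 ≤ t) : (t : ℂ) ∈ halfAxis := ⟨by simpa, by simp⟩

theorem ne_zero_of_notMem_halfAxis {u : ℂ} (hu : u ∉ halfAxis) : u ≠ 0 :=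
  fun h => hu (h ▸ ofReal_mem_halfAxis le_rfl)

theorem ofReal_sub_ne_zero_of_notMem_halfAxis {u : ℂ} (hu : u ∉ halfAxis) {t : ℝ} (ht : 0 ≤ t) :
    (t : ℂ) - u ≠ 0 :=
  fun h => hu (sub_eq_zero.1 h ▸ ofReal_mem_halfAxis ht)

section HalfDecay

variable {f : ℂ → ℂ}

theorem integrableOn_halfCauchy (hf : HalfDecay f) (hc : Continuous f) {u : ℂ}
    (hu : u ∉ halfAxis) : IntegrableOn (fun t : ℝ => f t / (t - u)) (Set.Ioi 0) :=
  integrableOn_div_sub measurableSet_Ioi (hf.integrableOn hc) isClosed_halfAxis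
    (fun _ ht => ofReal_mem_halfAxis (Set.mem_Ioi.1 ht).le) hu

theorem differentiableAt_halfCauchy (hf : HalfDecay f) (hc : Continuous f) {u : ℂ}
    (hu : u ∉ halfAxis) : DifferentiableAt ℂ (halfCauchy f) u :=
  differentiableAt_integral_div_sub measurableSet_Ioi (hf.integrableOn hc) isClosed_halfAxis
    (fun _ ht => ofReal_mem_halfAxis (Set.mem_Ioi.1 ht).le) hu

end HalfDecay

theorem one_sub_div_mem_slitPlane {u : ℂ} (hu : u ∉ halfAxis) {t : ℝ} (ht : 0 ≤ t) :
    1 - (t : ℂ) / u ∈ Complex.slitPlane := by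
  have hu0 := ne_zero_of_notMem_halfAxis hu
  by_contra hslit
  obtain ⟨r, hr, h⟩ : ∃ r : ℝ, r ≤ 0 ∧ 1 - (t : ℂ) / u = r := by
    rw [Complex.mem_slitPlane_iff, not_or, not_lt, not_not] at hslit
    exact ⟨_, hslit.1, Complex.ext rfl hslit.2⟩
  have hr1 : (1 - r : ℂ) ≠ 0 := by
    exact_mod_cast (by linarith : 1 - r ≠ 0)
  have hreal : u = ((t / (1 - r) : ℝ) : ℂ) := by
    push_cast
    rw [eq_div_iff hr1, ← h]
    field_simp
    ring
  exact hu (hreal ▸ ofReal_mem_halfAxis (div_nonneg ht (by linarith)))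

theorem intervalIntegral_inv_sub {u : ℂ} (hu : u ∉ halfAxis) {R : ℝ} (hR : 0 ≤ R) :
    ∫ t in (0 : ℝ)..R, ((t : ℂ) - u)⁻¹ = Complex.log (1 - R / u) := by
  have hu0 := ne_zero_of_notMem_halfAxis hu
  have hne (t : ℝ) (ht : t ∈ Set.uIcc 0 R) : (t : ℂ) - u ≠ 0 :=
    ofReal_sub_ne_zero_of_notMem_halfAxis hu (Set.uIcc_of_le hR ▸ ht).1
  have primitive (t : ℝ) (ht : t ∈ Set.uIcc 0 R) :
      HasDerivAt (fun t : ℝ => Complex.log (1 - t / u)) ((t : ℂ) - u)⁻¹ t := by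
    have hslit := one_sub_div_mem_slitPlane hu (Set.uIcc_of_le hR ▸ ht).1
    have inner : HasDerivAt (fun t : ℝ => 1 - (t : ℂ) / u) (-(1 / u)) t :=
      ((Complex.ofRealCLM.hasDerivAt (x := t)).div_const u).const_sub 1
    refine (inner.clog_real hslit).congr_deriv ?_
    have := Complex.slitPlane_ne_zero hslit
    have hne' : u - t ≠ 0 := fun h => hne t ht (by linear_combination -h)
    have := hne t ht
    field_simp
    ring
  rw [intervalIntegral.integral_eq_sub_of_hasDerivAt primitive
    (ContinuousOn.inv₀ (by fun_prop) hne).intervalIntegrable]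
  simp

/-- The part of the Cauchy transform that is continuous on the ball of radius `R`. -/
def regularPart (R : ℝ) (f : ℂ → ℂ) (u : ℂ) : ℂ :=
  (∫ t in Set.Ioc (0 : ℝ) R, (f t - f u) / (t - u)) + ∫ t in Set.Ioi R, f t / (t - u)

section RegularPart

variable {f : ℂ → ℂ}

theorem continuousAt_integral_slope (hd : Differentiable ℂ f) {R : ℝ} {u : ℂ} (hu : ‖u‖ < R) :
    ContinuousAt (fun v => ∫ t in Set.Ioc (0 : ℝ) R, (f t - f v) / (t - v)) u := by
  have hderiv : Continuous (deriv f) := (hd.contDiff (n := 1)).continuous_deriv le_rfl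
  have hm := hd.continuous.measurable
  obtain ⟨M, hM⟩ :=
    (isCompact_closedBall (0 : ℂ) R).exists_bound_of_continuousOn hderiv.continuousOn
  have hball : ∀ᶠ v in 𝓝 u, ‖v‖ < R := (isOpen_lt continuous_norm continuous_const).mem_nhds hu
  have hne : ∀ᵐ t : ℝ ∂(volume.restrict (Set.Ioc 0 R)), t ≠ u.re :=
    ae_restrict_of_ae (by simp [ae_iff])
  refine continuousAt_of_dominated (bound := fun _ => M)
    (Eventually.of_forall fun v => Measurable.aestronglyMeasurable (by fun_prop)) ?_
    (integrableOn_const (by simp)) ?_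
  · filter_upwards [hball] with v hv
    refine (ae_restrict_mem measurableSet_Ioc).mono fun t ht => ?_
    refine norm_slope_le hd (convex_closedBall 0 R) hM ?_ ?_
    · simp [abs_of_pos ht.1, ht.2]
    · simpa using hv.le
  · filter_upwards [hne] with t ht
    have := hd.continuous.continuousAt (x := u)
    refine ContinuousAt.div (by fun_prop) (by fun_prop) fun h => ht ?_
    simpa [sub_eq_zero] using congrArg Complex.re h

theorem continuousAt_regularPart (hf : HalfDecay f) (hd : Differentiable ℂ f) {R : ℝ}
    {u : ℂ} (hu : ‖u‖ < R) : ContinuousAt (regularPart R f) u := by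
  have hR : 0 < R := (norm_nonneg u).trans_lt hu
  refine (continuousAt_integral_slope hd hu).add (DifferentiableAt.continuousAt (𝕜 := ℂ) ?_)
  refine differentiableAt_integral_div_sub (S := {z | R ≤ ‖z‖}) measurableSet_Ioi
    ((hf.integrableOn hd.continuous).mono_set (Set.Ioi_subset_Ioi hR.le))
    (isClosed_le continuous_const continuous_norm) (fun t ht => ?_) (not_le.2 hu)
  simpa using (Set.mem_Ioi.1 ht).le.trans (le_abs_self t)

theorem halfCauchy_eq_regularPart (hf : HalfDecay f) (hd : Differentiable ℂ f) {R : ℝ}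
    (hR : 0 ≤ R) {u : ℂ} (hu : u ∉ halfAxis) :
    halfCauchy f u = regularPart R f u + f u * Complex.log (1 - R / u) := by
  have hcauchy := integrableOn_halfCauchy hf hd.continuous hu
  rw [halfCauchy, regularPart, ← Set.Ioc_union_Ioi_eq_Ioi hR,
    setIntegral_union (Set.Ioc_disjoint_Ioi le_rfl) measurableSet_Ioi
      (hcauchy.mono_set Set.Ioc_subset_Ioi_self) (hcauchy.mono_set (Set.Ioi_subset_Ioi hR)),
    integral_Ioc_div_sub f hR ((hf.integrableOn hd.continuous).mono_set Set.Ioc_subset_Ioi_self)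
      isClosed_halfAxis (fun t ht => ofReal_mem_halfAxis ht.1.le) hu,
    intervalIntegral_inv_sub hu hR]
  ring

end RegularPart

section BoundaryValues

variable {x R : ℝ}

theorem im_one_sub_div (R : ℝ) (u : ℂ) :
    (1 - (R : ℂ) / u).im = R * u.im / Complex.normSq u := by
  simp [Complex.div_im]

theorem tendsto_one_sub_div (hx : 0 < x) (S : Set ℂ) :
    Tendsto (fun u : ℂ => 1 - (R : ℂ) / u) (𝓝[S] (x : ℂ)) (𝓝 (1 - R / x)) :=
  (continuousAt_const.sub (continuousAt_const.div continuousAt_id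
    (Complex.ofReal_ne_zero.2 hx.ne'))).tendsto.mono_left nhdsWithin_le_nhds

theorem re_one_sub_div_neg (hx : 0 < x) (hxR : x < R) : (1 - (R : ℂ) / x).re < 0 := by
  rw [← Complex.ofReal_div, ← Complex.ofReal_one, ← Complex.ofReal_sub, Complex.ofReal_re, sub_neg]
  exact (one_lt_div hx).2 hxR

theorem tendsto_log_one_sub_div_im_pos (hx : 0 < x) (hxR : x < R) :
    Tendsto (fun u : ℂ => Complex.log (1 - R / u)) (𝓝[{u | 0 < u.im}] (x : ℂ))
      (𝓝 (Real.log ‖1 - (R : ℂ) / x‖ + Real.pi * Complex.I)) := by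
  refine (Complex.tendsto_log_nhdsWithin_im_nonneg_of_re_neg_of_im_zero
    (re_one_sub_div_neg hx hxR) (by simp)).comp
    (tendsto_nhdsWithin_iff.2 ⟨tendsto_one_sub_div hx _, ?_⟩)
  refine eventually_nhdsWithin_of_forall fun u (hu : 0 < u.im) => ?_
  rw [Set.mem_ofPred, im_one_sub_div]
  have := Complex.normSq_nonneg u
  have := hx.trans hxR
  positivity

theorem tendsto_log_one_sub_div_im_neg (hx : 0 < x) (hxR : x < R) :
    Tendsto (fun u : ℂ => Complex.log (1 - R / u)) (𝓝[{u | u.im < 0}] (x : ℂ))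
      (𝓝 (Real.log ‖1 - (R : ℂ) / x‖ - Real.pi * Complex.I)) := by
  refine (Complex.tendsto_log_nhdsWithin_im_neg_of_re_neg_of_im_zero
    (re_one_sub_div_neg hx hxR) (by simp)).comp
    (tendsto_nhdsWithin_iff.2 ⟨tendsto_one_sub_div hx _, ?_⟩)
  refine eventually_nhdsWithin_of_forall fun u (hu : u.im < 0) => ?_
  have hu0 : u ≠ 0 := fun h => by simp [h] at hu
  rw [Set.mem_ofPred, im_one_sub_div]
  exact div_neg_of_neg_of_pos (mul_neg_of_pos_of_neg (hx.trans hxR) hu) (Complex.normSq_pos.2 hu0)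

theorem tendsto_halfCauchy {f : ℂ → ℂ} (hf : HalfDecay f) (hd : Differentiable ℂ f)
    (hx : 0 < x) : ∃ N : ℂ,
      Tendsto (halfCauchy f) (𝓝[{u | 0 < u.im}] (x : ℂ)) (𝓝 (N + f x * (Real.pi * Complex.I))) ∧
      Tendsto (halfCauchy f) (𝓝[{u | u.im < 0}] (x : ℂ)) (𝓝 (N - f x * (Real.pi * Complex.I))) := by
  have hxR : x < x + 1 := lt_add_one x
  have limit {S : Set ℂ} {l : ℂ} (hS : ∀ u ∈ S, u.im ≠ 0)
      (hlog : Tendsto (fun u : ℂ => Complex.log (1 - (x + 1 : ℝ) / u)) (𝓝[S] (x : ℂ)) (𝓝 l)) :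
      Tendsto (halfCauchy f) (𝓝[S] (x : ℂ)) (𝓝 (regularPart (x + 1) f x + f x * l)) := by
    have hreg : ContinuousAt (regularPart (x + 1) f) x :=
      continuousAt_regularPart hf hd (by simp [abs_of_pos hx])
    refine ((hreg.tendsto.mono_left nhdsWithin_le_nhds).add
      ((hd.continuous.continuousAt.tendsto.mono_left nhdsWithin_le_nhds).mul hlog)).congr' ?_
    refine eventually_nhdsWithin_of_forall fun u hu => ?_
    exact (halfCauchy_eq_regularPart hf hd (by positivity) fun h => hS u hu h.2).symm
  refine ⟨regularPart (x + 1) f x + f x * Real.log ‖1 - ((x + 1 : ℝ) : ℂ) / x‖, ?_, ?_⟩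
  · rw [add_assoc, ← mul_add]
    exact limit (fun _ hu => ne_of_gt hu) (tendsto_log_one_sub_div_im_pos hx hxR)
  · rw [add_sub_assoc, ← mul_sub]
    exact limit (fun _ hu => ne_of_lt hu) (tendsto_log_one_sub_div_im_neg hx hxR)

end BoundaryValues

theorem norm_log_one_sub_inv_add_log_norm_le {u : ℂ} (hu0 : u ≠ 0) (hu : ‖u‖ < 1 / 2) :
    ‖Complex.log (1 - (1 : ℝ) / u) + Real.log ‖u‖‖ ≤ Real.log 2 + Real.pi := by
  have upper : ‖u - 1‖ ≤ 2 := by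
    linarith [norm_sub_le u 1, norm_one (α := ℂ)]
  have lower : 2⁻¹ ≤ ‖u - 1‖ := by
    linarith [norm_sub_norm_le 1 u, norm_sub_rev 1 u, norm_one (α := ℂ)]
  have hnorm : ‖1 - ((1 : ℝ) : ℂ) / u‖ = ‖u - 1‖ / ‖u‖ := by
    rw [← norm_div, Complex.ofReal_one, sub_div, div_self hu0]
  have polar : Complex.log (1 - (1 : ℝ) / u) + Real.log ‖u‖
      = (Real.log ‖u - 1‖ : ℝ) + (Complex.arg (1 - (1 : ℝ) / u) : ℝ) * Complex.I := by
    rw [Complex.log, hnorm, Real.log_div (by linarith) (norm_ne_zero_iff.2 hu0)]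
    push_cast
    ring
  rw [polar]
  refine (norm_add_le _ _).trans (add_le_add ?_ ?_)
  · rw [Complex.norm_real, Real.norm_eq_abs, abs_le, ← Real.log_inv]
    exact ⟨Real.log_le_log (by norm_num) lower, Real.log_le_log (by linarith) upper⟩
  · rw [norm_mul, Complex.norm_I, mul_one, Complex.norm_real]
    exact Complex.abs_arg_le_pi _

theorem exists_norm_halfCauchy_add_log_le {f : ℂ → ℂ} (hf : HalfDecay f)
    (hd : Differentiable ℂ f) : ∃ r > 0, ∃ C, ∀ u ∉ halfAxis, ‖u‖ < r →
      ‖halfCauchy f u + f u * Real.log ‖u‖‖ ≤ C := by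
  have regular_bound : ∀ᶠ u in 𝓝 (0 : ℂ), ‖regularPart 1 f u‖ < ‖regularPart 1 f 0‖ + 1 :=
    (continuousAt_regularPart hf hd (by simp)).norm.eventually (gt_mem_nhds (lt_add_one _))
  have value_bound : ∀ᶠ u in 𝓝 (0 : ℂ), ‖f u‖ < ‖f 0‖ + 1 :=
    hd.continuous.continuousAt.norm.eventually (gt_mem_nhds (lt_add_one _))
  obtain ⟨r, hr, h⟩ := Metric.eventually_nhds_iff.1 (regular_bound.and value_bound)
  refine ⟨min r (1 / 2), by positivity, (‖regularPart 1 f 0‖ + 1) +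
    (‖f 0‖ + 1) * (Real.log 2 + Real.pi), fun u hu hur => ?_⟩
  obtain ⟨hregular, hvalue⟩ := h (y := u) (by simpa using hur.trans_le (min_le_left _ _))
  rw [halfCauchy_eq_regularPart hf hd zero_le_one hu, add_assoc, ← mul_add]
  refine (norm_add_le _ _).trans (add_le_add hregular.le ?_)
  rw [norm_mul]
  exact mul_le_mul hvalue.le (norm_log_one_sub_inv_add_log_norm_le
    (ne_zero_of_notMem_halfAxis hu) (hur.trans_le (min_le_right _ _))) (norm_nonneg _)
    (by positivity)

section NearHalfAxis

variable {u : ℂ}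

theorem norm_log_sub_log_le {a b : ℂ} (h : ‖a‖ = ‖b‖) :
    ‖Complex.log a - Complex.log b‖ ≤ 2 * Real.pi := by
  have hdiff : Complex.log a - Complex.log b = ((a.arg - b.arg : ℝ) : ℂ) * Complex.I := by
    rw [Complex.log, Complex.log, h]
    push_cast
    ring
  rw [hdiff, norm_mul, Complex.norm_I, mul_one, Complex.norm_real, Real.norm_eq_abs, two_mul]
  exact (abs_sub _ _).trans (add_le_add (Complex.abs_arg_le_pi _) (Complex.abs_arg_le_pi _))

theorem intervalIntegral_inv_sub_of_im_ne_zero (hu : u.im ≠ 0) (a b : ℝ) :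
    ∫ t in a..b, ((t : ℂ) - u)⁻¹ = Complex.log (b - u) - Complex.log (a - u) := by
  have hne (t : ℝ) : (t : ℂ) - u ≠ 0 := fun h => hu (by simpa using congrArg Complex.im h)
  refine intervalIntegral.integral_eq_sub_of_hasDerivAt
    (f := fun t : ℝ => Complex.log ((t : ℂ) - u)) (fun t _ => ?_)
    ((Continuous.inv₀ (by fun_prop) hne).intervalIntegrable _ _)
  have inner : HasDerivAt (fun t : ℝ => (t : ℂ) - u) 1 t :=
    (Complex.ofRealCLM.hasDerivAt (x := t)).sub_const u
  have hslit : (t : ℂ) - u ∈ Complex.slitPlane := by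
    rw [Complex.mem_slitPlane_iff]
    exact Or.inr (by simpa using hu)
  simpa using inner.clog_real hslit

/- The endpoints of the interval are equidistant from `u`, so the logarithms differ by arguments. -/
theorem norm_intervalIntegral_inv_sub_le (hu : u.im ≠ 0) (r : ℝ) :
    ‖∫ t in (u.re - r)..(u.re + r), ((t : ℂ) - u)⁻¹‖ ≤ 2 * Real.pi := by
  rw [intervalIntegral_inv_sub_of_im_ne_zero hu]
  refine norm_log_sub_log_le ?_
  rw [← sq_eq_sq₀ (norm_nonneg _) (norm_nonneg _), Complex.sq_norm, Complex.sq_norm,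
    Complex.normSq_apply, Complex.normSq_apply]
  simp

theorem convex_halfStrip : Convex ℝ {v : ℂ | 0 ≤ v.re ∧ |v.im| ≤ 1} := by
  have hstrip : {v : ℂ | 0 ≤ v.re ∧ |v.im| ≤ 1}
      = Complex.reLm ⁻¹' Set.Ici 0 ∩ Complex.imLm ⁻¹' Set.Icc (-1) 1 := by
    ext v
    simp [abs_le]
  rw [hstrip]
  exact ((convex_Ici 0).linear_preimage _).inter ((convex_Icc _ _).linear_preimage _)

theorem HalfDecay.exists_norm_le {f : ℂ → ℂ} (hf : HalfDecay f) :
    ∃ C, ∀ u : ℂ, 0 ≤ u.re → |u.im| ≤ 1 → ‖f u‖ ≤ C := by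
  obtain ⟨C, hC0, hC⟩ := hf
  refine ⟨C, fun u hre him => (hC u hre him).trans (mul_le_of_le_one_right hC0 ?_)⟩
  simpa using hre

theorem exists_norm_integral_Ioc_div_sub_le {f : ℂ → ℂ} (hf : HalfDecay f)
    (hd : Differentiable ℂ f) (hf' : HalfDecay (deriv f)) :
    ∃ C, ∀ u : ℂ, 1 ≤ u.re → |u.im| ≤ 1 → u.im ≠ 0 →
      ‖∫ t in Set.Ioc (u.re - 1) (u.re + 1), f (t : ℝ) / (t - u)‖ ≤ C := by
  obtain ⟨C₀, hC₀⟩ := hf.exists_norm_le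
  obtain ⟨C₁, hC₁⟩ := hf'.exists_norm_le
  refine ⟨C₁ * 2 + C₀ * (2 * Real.pi), fun u hre him him0 => ?_⟩
  have hsub : Set.Ioc (u.re - 1) (u.re + 1) ⊆ Set.Ioi 0 :=
    fun t ht => Set.mem_Ioi.2 (by linarith [ht.1])
  have slope_bound :
      ‖∫ t in Set.Ioc (u.re - 1) (u.re + 1), (f (t : ℝ) - f u) / (t - u)‖ ≤ C₁ * 2 := by
    have hvol : volume.real (Set.Ioc (u.re - 1) (u.re + 1)) = 2 := by
      rw [Real.volume_real_Ioc_of_le (by linarith)]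
      ring
    rw [← hvol]
    refine norm_setIntegral_le_of_norm_le_const (by simp) fun t ht => ?_
    exact norm_slope_le hd convex_halfStrip (fun v hv => hC₁ v hv.1 hv.2)
      ⟨by simpa using (hsub ht).le, by simp⟩ ⟨by linarith, him⟩
  have value_bound : ‖f u‖ ≤ C₀ := hC₀ u (by linarith) him
  rw [integral_Ioc_div_sub (S := {z | z.im = 0}) f (by linarith)
    ((hf.integrableOn hd.continuous).mono_set hsub)
    (isClosed_eq Complex.continuous_im continuous_const) (fun t _ => Complex.ofReal_im t) him0]
  refine (norm_add_le _ _).trans (add_le_add slope_bound ?_)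
  rw [norm_mul]
  exact mul_le_mul value_bound (norm_intervalIntegral_inv_sub_le him0 1) (norm_nonneg _)
    ((norm_nonneg _).trans value_bound)

theorem two_le_re_of_norm_ofReal_sub_lt_one {t : ℝ} (ht : 0 < t) (hu : 3 ≤ ‖u‖)
    (htu : ‖(t : ℂ) - u‖ < 1) : 2 ≤ u.re ∧ |u.im| < 1 := by
  have him : |u.im| < 1 := by
    simpa using (Complex.abs_im_le_norm ((t : ℂ) - u)).trans_lt htu
  have hre : |t - u.re| < 1 := by
    simpa using (Complex.abs_re_le_norm ((t : ℂ) - u)).trans_lt htu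
  have habs : 2 ≤ |u.re| := by linarith [Complex.norm_le_abs_re_add_abs_im u]
  refine ⟨(le_abs.1 habs).resolve_right fun h => ?_, him⟩
  linarith [(abs_lt.1 hre).2]

theorem exists_norm_halfCauchy_le {f : ℂ → ℂ} (hf : HalfDecay f) (hd : Differentiable ℂ f)
    (hf' : HalfDecay (deriv f)) : ∃ C, ∀ u ∉ halfAxis, 3 ≤ ‖u‖ → ‖halfCauchy f u‖ ≤ C := by
  have hint := hf.integrableOn hd.continuous
  obtain ⟨C, hC⟩ := exists_norm_integral_Ioc_div_sub_le hf hd hf'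
  refine ⟨(∫ t in Set.Ioi (0 : ℝ), ‖f t‖) + max C 0, fun u hu hu3 => ?_⟩
  by_cases hfar : ∀ t ∈ Set.Ioi (0 : ℝ), 1 ≤ ‖(t : ℂ) - u‖
  · exact (norm_integral_div_sub_le measurableSet_Ioi hint hfar).trans
      (le_add_of_nonneg_right (le_max_right _ _))
  push Not at hfar
  obtain ⟨t₀, ht₀, hclose⟩ := hfar
  obtain ⟨hre, him⟩ := two_le_re_of_norm_ofReal_sub_lt_one ht₀ hu3 hclose
  have him0 : u.im ≠ 0 := fun h => hu ⟨by linarith, h⟩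
  set J := Set.Ioc (u.re - 1) (u.re + 1)
  have hJ : J ⊆ Set.Ioi 0 := fun t ht => Set.mem_Ioi.2 (by linarith [ht.1])
  have hdiff : IntegrableOn (fun t : ℝ => f t) (Set.Ioi 0 \ J) := hint.mono_set Set.sdiff_subset
  have far_bound : ‖∫ t in Set.Ioi 0 \ J, f (t : ℝ) / (t - u)‖
      ≤ ∫ t in Set.Ioi (0 : ℝ), ‖f t‖ := by
    refine (norm_integral_div_sub_le (measurableSet_Ioi.diff measurableSet_Ioc) hdiff
      fun t ht => ?_).trans (setIntegral_mono_set hint.norm (ae_of_all _ fun _ => norm_nonneg _)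
        (LE.le.eventuallyLE Set.sdiff_subset))
    refine le_trans (le_abs.2 ?_) (Complex.abs_re_le_norm _)
    rw [Complex.sub_re, Complex.ofReal_re]
    rcases not_and_or.1 ht.2 with h | h
    · exact Or.inr (by linarith)
    · exact Or.inl (by linarith)
  rw [halfCauchy, ← integral_inter_add_sdiff measurableSet_Ioc
    (integrableOn_halfCauchy hf hd.continuous hu) (s := Set.Ioi 0) (t := J),
    Set.inter_eq_right.2 hJ, add_comm]
  exact (norm_add_le _ _).trans
    (add_le_add far_bound ((hC u (by linarith) him.le him0).trans (le_max_left _ _)))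

end NearHalfAxis

/-! ### Cauchy transforms on rays and arcs -/

/-- The Cauchy transform (without the factor `1 / 2πi`) on the ray `C_k`, traversed outwards. -/
def rayCauchy (D k : ℕ) (f : ℂ → ℂ) (z : ℂ) : ℂ :=
  halfCauchy (fun u => f (u * dir D k)) (z / dir D k)

theorem div_dir_mem_halfAxis_iff {D k : ℕ} {z : ℂ} : z / dir D k ∈ halfAxis ↔ z ∈ ray D k :=
  mem_ray_iff.symm

theorem norm_div_dir (D k : ℕ) (z : ℂ) : ‖z / dir D k‖ = ‖z‖ := by simp

theorem differentiableAt_rayCauchy {D k : ℕ} {f : ℂ → ℂ} (hf : StripDecay D k f)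
    (hd : Differentiable ℂ f) {z : ℂ} (hz : z ∉ ray D k) :
    DifferentiableAt ℂ (rayCauchy D k f) z :=
  (differentiableAt_halfCauchy (f := fun u => f (u * dir D k)) hf
    (hd.continuous.comp (by fun_prop)) (mt div_dir_mem_halfAxis_iff.1 hz)).comp
    (f := fun z => z / dir D k) z (by fun_prop)

theorem tendsto_rayCauchy_of_im_div_dir {D k : ℕ} {f : ℂ → ℂ} (hf : StripDecay D k f)
    (hd : Differentiable ℂ f) {x : ℂ} (hx : x ∈ ray D k) (hx0 : x ≠ 0) : ∃ N : ℂ,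
      (∀ S : Set ℂ, (∀ z ∈ S, 0 < (z / dir D k).im) →
        Tendsto (rayCauchy D k f) (𝓝[S] x) (𝓝 (N + f x * (Real.pi * Complex.I)))) ∧
      ∀ S : Set ℂ, (∀ z ∈ S, (z / dir D k).im < 0) →
        Tendsto (rayCauchy D k f) (𝓝[S] x) (𝓝 (N - f x * (Real.pi * Complex.I))) := by
  obtain ⟨t, ht, rfl⟩ := hx
  have ht0 : 0 < t := lt_of_le_of_ne ht fun h => hx0 (by simp [← h])
  obtain ⟨N, hupper, hlower⟩ := tendsto_halfCauchy (f := fun u => f (u * dir D k)) hf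
    (hd.comp (by fun_prop)) ht0
  have hdiv : Tendsto (fun z : ℂ => z / dir D k) (𝓝 (t * dir D k)) (𝓝 (t : ℂ)) := by
    have hcont : Continuous fun z : ℂ => z / dir D k := by fun_prop
    simpa only [mul_div_cancel_right₀ _ (dir_ne_zero D k)] using hcont.tendsto (t * dir D k)
  exact ⟨N,
    fun S hS => hupper.comp (tendsto_nhdsWithin_iff.2
      ⟨hdiv.mono_left nhdsWithin_le_nhds, eventually_nhdsWithin_of_forall hS⟩),
    fun S hS => hlower.comp (tendsto_nhdsWithin_iff.2
      ⟨hdiv.mono_left nhdsWithin_le_nhds, eventually_nhdsWithin_of_forall hS⟩)⟩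

theorem tendsto_rayCauchy {D k : ℕ} {f : ℂ → ℂ} (hf : StripDecay D k f)
    (hd : Differentiable ℂ f) {x : ℂ} (hx : x ∈ ray D k) (hx0 : x ≠ 0) : ∃ N : ℂ,
      Tendsto (rayCauchy D k f) (𝓝[leftSide D k \ contour D] x)
        (𝓝 (N + (if k = 0 then 1 else -1) * (f x * (Real.pi * Complex.I)))) ∧
      Tendsto (rayCauchy D k f) (𝓝[rightSide D k \ contour D] x)
        (𝓝 (N - (if k = 0 then 1 else -1) * (f x * (Real.pi * Complex.I)))) := by
  obtain ⟨N, hupper, hlower⟩ := tendsto_rayCauchy_of_im_div_dir hf hd hx hx0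
  have hleft : ∀ z ∈ leftSide D k \ contour D,
      0 < (if k = 0 then 1 else -1) * (z / dir D k).im := fun z hz => by
    rw [← im_div_tangent]
    exact hz.1
  have hright : ∀ z ∈ rightSide D k \ contour D,
      (if k = 0 then 1 else -1) * (z / dir D k).im < 0 := fun z hz => by
    rw [← im_div_tangent]
    exact hz.1
  refine ⟨N, ?_⟩
  by_cases hk : k = 0
  · simp only [if_pos hk, one_mul] at hleft hright ⊢
    exact ⟨hupper _ hleft, hlower _ hright⟩
  · simp only [if_neg hk, neg_one_mul, Left.neg_pos_iff, Left.neg_neg_iff] at hleft hright ⊢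
    rw [← sub_eq_add_neg, sub_neg_eq_add]
    exact ⟨hlower _ hleft, hupper _ hright⟩

theorem tendsto_rayCauchy_indicator {D k l : ℕ} (hk : k < D) (hl : l < D) {f : ℂ → ℂ}
    (hf : StripDecay D l f) (hd : Differentiable ℂ f) {x : ℂ} (hx : x ∈ ray D k) (hx0 : x ≠ 0) :
    ∃ N : ℂ,
      Tendsto (rayCauchy D l f) (𝓝[leftSide D k \ contour D] x) (𝓝 (N +
        (if l = 0 then 1 else -1) * (Set.indicator (ray D l) f x * (Real.pi * Complex.I)))) ∧
      Tendsto (rayCauchy D l f) (𝓝[rightSide D k \ contour D] x) (𝓝 (N -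
        (if l = 0 then 1 else -1) * (Set.indicator (ray D l) f x * (Real.pi * Complex.I)))) := by
  by_cases hxl : x ∈ ray D l
  · obtain rfl := eq_of_mem_ray (by omega) hk hl hx0 hx hxl
    rw [Set.indicator_of_mem hxl]
    exact tendsto_rayCauchy hf hd hx hx0
  · have hlim := (differentiableAt_rayCauchy hf hd hxl).continuousAt.tendsto
    refine ⟨rayCauchy D l f x, ?_⟩
    rw [Set.indicator_of_notMem hxl, zero_mul, mul_zero, add_zero, sub_zero]
    exact ⟨hlim.mono_left nhdsWithin_le_nhds, hlim.mono_left nhdsWithin_le_nhds⟩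

theorem exists_norm_rayCauchy_add_log_le {D k : ℕ} {f : ℂ → ℂ} (hf : StripDecay D k f)
    (hd : Differentiable ℂ f) : ∃ r > 0, ∃ C, ∀ z ∉ ray D k, ‖z‖ < r →
      ‖rayCauchy D k f z + f z * Real.log ‖z‖‖ ≤ C := by
  obtain ⟨r, hr, C, hC⟩ := exists_norm_halfCauchy_add_log_le (f := fun u => f (u * dir D k)) hf
    (hd.comp (by fun_prop))
  refine ⟨r, hr, C, fun z hz hzr => ?_⟩
  have := hC (z / dir D k) (fun h => hz (div_dir_mem_halfAxis_iff.1 h)) (by rwa [norm_div_dir])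
  rwa [norm_div_dir, div_mul_cancel₀ _ (dir_ne_zero D k)] at this

/-- The Cauchy transform on the arc `Γ_j`, with its orientation. -/
def arcCauchy (D j : ℕ) (f : ℂ → ℂ) (z : ℂ) : ℂ :=
  (2 * Real.pi * Complex.I)⁻¹ * (rayCauchy D 0 f z - rayCauchy D j f z)

theorem notMem_ray_of_notMem_contour {D k : ℕ} (hD : 2 ≤ D) (hk : k < D) {z : ℂ}
    (hz : z ∉ contour D) : z ∉ ray D k := fun h => hz ((mem_contour_iff hD).2 ⟨k, hk, h⟩)

section arc

variable {D : ℕ} {U : ℂ[X]} {j : ℕ}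

theorem differentiableOn_arcCauchy (hU : IsPotential D U) (hD : 2 ≤ D) (hj : j < D) (p : ℂ[X]) :
    DifferentiableOn ℂ (arcCauchy D j (weighted U p)) (contour D)ᶜ := fun z hz => by
  have hdiff : ∀ k < D, DifferentiableAt ℂ (rayCauchy D k (weighted U p)) z := fun k hk =>
    differentiableAt_rayCauchy (hU.stripDecay hD k p) (differentiable_weighted U p)
      (notMem_ray_of_notMem_contour hD hk hz)
  exact (((hdiff 0 (by omega)).sub (hdiff j hj)).const_mul _).differentiableWithinAt

theorem indicator_arc_apply (hj0 : 1 ≤ j) (hj : j < D) (f : ℂ → ℂ) {x : ℂ} (hx0 : x ≠ 0) :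
    Set.indicator (arc D j) f x = Set.indicator (ray D 0) f x + Set.indicator (ray D j) f x :=
  Set.indicator_union_of_notMem_inter
    (fun h => absurd (eq_of_mem_ray (by omega) (by omega) hj hx0 h.1 h.2) (by omega)) f

theorem tendsto_arcCauchy (hU : IsPotential D U) (hD : 2 ≤ D) (hj0 : 1 ≤ j) (hj : j < D) (p : ℂ[X])
    {k : ℕ} (hk : k < D) {x : ℂ} (hx : x ∈ ray D k) (hx0 : x ≠ 0) : ∃ b : ℂ,
      Tendsto (arcCauchy D j (weighted U p)) (𝓝[leftSide D k \ contour D] x)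
        (𝓝 (b + Set.indicator (arc D j) (weighted U p) x)) ∧
      Tendsto (arcCauchy D j (weighted U p)) (𝓝[rightSide D k \ contour D] x) (𝓝 b) := by
  have hd := differentiable_weighted U p
  obtain ⟨N₀, hleft₀, hright₀⟩ :=
    tendsto_rayCauchy_indicator hk (by omega) (hU.stripDecay hD 0 p) hd hx hx0
  obtain ⟨N, hleft, hright⟩ := tendsto_rayCauchy_indicator hk hj (hU.stripDecay hD j p) hd hx hx0
  refine ⟨_, ?_, (hright₀.sub hright).const_mul _⟩
  convert (hleft₀.sub hleft).const_mul (2 * Real.pi * Complex.I : ℂ)⁻¹ using 2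
  · rfl
  have hpi : (Real.pi : ℂ) ≠ 0 := Complex.ofReal_ne_zero.2 Real.pi_ne_zero
  rw [indicator_arc_apply hj0 hj _ hx0, if_pos rfl, if_neg (by omega)]
  field_simp
  ring

theorem exists_norm_arcCauchy_le_near_zero (hU : IsPotential D U) (hD : 2 ≤ D) (hj : j < D)
    (p : ℂ[X]) : ∃ r > (0 : ℝ), ∃ C : ℝ,
      ∀ z, z ∉ contour D → ‖z‖ < r → ‖arcCauchy D j (weighted U p) z‖ ≤ C := by
  have hd := differentiable_weighted U p
  obtain ⟨r₀, hr₀, C₀, h₀⟩ := exists_norm_rayCauchy_add_log_le (hU.stripDecay hD 0 p) hd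
  obtain ⟨r₁, hr₁, C₁, h₁⟩ := exists_norm_rayCauchy_add_log_le (hU.stripDecay hD j p) hd
  refine ⟨min r₀ r₁, lt_min hr₀ hr₁, ‖(2 * Real.pi * Complex.I : ℂ)⁻¹‖ * (C₀ + C₁),
    fun z hz hzr => ?_⟩
  have hz₀ := h₀ z (notMem_ray_of_notMem_contour hD (by omega) hz) (hzr.trans_le (min_le_left _ _))
  have hz₁ := h₁ z (notMem_ray_of_notMem_contour hD hj hz) (hzr.trans_le (min_le_right _ _))
  rw [arcCauchy, norm_mul]
  refine mul_le_mul_of_nonneg_left ?_ (norm_nonneg _)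
  calc ‖rayCauchy D 0 (weighted U p) z - rayCauchy D j (weighted U p) z‖
      = ‖(rayCauchy D 0 (weighted U p) z + weighted U p z * Real.log ‖z‖)
          - (rayCauchy D j (weighted U p) z + weighted U p z * Real.log ‖z‖)‖ := by ring_nf
    _ ≤ C₀ + C₁ := (norm_sub_le _ _).trans (add_le_add hz₀ hz₁)

theorem IsPotential.halfDecay_deriv_weighted (hU : IsPotential D U) (hD : 2 ≤ D) (k : ℕ)
    (p : ℂ[X]) : HalfDecay (deriv fun u => weighted U p (u * dir D k)) := by
  have hderiv : deriv (fun u => weighted U p (u * dir D k))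
      = fun u => weighted U (twist U p) (u * dir D k) * dir D k := by
    ext u
    exact (HasDerivAt.comp u (hasDerivAt_weighted U p (u * dir D k))
      (hasDerivAt_mul_const (dir D k))).deriv
  rw [hderiv]
  obtain ⟨C, hC0, hC⟩ := hU.stripDecay hD k (twist U p)
  exact ⟨C, hC0, fun u h0 h1 => by simpa using hC u h0 h1⟩

theorem exists_norm_rayCauchy_le (hU : IsPotential D U) (hD : 2 ≤ D) (k : ℕ) (p : ℂ[X]) :
    ∃ C, ∀ z ∉ ray D k, 3 ≤ ‖z‖ → ‖rayCauchy D k (weighted U p) z‖ ≤ C := by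
  obtain ⟨C, hC⟩ := exists_norm_halfCauchy_le (hU.stripDecay hD k p)
    ((differentiable_weighted U p).comp (by fun_prop)) (hU.halfDecay_deriv_weighted hD k p)
  exact ⟨C, fun z hz hz3 => hC _ (mt div_dir_mem_halfAxis_iff.1 hz) (by rwa [norm_div_dir])⟩

theorem arcCauchy_isBigO_one (hU : IsPotential D U) (hD : 2 ≤ D) (hj : j < D) (p : ℂ[X]) :
    arcCauchy D j (weighted U p) =O[Bornology.cobounded ℂ ⊓ 𝓟 (contour D)ᶜ]
      fun _ => (1 : ℂ) := by
  obtain ⟨C₀, h₀⟩ := exists_norm_rayCauchy_le hU hD 0 p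
  obtain ⟨C₁, h₁⟩ := exists_norm_rayCauchy_le hU hD j p
  refine Asymptotics.IsBigO.of_bound (‖(2 * Real.pi * Complex.I : ℂ)⁻¹‖ * (C₀ + C₁)) ?_
  rw [eventually_inf_principal]
  filter_upwards [tendsto_norm_cobounded_atTop.eventually_ge_atTop 3] with z hz3 hz
  rw [arcCauchy, norm_mul, norm_one, mul_one]
  refine mul_le_mul_of_nonneg_left ?_ (norm_nonneg _)
  exact (norm_sub_le _ _).trans (add_le_add
    (h₀ z (notMem_ray_of_notMem_contour hD (by omega) hz) hz3)
    (h₁ z (notMem_ray_of_notMem_contour hD hj hz) hz3))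

theorem rayCauchy_eq (hU : IsPotential D U) (hD : 2 ≤ D) (k : ℕ) (p : ℂ[X]) {z : ℂ}
    (hz : z ∉ ray D k) :
    rayCauchy D k (weighted U p) z
      = z⁻¹ * (rayCauchy D k (weighted U (X * p)) z - rayMoment hU hD k p) := by
  have hz0 : z ≠ 0 := fun h => hz (h ▸ zero_mem_ray D k)
  have hz' : z / dir D k ∉ halfAxis := mt div_dir_mem_halfAxis_iff.1 hz
  have hint := integrableOn_halfCauchy (f := fun u => weighted U (X * p) (u * dir D k))
    (hU.stripDecay hD k _) ((continuous_weighted U _).comp (by fun_prop)) hz'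
  rw [eq_inv_mul_iff_mul_eq₀ hz0, rayMoment_apply, rayIntegral, rayCauchy, rayCauchy, halfCauchy,
    halfCauchy, ← integral_sub hint (((hU.stripDecay hD k p).integrableOn
      (continuous_weighted U p)).mul_const _), ← integral_const_mul]
  refine setIntegral_congr_fun measurableSet_Ioi fun t ht => ?_
  have hdir := dir_ne_zero D k
  have hne : (t : ℂ) * dir D k - z ≠ 0 := fun h =>
    ofReal_sub_ne_zero_of_notMem_halfAxis hz' (Set.mem_Ioi.1 ht).le (by
      field_simp
      rw [h, mul_zero])
  simp only [weighted_mul, eval_X]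
  field_simp
  ring

/-- The integral of `p e^{-U}` over the arc `Γ_j`, as a linear functional of `p`. -/
def arcMoment (hU : IsPotential D U) (hD : 2 ≤ D) (j : ℕ) : ℂ[X] →ₗ[ℂ] ℂ :=
  rayMoment hU hD 0 - rayMoment hU hD j

theorem arcMoment_apply (hU : IsPotential D U) (hD : 2 ≤ D) (p : ℂ[X]) :
    arcMoment hU hD j p = rayMoment hU hD 0 p - rayMoment hU hD j p := rfl

theorem arcMoment_twist (hU : IsPotential D U) (hD : 2 ≤ D) (q : ℂ[X]) :
    arcMoment hU hD j (twist U q) = 0 := by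
  rw [arcMoment_apply, rayMoment_twist, rayMoment_twist, sub_self]

theorem arcCauchy_eq (hU : IsPotential D U) (hD : 2 ≤ D) (hj : j < D) (p : ℂ[X]) {z : ℂ}
    (hz : z ∉ contour D) :
    arcCauchy D j (weighted U p) z = z⁻¹ * (arcCauchy D j (weighted U (X * p)) z
      - (2 * Real.pi * Complex.I)⁻¹ * arcMoment hU hD j p) := by
  rw [arcCauchy, rayCauchy_eq hU hD 0 p (notMem_ray_of_notMem_contour hD (by omega) hz),
    rayCauchy_eq hU hD j p (notMem_ray_of_notMem_contour hD hj hz), arcMoment_apply, arcCauchy]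
  ring

theorem arcCauchy_eq_pow (hU : IsPotential D U) (hD : 2 ≤ D) (hj : j < D) (p : ℂ[X]) {z : ℂ}
    (hz : z ∉ contour D) (N : ℕ)
    (h : ∀ m < N, arcMoment hU hD j (X ^ m * p) = 0) :
    arcCauchy D j (weighted U p) z = z⁻¹ ^ N * arcCauchy D j (weighted U (X ^ N * p)) z := by
  induction N with
  | zero => simp
  | succ N ih =>
    rw [ih fun m hm => h m (by omega), arcCauchy_eq hU hD hj _ hz, h N (by omega), pow_succ,
      pow_succ, mul_comm (X ^ N) X, mul_assoc X]
    ring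

theorem arcCauchy_isBigO_inv (hU : IsPotential D U) (hD : 2 ≤ D) (hj : j < D) (p : ℂ[X]) :
    arcCauchy D j (weighted U p) =O[Bornology.cobounded ℂ ⊓ 𝓟 (contour D)ᶜ] fun z => z⁻¹ := by
  have hbdd : (fun z => arcCauchy D j (weighted U (X * p)) z
      - (2 * Real.pi * Complex.I)⁻¹ * arcMoment hU hD j p)
      =O[Bornology.cobounded ℂ ⊓ 𝓟 (contour D)ᶜ] fun _ => (1 : ℂ) :=
    (arcCauchy_isBigO_one hU hD hj _).sub (Asymptotics.isBigO_const_const _ one_ne_zero _)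
  refine ((Asymptotics.isBigO_refl (fun z : ℂ => z⁻¹) _).mul hbdd).congr' ?_
    (Eventually.of_forall fun z => mul_one _)
  rw [EventuallyEq, eventually_inf_principal]
  exact Eventually.of_forall fun z hz => (arcCauchy_eq hU hD hj p hz).symm

theorem det_arcMoment_ne_zero {N : ℕ} (hU : IsPotential (N + 1) U) (hD : 2 ≤ N + 1) :
    (Matrix.of fun m j : Fin N => arcMoment hU hD (j + 1) (X ^ (m : ℕ))).det ≠ 0 := by
  intro hdet
  obtain ⟨c, hc, hMc⟩ := Matrix.exists_mulVec_eq_zero_iff.2 hdet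
  refine hc (funext fun j => ?_)
  have hzero := eq_zero_of_rayMoment_eq_zero hU hD (c := Fin.cons (∑ j, c j) (-c))
    (by simp [Fin.sum_univ_succ]) fun m hm => by
      have hrow : ∑ j : Fin N, arcMoment hU hD (j + 1) (X ^ m) * c j = 0 :=
        congrFun hMc ⟨m, by omega⟩
      simp only [Fin.sum_univ_succ, Fin.cons_zero, Fin.cons_succ, Fin.val_zero, Fin.val_succ,
        LinearMap.add_apply, LinearMap.sum_apply, LinearMap.smul_apply, smul_eq_mul,
        Pi.neg_apply, Finset.sum_mul, ← Finset.sum_add_distrib]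
      rw [← hrow]
      refine Finset.sum_congr rfl fun j _ => ?_
      rw [arcMoment_apply]
      ring
  simpa using congrFun hzero j.succ

theorem eq_zero_of_arcMoment_eq_zero (hU : IsPotential D U) (hD : 2 ≤ D) {p : ℂ[X]}
    (hp : p.degree < (D - 1 : ℕ)) (h : ∀ j, 1 ≤ j → j < D → arcMoment hU hD j p = 0) :
    p = 0 := by
  obtain ⟨N, rfl⟩ : ∃ N, D = N + 1 := ⟨D - 1, by omega⟩
  rw [Nat.add_sub_cancel] at hp
  have hcoeff : (fun m : Fin N => p.coeff m) = 0 := by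
    refine Matrix.eq_zero_of_vecMul_eq_zero (det_arcMoment_ne_zero hU hD) (funext fun j => ?_)
    have hpj := h (j + 1) (by omega) (by omega)
    have hsum : p = ∑ m : Fin N, p.coeff m • X ^ (m : ℕ) := by
      conv_lhs =>
        rw [← p.sum_monomial_eq, ← sum_fin (fun m a => monomial m a) (fun _ => map_zero _) hp]
      simp only [smul_X_eq_monomial]
    rw [hsum, map_sum] at hpj
    simp only [map_smul] at hpj
    exact hpj
  ext m
  by_cases hm : m < N
  · exact congrFun hcoeff ⟨m, hm⟩
  · rw [coeff_eq_zero_of_degree_lt (hp.trans_le (by exact_mod_cast not_lt.1 hm)), coeff_zero]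

end arc

/-! ### The symplectic form on real polynomials -/

/-- A real polynomial, viewed as a complex one. -/
abbrev toC (P : ℝ[X]) : ℂ[X] := P.map (algebraMap ℝ ℂ)

theorem aeval_eq_eval_toC (P : ℝ[X]) (z : ℂ) : aeval z P = (toC P).eval z :=
  (eval_map_algebraMap P z).symm

theorem eval_toC_ofReal (P : ℝ[X]) (x : ℝ) : (toC P).eval (x : ℂ) = ((P.eval x : ℝ) : ℂ) := by
  rw [← aeval_eq_eval_toC]
  exact aeval_algebraMap_apply_eq_algebraMap_eval x P

theorem isPotential_toC {V : ℝ[X]} {D : ℕ} (hD : V.natDegree = D) (hV : 0 < V.leadingCoeff) :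
    IsPotential D (toC V) :=
  ⟨by rw [natDegree_map, hD], V.leadingCoeff, hV, by rw [leadingCoeff_map]; rfl⟩

theorem IsPotential.two_mul {U : ℂ[X]} {D : ℕ} (hU : IsPotential D U) :
    IsPotential D (C 2 * U) := by
  obtain ⟨c, hc, hlead⟩ := hU.leadingCoeff_pos
  refine ⟨by rw [natDegree_C_mul two_ne_zero, hU.natDegree_eq], 2 * c, by positivity, ?_⟩
  rw [leadingCoeff_mul, leadingCoeff_C, hlead, Complex.ofReal_mul, Complex.ofReal_ofNat]

theorem integrable_weighted {D : ℕ} {U : ℂ[X]} (hU : IsPotential D U) (hD : 2 ≤ D)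
    (hDe : Even D) (p : ℂ[X]) : Integrable fun x : ℝ => weighted U p x := by
  have hpos := (hU.stripDecay hD 0 p).integrableOn (continuous_weighted U p)
  have hneg := (hU.stripDecay hD (D / 2) p).integrableOn (continuous_weighted U p)
  simp only [dir_zero, mul_one] at hpos
  simp only [dir_half hDe (by omega), mul_neg, mul_one, ← Complex.ofReal_neg] at hneg
  have hneg' : IntegrableOn (fun x : ℝ => weighted U p (-(-x) : ℝ)) (Set.Iio 0) :=
    IntegrableOn.comp_neg_Iio (c := (0 : ℝ)) (by rwa [neg_zero])
  simp only [neg_neg] at hneg'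
  rw [← integrableOn_univ, ← Set.Iic_union_Ioi (a := (0 : ℝ))]
  exact ((integrableOn_Iic_iff_integrableOn_Iio).2 hneg').union hpos

theorem integral_weighted {D : ℕ} {U : ℂ[X]} (hU : IsPotential D U) (hD : 2 ≤ D)
    (hDe : Even D) (p : ℂ[X]) :
    ∫ x : ℝ, weighted U p x = arcMoment hU hD (D / 2) p := by
  have hint := integrable_weighted hU hD hDe p
  have hneg : ∫ x in Set.Ioi (0 : ℝ), weighted U p (-x : ℝ)
      = ∫ x in Set.Iic (0 : ℝ), weighted U p x := by
    simpa using integral_comp_neg_Ioi (0 : ℝ) (fun x : ℝ => weighted U p x)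
  rw [← intervalIntegral.integral_Iic_add_Ioi hint.integrableOn hint.integrableOn,
    arcMoment_apply, rayMoment_apply, rayMoment_apply, rayIntegral, rayIntegral, ← hneg]
  simp only [dir_half hDe (by omega), dir_zero, mul_one, mul_neg, integral_neg, sub_neg_eq_add,
    Complex.ofReal_neg]
  rw [add_comm]

section real

variable {V : ℝ[X]} {D : ℕ}

theorem weighted_toC_ofReal (V P : ℝ[X]) (x : ℝ) :
    weighted (C 2 * toC V) (toC P) x = ((P.eval x * Real.exp (-2 * V.eval x) : ℝ) : ℂ) := by
  rw [weighted, eval_mul, eval_C, eval_toC_ofReal, eval_toC_ofReal]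
  push_cast
  ring_nf

theorem integrable_eval_mul_exp (hU : IsPotential D (toC V)) (hD : 2 ≤ D) (hDe : Even D)
    (P : ℝ[X]) : Integrable fun x : ℝ => P.eval x * Real.exp (-2 * V.eval x) := by
  have hre := (integrable_weighted hU.two_mul hD hDe (toC P)).re
  simpa only [weighted_toC_ofReal, RCLike.re_to_complex, Complex.ofReal_re] using hre

/-- The linear functional `P ↦ ∫ P e^{-2V}` on real polynomials. -/
def lineMoment (hU : IsPotential D (toC V)) (hD : 2 ≤ D) (hDe : Even D) : ℝ[X] →ₗ[ℝ] ℝ where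
  toFun P := ∫ x : ℝ, P.eval x * Real.exp (-2 * V.eval x)
  map_add' P Q := by
    simp only [eval_add, add_mul]
    exact integral_add (integrable_eval_mul_exp hU hD hDe P) (integrable_eval_mul_exp hU hD hDe Q)
  map_smul' c P := by
    simp only [RingHom.id_apply, eval_smul, smul_eq_mul, mul_assoc, integral_const_mul]

variable (hU : IsPotential D (toC V)) (hD : 2 ≤ D) (hDe : Even D)

theorem lineMoment_apply (P : ℝ[X]) :
    lineMoment hU hD hDe P = ∫ x : ℝ, P.eval x * Real.exp (-2 * V.eval x) := rfl

theorem ofReal_lineMoment (P : ℝ[X]) :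
    ((lineMoment hU hD hDe P : ℝ) : ℂ) = arcMoment hU.two_mul hD (D / 2) (toC P) := by
  rw [← integral_weighted hU.two_mul hD hDe (toC P), lineMoment_apply, ← integral_complex_ofReal]
  simp only [weighted_toC_ofReal]

theorem lineMoment_mul_self_pos {P : ℝ[X]} (hP : P ≠ 0) : 0 < lineMoment hU hD hDe (P * P) := by
  rw [lineMoment_apply,
    integral_pos_iff_support_of_nonneg _ (integrable_eval_mul_exp hU hD hDe (P * P))]
  · have hcont : Continuous fun x : ℝ => (P * P).eval x * Real.exp (-2 * V.eval x) := by fun_prop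
    obtain ⟨x, hx⟩ : ∃ x, P.eval x ≠ 0 := by
      by_contra! h
      exact hP (Polynomial.funext (by simpa using h))
    refine hcont.isOpen_support.measure_pos volume ⟨x, ?_⟩
    rw [Function.mem_support, eval_mul]
    exact mul_ne_zero (mul_ne_zero hx hx) (Real.exp_ne_zero _)
  · intro x
    simp only [Pi.zero_apply, eval_mul]
    exact mul_nonneg (mul_self_nonneg _) (Real.exp_pos _).le

/-- `⟨P, Q⟩₄` as a bilinear form. -/
def skewForm (hU : IsPotential D (toC V)) (hD : 2 ≤ D) (hDe : Even D) :
    ℝ[X] →ₗ[ℝ] ℝ[X] →ₗ[ℝ] ℝ :=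
  let moment := (LinearMap.mul ℝ ℝ[X]).compr₂ (lineMoment hU hD hDe)
  (2⁻¹ : ℝ) • (moment.compl₂ derivative - moment ∘ₗ derivative)

theorem skewForm_apply (P Q : ℝ[X]) : skewForm hU hD hDe P Q
    = 2⁻¹ * lineMoment hU hD hDe (P * derivative Q - derivative P * Q) := by
  rw [map_sub]
  rfl

theorem skewInner_eq_skewForm (P Q : ℝ[X]) : skewInner V P Q = skewForm hU hD hDe P Q := by
  rw [skewInner, skewForm_apply, lineMoment_apply, one_div]
  simp only [eval_sub, eval_mul]

theorem skewInner_swap (V P Q : ℝ[X]) : skewInner V P Q = -skewInner V Q P := by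
  rw [skewInner, skewInner, ← mul_neg, ← integral_neg]
  congr 2 with x
  ring

theorem skewInner_self (V P : ℝ[X]) : skewInner V P P = 0 :=
  self_eq_neg.1 (skewInner_swap V P P)

theorem skewForm_X_mul (P : ℝ[X]) :
    skewForm hU hD hDe P (X * P) = 2⁻¹ * lineMoment hU hD hDe (P * P) := by
  rw [skewForm_apply, derivative_mul, derivative_X]
  congr 2
  ring

theorem skewForm_X_sub_C_mul (x : ℝ) (P : ℝ[X]) :
    skewForm hU hD hDe ((X - C x) * P) P = -(2⁻¹ * lineMoment hU hD hDe (P * P)) := by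
  rw [skewForm_apply, derivative_mul, derivative_X_sub_C, ← mul_neg, ← map_neg]
  congr 2
  ring

theorem exists_isRoot_of_odd_natDegree {P : ℝ[X]} (hP : Odd P.natDegree) :
    ∃ x, P.IsRoot x := by
  by_contra! hno
  wlog hlead : 0 ≤ P.leadingCoeff generalizing P
  · exact this (P := -P) (by rwa [natDegree_neg])
      (fun x => by simpa only [IsRoot.def, eval_neg, neg_eq_zero, ne_eq] using hno x)
      (by rw [leadingCoeff_neg]; linarith)
  have hpos := zero_lt_eval_of_roots_lt_of_leadingCoeff_nonneg (x := 0)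
    (fun y hy => absurd hy (hno y)) hlead
  have hneg := zero_lt_negOnePow_mul_eval_of_lt_roots_of_leadingCoeff_nonneg (x := 0)
    (fun y hy => absurd hy (hno y)) hlead
  rw [Int.negOnePow_odd _ (by exact_mod_cast hP)] at hneg
  push_cast at hneg
  linarith

theorem eq_zero_of_skewForm_eq_zero {k : ℕ} {q : ℝ[X]} (hq : q.degree < (2 * k : ℕ))
    (h : ∀ r : ℝ[X], r.degree < (2 * k : ℕ) → skewForm hU hD hDe q r = 0) : q = 0 := by
  by_contra hq0
  have hqn : q.natDegree < 2 * k := (natDegree_lt_iff_degree_lt hq0).2 hq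
  by_cases hlt : q.natDegree + 1 < 2 * k
  · have hX := h (X * q) (by
      rw [← natDegree_lt_iff_degree_lt (mul_ne_zero X_ne_zero hq0), natDegree_X_mul hq0]
      exact hlt)
    rw [skewForm_X_mul] at hX
    linarith [lineMoment_mul_self_pos hU hD hDe hq0]
  · -- `X * q` has too large a degree, but `q` has odd degree: divide by a linear factor instead.
    obtain ⟨x, hx⟩ := exists_isRoot_of_odd_natDegree (P := q) ⟨k - 1, by omega⟩
    obtain ⟨s, rfl⟩ := dvd_iff_isRoot.2 hx
    have hs0 : s ≠ 0 := right_ne_zero_of_mul hq0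
    rw [natDegree_mul (X_sub_C_ne_zero x) hs0, natDegree_X_sub_C] at hqn
    have hs := h s ((natDegree_lt_iff_degree_lt hs0).1 (by omega))
    rw [skewForm_X_sub_C_mul] at hs
    linarith [lineMoment_mul_self_pos hU hD hDe hs0]

instance finiteDimensional_degreeLT (K : Type*) [Field K] (n : ℕ) :
    FiniteDimensional K (degreeLT K n) :=
  Module.Finite.equiv (degreeLTEquiv K n).symm

theorem finrank_degreeLT (K : Type*) [Field K] (n : ℕ) : Module.finrank K (degreeLT K n) = n := by
  rw [(degreeLTEquiv K n).finrank_eq, Module.finrank_fin_fun]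

theorem exists_skewForm_sub_eq_zero (k : ℕ) (f : ℝ[X]) : ∃ q : ℝ[X], q.degree < (2 * k : ℕ) ∧
    ∀ r : ℝ[X], r.degree < (2 * k : ℕ) → skewForm hU hD hDe (f - q) r = 0 := by
  let W := degreeLT ℝ (2 * k)
  let T : W →ₗ[ℝ] Module.Dual ℝ W := (skewForm hU hD hDe).domRestrict₁₂ W W
  have hinj : Function.Injective T := by
    rw [← LinearMap.ker_eq_bot, LinearMap.ker_eq_bot']
    intro q hq
    refine Subtype.ext (eq_zero_of_skewForm_eq_zero hU hD hDe (mem_degreeLT.1 q.2) fun r hr => ?_)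
    exact LinearMap.congr_fun hq ⟨r, mem_degreeLT.2 hr⟩
  have hsurj : Function.Surjective T :=
    (LinearMap.injective_iff_surjective_of_finrank_eq_finrank
      (Subspace.dual_finrank_eq (K := ℝ) (V := W)).symm).1 hinj
  obtain ⟨q, hq⟩ := hsurj ((skewForm hU hD hDe f).domRestrict W)
  refine ⟨q, mem_degreeLT.1 q.2, fun r hr => ?_⟩
  rw [map_sub, LinearMap.sub_apply, sub_eq_zero]
  exact (LinearMap.congr_fun hq ⟨r, mem_degreeLT.2 hr⟩).symm

theorem exists_isSkewOrthogonal (hU : IsPotential D (toC V)) (hD : 2 ≤ D) (hDe : Even D) :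
    ∃ P : ℕ → ℝ[X], IsSkewOrthogonal V P := by
  choose q hq horth using fun m : ℕ => exists_skewForm_sub_eq_zero hU hD hDe (m / 2) (X ^ m)
  have hdeg : ∀ m, (q m).degree < (X ^ m : ℝ[X]).degree := fun m => by
    rw [degree_X_pow]
    exact (hq m).trans_le (by exact_mod_cast (by omega : 2 * (m / 2) ≤ m))
  have hmonic : ∀ m, (X ^ m - q m).Monic := fun m => (monic_X_pow m).sub_of_left (hdeg m)
  have hnat : ∀ m, (X ^ m - q m).natDegree = m := fun m =>
    natDegree_eq_of_degree_eq_some (by rw [degree_sub_eq_left_of_degree_lt (hdeg m), degree_X_pow])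
  have hlt : ∀ a b, b / 2 < a / 2 → skewInner V (X ^ a - q a) (X ^ b - q b) = 0 := by
    intro a b hab
    rw [skewInner_eq_skewForm hU hD hDe]
    refine horth a _ ?_
    rw [← natDegree_lt_iff_degree_lt (hmonic b).ne_zero, hnat]
    omega
  have hne : ∀ a b, a / 2 ≠ b / 2 → skewInner V (X ^ a - q a) (X ^ b - q b) = 0 := by
    intro a b hab
    rcases lt_or_gt_of_ne hab with h | h
    · rw [skewInner_swap, hlt b a h, neg_zero]
    · exact hlt a b h
  refine ⟨fun m => X ^ m - q m, hmonic, hnat, fun k l => ?_, fun k l => ?_,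
    fun k l hkl => hne _ _ (by omega)⟩
  · rcases eq_or_ne k l with rfl | h
    · exact skewInner_self V _
    · exact hne _ _ (by omega)
  · rcases eq_or_ne k l with rfl | h
    · exact skewInner_self V _
    · exact hne _ _ (by omega)

theorem exists_eq_sum_of_degree_eq {K : Type*} [Field K] {P : ℕ → K[X]}
    (hP : ∀ m, (P m).degree = m) {N : ℕ} {q : K[X]} (hq : q.degree < N) :
    ∃ c : ℕ → K, q = ∑ j ∈ Finset.range N, c j • P j := by
  have hspan := Sequence.span_degreeLT ⟨P, hP⟩ (m := N) fun i _ => isUnit_iff_ne_zero.2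
    (leadingCoeff_ne_zero.2 (Sequence.ne_zero ⟨P, hP⟩ i))
  obtain ⟨c, hc, hsum⟩ := (Finsupp.mem_span_image_iff_linearCombination K).1
    (hspan ▸ mem_degreeLT.2 hq)
  refine ⟨c, hsum.symm.trans ?_⟩
  rw [Finsupp.linearCombination_apply]
  refine Finsupp.sum_of_support_subset c (fun i hi => ?_) _ fun i _ => zero_smul K _
  exact Finset.mem_range.2 ((Finsupp.mem_supported K c).1 hc hi)

theorem IsSkewOrthogonal.degree_eq {P : ℕ → ℝ[X]} (hP : IsSkewOrthogonal V P) (m : ℕ) :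
    (P m).degree = m := by
  rw [degree_eq_natDegree (hP.monic m).ne_zero, hP.natDegree_eq]

theorem IsSkewOrthogonal.skewInner_eq_zero {P : ℕ → ℝ[X]} (hP : IsSkewOrthogonal V P) {a b : ℕ}
    (h : a = b ∨ a / 2 ≠ b / 2) : skewInner V (P a) (P b) = 0 := by
  rcases h with rfl | h
  · exact skewInner_self V _
  · obtain ⟨k, rfl | rfl⟩ := Nat.even_or_odd' a <;> obtain ⟨l, rfl | rfl⟩ := Nat.even_or_odd' b
    · exact hP.even_even k l
    · exact hP.even_odd k l (by omega)
    · rw [skewInner_swap, hP.even_odd l k (by omega), neg_zero]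
    · exact hP.odd_odd k l

theorem IsSkewOrthogonal.skewNorm_pos {P : ℕ → ℝ[X]} (hP : IsSkewOrthogonal V P)
    (hU : IsPotential D (toC V)) (hD : 2 ≤ D) (hDe : Even D) (k : ℕ) : 0 < skewNorm V P k := by
  have hmonic : (X * P (2 * k)).Monic := monic_X.mul (hP.monic _)
  have hdeg : (X * P (2 * k)).degree = ((2 * k + 1 : ℕ) : WithBot ℕ) := by
    rw [degree_mul, degree_X, hP.degree_eq]
    push_cast
    rw [add_comm]
  have hlt : (X * P (2 * k) - P (2 * k + 1)).degree < ((2 * k + 1 : ℕ) : WithBot ℕ) := by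
    rw [← hdeg]
    refine degree_sub_lt_left (by rw [hdeg, hP.degree_eq]) hmonic.ne_zero ?_
    rw [hmonic.leadingCoeff, (hP.monic _).leadingCoeff]
  obtain ⟨c, hc⟩ := exists_eq_sum_of_degree_eq hP.degree_eq hlt
  have horth : skewForm hU hD hDe (P (2 * k)) (X * P (2 * k) - P (2 * k + 1)) = 0 := by
    rw [hc, map_sum]
    refine Finset.sum_eq_zero fun j hj => ?_
    have hj' := Finset.mem_range.1 hj
    rw [map_smul, ← skewInner_eq_skewForm, hP.skewInner_eq_zero (by omega), smul_zero]
  rw [map_sub, sub_eq_zero, skewForm_X_mul] at horth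
  rw [skewNorm, skewInner_eq_skewForm hU hD hDe, ← horth]
  exact mul_pos (by norm_num) (lineMoment_mul_self_pos hU hD hDe (hP.monic _).ne_zero)

end real

/-! ### The symplectic form on complex polynomials -/

section complexForm

variable {V : ℝ[X]} {D : ℕ} (hU : IsPotential D (toC V)) (hD : 2 ≤ D)

/-- The form `(P, Q) ↦ ∫ P e^{-V} (Q e^{-V})'` on complex polynomials; after an integration by
parts it is the complexification of `⟨P, Q⟩₄`. -/
def cskew (hU : IsPotential D (toC V)) (hD : 2 ≤ D) : ℂ[X] →ₗ[ℂ] ℂ[X] →ₗ[ℂ] ℂ :=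
  ((LinearMap.mul ℂ ℂ[X]).compr₂ (arcMoment hU.two_mul hD (D / 2))).compl₂ (twist (toC V))

theorem cskew_apply (P Q : ℂ[X]) :
    cskew hU hD P Q = arcMoment hU.two_mul hD (D / 2) (P * twist (toC V) Q) := rfl

theorem mul_twist_add_mul_twist {R : Type*} [CommRing R] (U P Q : R[X]) :
    P * twist U Q + Q * twist U P = twist (C 2 * U) (P * Q) := by
  simp only [twist_apply, derivative_mul, derivative_C, zero_mul, zero_add]
  rw [map_ofNat]
  ring

theorem cskew_swap (P Q : ℂ[X]) : cskew hU hD P Q = -cskew hU hD Q P := by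
  rw [eq_neg_iff_add_eq_zero, cskew_apply, cskew_apply, ← map_add, mul_twist_add_mul_twist,
    arcMoment_twist]

theorem cskew_toC (hDe : Even D) (P Q : ℝ[X]) :
    cskew hU hD (toC P) (toC Q) = ((skewInner V P Q : ℝ) : ℂ) := by
  have hsub : cskew hU hD (toC P) (toC Q) - cskew hU hD (toC Q) (toC P)
      = arcMoment hU.two_mul hD (D / 2) (toC (P * derivative Q - derivative P * Q)) := by
    rw [cskew_apply, cskew_apply, ← map_sub]
    congr 1
    simp only [twist_apply, toC, Polynomial.map_sub, Polynomial.map_mul, ← derivative_map]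
    ring
  rw [cskew_swap hU hD (toC Q), sub_neg_eq_add, ← two_mul, ← ofReal_lineMoment hU hD hDe] at hsub
  rw [skewInner_eq_skewForm hU hD hDe, skewForm_apply, Complex.ofReal_mul, ← hsub]
  push_cast
  ring

theorem degree_toC (P : ℝ[X]) : (toC P).degree = P.degree :=
  degree_map P (algebraMap ℝ ℂ)

theorem IsSkewOrthogonal.exists_eq_sum {P : ℕ → ℝ[X]} (hP : IsSkewOrthogonal V P) {N : ℕ}
    {q : ℂ[X]} (hq : q.degree < N) :
    ∃ c : ℕ → ℂ, q = ∑ j ∈ Finset.range N, c j • toC (P j) :=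
  exists_eq_sum_of_degree_eq (fun m => (degree_toC _).trans (hP.degree_eq m)) hq

theorem IsSkewOrthogonal.cskew_even_sum {P : ℕ → ℝ[X]} (hP : IsSkewOrthogonal V P)
    (hU : IsPotential D (toC V)) (hD : 2 ≤ D) (hDe : Even D) {n k : ℕ} (hk : k < n) (c : ℕ → ℂ) :
    cskew hU hD (toC (P (2 * k))) (∑ j ∈ Finset.range (2 * n), c j • toC (P j))
      = c (2 * k + 1) * skewNorm V P k := by
  simp only [map_sum, map_smul, smul_eq_mul, cskew_toC hU hD hDe]
  rw [Finset.sum_eq_single_of_mem (2 * k + 1) (Finset.mem_range.2 (by omega))]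
  · rfl
  · intro j _ hj
    rw [hP.skewInner_eq_zero (by omega), Complex.ofReal_zero, mul_zero]

theorem IsSkewOrthogonal.cskew_odd_sum {P : ℕ → ℝ[X]} (hP : IsSkewOrthogonal V P)
    (hU : IsPotential D (toC V)) (hD : 2 ≤ D) (hDe : Even D) {n k : ℕ} (hk : k < n) (c : ℕ → ℂ) :
    cskew hU hD (toC (P (2 * k + 1))) (∑ j ∈ Finset.range (2 * n), c j • toC (P j))
      = -(c (2 * k) * skewNorm V P k) := by
  simp only [map_sum, map_smul, smul_eq_mul, cskew_toC hU hD hDe]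
  rw [Finset.sum_eq_single_of_mem (2 * k) (Finset.mem_range.2 (by omega))]
  · rw [skewInner_swap, Complex.ofReal_neg, mul_neg, skewNorm]
  · intro j _ hj
    rw [hP.skewInner_eq_zero (by omega), Complex.ofReal_zero, mul_zero]

theorem eq_zero_of_cskew_eq_zero {n : ℕ} (hDe : Even D) {q : ℂ[X]} (hq : q.degree < (2 * n : ℕ))
    (h : ∀ p : ℂ[X], p.degree < (2 * n : ℕ) → cskew hU hD p q = 0) : q = 0 := by
  obtain ⟨P, hP⟩ := exists_isSkewOrthogonal hU hD hDe
  obtain ⟨c, rfl⟩ := hP.exists_eq_sum hq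
  have horth : ∀ m < 2 * n,
      cskew hU hD (toC (P m)) (∑ j ∈ Finset.range (2 * n), c j • toC (P j)) = 0 := fun m hm =>
    h _ (by rw [degree_toC, hP.degree_eq]; exact_mod_cast hm)
  have hnorm : ∀ k, (skewNorm V P k : ℂ) ≠ 0 := fun k =>
    Complex.ofReal_ne_zero.2 (hP.skewNorm_pos hU hD hDe k).ne'
  refine Finset.sum_eq_zero fun j hj => ?_
  have hj' := Finset.mem_range.1 hj
  suffices c j = 0 by rw [this, zero_smul]
  obtain ⟨k, rfl | rfl⟩ := Nat.even_or_odd' j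
  · have hodd := horth (2 * k + 1) (by omega)
    rw [hP.cskew_odd_sum hU hD hDe (by omega), neg_eq_zero] at hodd
    exact (mul_eq_zero.1 hodd).resolve_right (hnorm k)
  · have heven := horth (2 * k) (by omega)
    rw [hP.cskew_even_sum hU hD hDe (by omega)] at heven
    exact (mul_eq_zero.1 heven).resolve_right (hnorm k)

/-! ### The moment map -/

/-- The moments that determine the first column of the solution: the moments of `p e^{-2V}` on
the real line against `x^m` for `m < 2n`, and the integrals of `p e^{-V}` over the arcs. -/
def momentMap (hU : IsPotential D (toC V)) (hD : 2 ≤ D) (n : ℕ) :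
    degreeLT ℂ (2 * n + (D - 1)) →ₗ[ℂ] (Fin (2 * n) → ℂ) × (Fin (D - 1) → ℂ) :=
  LinearMap.prod
    (LinearMap.pi fun m => (arcMoment hU.two_mul hD (D / 2)) ∘ₗ
      (LinearMap.mulLeft ℂ (X ^ (m : ℕ) : ℂ[X])) ∘ₗ (degreeLT ℂ (2 * n + (D - 1))).subtype)
    (LinearMap.pi fun j => (arcMoment hU hD (j + 1)) ∘ₗ (degreeLT ℂ (2 * n + (D - 1))).subtype)

theorem momentMap_eq_iff (n : ℕ) (p : degreeLT ℂ (2 * n + (D - 1))) (a b : ℕ → ℂ) :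
    momentMap hU hD n p = (fun m : Fin (2 * n) => a m, fun j : Fin (D - 1) => b (j + 1)) ↔
      (∀ m < 2 * n, arcMoment hU.two_mul hD (D / 2) (X ^ m * (p : ℂ[X])) = a m) ∧
      ∀ j, 1 ≤ j → j < D → arcMoment hU hD j (p : ℂ[X]) = b j := by
  rw [Prod.ext_iff, funext_iff, funext_iff, Fin.forall_iff, Fin.forall_iff]
  refine and_congr Iff.rfl ⟨fun h j hj0 hj => ?_, fun h j hj => h _ (by omega) (by omega)⟩
  obtain ⟨i, rfl⟩ := Nat.exists_eq_add_of_le' hj0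
  exact h i (by omega)

theorem momentMap_injective (hDe : Even D) (n : ℕ) :
    Function.Injective (momentMap hU hD n) := by
  rw [← LinearMap.ker_eq_bot, LinearMap.ker_eq_bot']
  intro p h
  obtain ⟨hline, harc⟩ := (momentMap_eq_iff hU hD n p (fun _ => 0) (fun _ => 0)).1 h
  obtain ⟨p, hp⟩ := p
  dsimp only at hline harc
  rw [Submodule.mk_eq_zero]
  have hdeg : (toC V).natDegree ≠ 0 := by
    rw [hU.natDegree_eq]
    omega
  obtain ⟨p₀, q, hp₀, rfl⟩ := exists_eq_add_twist hdeg p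
  rw [hU.natDegree_eq] at hp₀
  obtain rfl : p₀ = 0 := eq_zero_of_arcMoment_eq_zero hU hD hp₀ fun j hj0 hj => by
    have := harc j hj0 hj
    rwa [map_add, arcMoment_twist, add_zero] at this
  simp only [zero_add] at hp hline
  have hq : q.degree < (2 * n : ℕ) := by
    rwa [← degree_twist_lt_iff hdeg, hU.natDegree_eq, ← mem_degreeLT]
  have hskew : ∀ m < 2 * n, (cskew hU hD).flip q (X ^ m) = 0 := fun m hm => by
    rw [LinearMap.flip_apply, cskew_apply]
    exact hline m hm
  obtain rfl : q = 0 := eq_zero_of_cskew_eq_zero hU hD hDe hq fun r hr => by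
    rw [← LinearMap.flip_apply]
    exact map_eq_zero_of_degree_lt hskew hr
  rw [map_zero, add_zero]

theorem momentMap_surjective (hDe : Even D) (n : ℕ) :
    Function.Surjective (momentMap hU hD n) := by
  refine (LinearMap.injective_iff_surjective_of_finrank_eq_finrank ?_).1
    (momentMap_injective hU hD hDe n)
  rw [finrank_degreeLT, Module.finrank_prod, Module.finrank_fin_fun, Module.finrank_fin_fun]

theorem exists_moments (hDe : Even D) (n : ℕ) (a : ℕ → ℂ) (b : ℕ → ℂ) :
    ∃ p : ℂ[X], p.degree < (2 * n + (D - 1) : ℕ) ∧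
      (∀ m < 2 * n, arcMoment hU.two_mul hD (D / 2) (X ^ m * p) = a m) ∧
      ∀ j, 1 ≤ j → j < D → arcMoment hU hD j p = b j := by
  obtain ⟨p, hp⟩ := momentMap_surjective hU hD hDe n
    (fun m : Fin (2 * n) => a m, fun j : Fin (D - 1) => b (j + 1))
  exact ⟨p, mem_degreeLT.1 p.2, (momentMap_eq_iff hU hD n p a b).1 hp⟩

end complexForm

/-! ### The jump matrix -/

theorem fin_eq_one_iff {D : ℕ} (hD : 2 ≤ D) (j : Fin (D + 1)) : j = 1 ↔ (j : ℕ) = 1 := by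
  rw [Fin.ext_iff, Fin.val_one', Nat.mod_eq_of_lt (by omega)]

theorem fin_one_ne_zero {D : ℕ} (hD : 2 ≤ D) : (1 : Fin (D + 1)) ≠ 0 := fun h =>
  zero_ne_one ((fin_eq_one_iff hD 0).1 h.symm)

/-- The potential in the weight of column `j ≠ 0` of the jump matrix: `2V` for the column `1`,
which belongs to the real line, and `V` for the others. -/
def colPot (V : ℝ[X]) {D : ℕ} (j : Fin (D + 1)) : ℂ[X] := if j = 1 then C 2 * toC V else toC V

/-- The index of the arc that carries the weight of column `j ≠ 0` of the jump matrix. The real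
line is the arc `D / 2`. -/
def colArc {D : ℕ} (j : Fin (D + 1)) : ℕ := if j = 1 then D / 2 else j - 1

theorem isPotential_colPot {V : ℝ[X]} {D : ℕ} (hU : IsPotential D (toC V)) (j : Fin (D + 1)) :
    IsPotential D (colPot V j) := by
  unfold colPot
  split_ifs
  exacts [hU.two_mul, hU]

theorem colArc_mem {D : ℕ} (hD : 2 ≤ D) {j : Fin (D + 1)} (hj : j ≠ 0) :
    1 ≤ colArc j ∧ colArc j < D := by
  have hj0 : (j : ℕ) ≠ 0 := fun h => hj (Fin.ext h)
  have hjD := j.2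
  unfold colArc
  split_ifs with hj1
  · omega
  · rw [fin_eq_one_iff hD] at hj1
    omega

/-- The first row of the jump matrix without its diagonal entry. -/
def jumpRow (V : ℝ[X]) (D : ℕ) (x : ℂ) (j : Fin (D + 1)) : ℂ :=
  if j = 0 then 0 else Set.indicator (arc D (colArc j)) (weighted (colPot V j) 1) x

theorem mem_arc_half_iff {D : ℕ} (hD : 2 ≤ D) (hDe : Even D) (x : ℂ) :
    x ∈ arc D (D / 2) ↔ x.im = 0 := by
  rw [arc, Set.mem_union, mem_ray_iff, mem_ray_iff, dir_half hDe (by omega), dir_zero]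
  simp only [div_one, div_neg, Complex.neg_re, Complex.neg_im, neg_eq_zero, ← or_and_right]
  refine and_iff_right ?_
  rcases le_total 0 x.re with h | h
  exacts [Or.inl h, Or.inr (by linarith)]

theorem jump_zero_apply {V : ℝ[X]} {D : ℕ} (hD : 2 ≤ D) (hDe : Even D) (x : ℂ) {j : Fin (D + 1)}
    (hj : j ≠ 0) : jump V D x 0 j = jumpRow V D x j := by
  simp only [jump, Matrix.of_apply, if_neg hj.symm, if_true, jumpRow, if_neg hj, colArc, colPot]
  split_ifs
  · have real_line : {w : ℂ | w.im = 0} = arc D (D / 2) :=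
      Set.ext fun w => (mem_arc_half_iff hD hDe w).symm
    rw [real_line]
    congr 1
    ext w
    simp only [weighted, aeval_eq_eval_toC, eval_mul, eval_C, eval_one, one_mul, neg_mul]
  · congr 1
    ext w
    simp only [weighted, aeval_eq_eval_toC, eval_one, one_mul]

theorem jump_eq {V : ℝ[X]} {D : ℕ} (hD : 2 ≤ D) (hDe : Even D) (x : ℂ) (i j : Fin (D + 1)) :
    jump V D x i j = (1 : Matrix (Fin (D + 1)) (Fin (D + 1)) ℂ) i j
      + if i = 0 then jumpRow V D x j else 0 := by
  rcases eq_or_ne i j with rfl | hij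
  · simp only [jump, Matrix.of_apply, if_true, Matrix.one_apply_eq, jumpRow]
    split_ifs <;> simp
  rw [Matrix.one_apply_ne hij, zero_add]
  split_ifs with hi
  · subst hi
    exact jump_zero_apply hD hDe x hij.symm
  · simp only [jump, Matrix.of_apply, if_neg hij, if_neg hi]

theorem vecMul_jump {V : ℝ[X]} {D : ℕ} (hD : 2 ≤ D) (hDe : Even D) (x : ℂ) (b : Fin (D + 1) → ℂ) :
    Matrix.vecMul b (jump V D x) = fun j => b j + b 0 * jumpRow V D x j := by
  ext j
  simp only [Matrix.vecMul, dotProduct, jump_eq hD hDe, mul_add, Finset.sum_add_distrib, mul_ite,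
    mul_zero, Finset.sum_ite_eq', Finset.mem_univ, if_true, Matrix.one_apply, mul_one]

theorem det_jump {V : ℝ[X]} {D : ℕ} (hD : 2 ≤ D) (hDe : Even D) (x : ℂ) :
    (jump V D x).det = 1 := by
  rw [Matrix.det_of_isUpperTriangular]
  · refine Finset.prod_eq_one fun i _ => ?_
    rw [jump_eq hD hDe, Matrix.one_apply_eq, jumpRow]
    split_ifs <;> simp
  · intro i j hji
    replace hji : j < i := hji
    have hi : i ≠ 0 := ((Fin.zero_le j).trans_lt hji).ne'
    rw [jump_eq hD hDe, Matrix.one_apply_ne hji.ne', if_neg hi, add_zero]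

/-! ### Row solutions -/

/-- A row vector with the analytic properties of a row of a solution of the Riemann-Hilbert
problem, without normalisation at infinity. -/
structure IsRowSolution (V : ℝ[X]) (D : ℕ) (r : ℂ → Fin (D + 1) → ℂ) : Prop where
  analytic : ∀ j, DifferentiableOn ℂ (fun z => r z j) (contour D)ᶜ
  boundary : ∀ k < D, ∀ x ∈ ray D k, x ≠ 0 → ∃ b : Fin (D + 1) → ℂ,
    Tendsto r (𝓝[leftSide D k \ contour D] x) (𝓝 (Matrix.vecMul b (jump V D x))) ∧
    Tendsto r (𝓝[rightSide D k \ contour D] x) (𝓝 b)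
  bounded_near_zero : ∃ ρ > (0 : ℝ), ∃ C : ℝ, ∀ z, z ∉ contour D → ‖z‖ < ρ → ∀ j, ‖r z j‖ ≤ C

/-- The row with first entry `p`, completed by Cauchy transforms of the weighted polynomial `p`
along the arcs. Every row of a solution has this form. -/
def cauchyRow (V : ℝ[X]) (D : ℕ) (p : ℂ[X]) (z : ℂ) (j : Fin (D + 1)) : ℂ :=
  if j = 0 then p.eval z else arcCauchy D (colArc j) (weighted (colPot V j) p) z

theorem cauchyRow_zero (V : ℝ[X]) (D : ℕ) (p : ℂ[X]) :
    (fun z => cauchyRow V D p z 0) = fun z => p.eval z := rfl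

theorem cauchyRow_of_ne_zero (V : ℝ[X]) {D : ℕ} (p : ℂ[X]) {j : Fin (D + 1)} (hj : j ≠ 0) :
    (fun z => cauchyRow V D p z j) = arcCauchy D (colArc j) (weighted (colPot V j) p) := by
  simp only [cauchyRow, if_neg hj]

theorem eval_mul_jumpRow (V : ℝ[X]) {D : ℕ} (p : ℂ[X]) (x : ℂ) {j : Fin (D + 1)} (hj : j ≠ 0) :
    p.eval x * jumpRow V D x j
      = Set.indicator (arc D (colArc j)) (weighted (colPot V j) p) x := by
  rw [jumpRow, if_neg hj, ← Set.indicator_mul_right _ fun w => p.eval w]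
  congr 1
  ext w
  simp only [weighted, eval_one, one_mul]

theorem tendsto_cauchyRow {V : ℝ[X]} {D k : ℕ} (hU : IsPotential D (toC V)) (hD : 2 ≤ D)
    (p : ℂ[X]) (hk : k < D) {x : ℂ} (hx : x ∈ ray D k) (hx0 : x ≠ 0) (j : Fin (D + 1)) :
    ∃ b : ℂ, (j = 0 → b = p.eval x) ∧
      Tendsto (fun z => cauchyRow V D p z j) (𝓝[leftSide D k \ contour D] x)
        (𝓝 (b + p.eval x * jumpRow V D x j)) ∧
      Tendsto (fun z => cauchyRow V D p z j) (𝓝[rightSide D k \ contour D] x) (𝓝 b) := by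
  rcases eq_or_ne j 0 with rfl | hj
  · have heval : Tendsto (fun z => p.eval z) (𝓝 x) (𝓝 (p.eval x)) := p.continuous.tendsto x
    rw [cauchyRow_zero, jumpRow, if_pos rfl, mul_zero]
    refine ⟨p.eval x, fun _ => rfl, ?_, heval.mono_left nhdsWithin_le_nhds⟩
    rw [add_zero]
    exact heval.mono_left nhdsWithin_le_nhds
  · obtain ⟨hj1, hjD⟩ := colArc_mem hD hj
    obtain ⟨b, hleft, hright⟩ :=
      tendsto_arcCauchy (isPotential_colPot hU j) hD hj1 hjD p hk hx hx0
    rw [cauchyRow_of_ne_zero V p hj, eval_mul_jumpRow V p x hj]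
    exact ⟨b, fun h => absurd h hj, hleft, hright⟩

theorem exists_forall_norm_le_near_zero {ι E : Type*} [Finite ι] [SeminormedAddCommGroup E]
    {S : Set ℂ} {f : ι → ℂ → E}
    (h : ∀ i, ∃ ρ > (0 : ℝ), ∃ C : ℝ, ∀ z, z ∉ S → ‖z‖ < ρ → ‖f i z‖ ≤ C) :
    ∃ ρ > (0 : ℝ), ∃ C : ℝ, ∀ z, z ∉ S → ‖z‖ < ρ → ∀ i, ‖f i z‖ ≤ C := by
  choose ρ hρ C hC using h
  cases isEmpty_or_nonempty ι
  · exact ⟨1, one_pos, 0, fun z _ _ i => isEmptyElim i⟩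
  obtain ⟨i₀, hρ_min⟩ := Finite.exists_min ρ
  obtain ⟨i₁, hC_max⟩ := Finite.exists_max C
  exact ⟨ρ i₀, hρ i₀, C i₁, fun z hz hzρ i =>
    (hC i z hz (hzρ.trans_le (hρ_min i))).trans (hC_max i)⟩

theorem exists_norm_cauchyRow_le_near_zero {V : ℝ[X]} {D : ℕ} (hU : IsPotential D (toC V))
    (hD : 2 ≤ D) (p : ℂ[X]) (j : Fin (D + 1)) :
    ∃ ρ > (0 : ℝ), ∃ C : ℝ, ∀ z, z ∉ contour D → ‖z‖ < ρ → ‖cauchyRow V D p z j‖ ≤ C := by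
  rcases eq_or_ne j 0 with rfl | hj
  · obtain ⟨B, hB, hbound⟩ := exists_norm_eval_le p le_rfl
    refine ⟨1, one_pos, B * (1 + 1) ^ p.natDegree, fun z _ hz => (hbound z).trans ?_⟩
    gcongr
  · simp only [cauchyRow, if_neg hj]
    exact exists_norm_arcCauchy_le_near_zero (isPotential_colPot hU j) hD (colArc_mem hD hj).2 p

theorem isRowSolution_cauchyRow {V : ℝ[X]} {D : ℕ} (hU : IsPotential D (toC V)) (hD : 2 ≤ D)
    (hDe : Even D) (p : ℂ[X]) : IsRowSolution V D (cauchyRow V D p) where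
  analytic j := by
    rcases eq_or_ne j 0 with rfl | hj
    · rw [cauchyRow_zero]
      exact p.differentiable.differentiableOn
    · rw [cauchyRow_of_ne_zero V p hj]
      exact differentiableOn_arcCauchy (isPotential_colPot hU j) hD (colArc_mem hD hj).2 p
  boundary k hk x hx hx0 := by
    choose b hb0 hleft hright using tendsto_cauchyRow hU hD p hk hx hx0
    refine ⟨b, ?_, tendsto_pi_nhds.2 hright⟩
    rw [vecMul_jump hD hDe, hb0 0 rfl]
    exact tendsto_pi_nhds.2 hleft
  bounded_near_zero := exists_forall_norm_le_near_zero (f := fun j z => cauchyRow V D p z j)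
    (exists_norm_cauchyRow_le_near_zero hU hD p)

theorem isRowSolution_single {V : ℝ[X]} {D : ℕ} (hD : 2 ≤ D) (hDe : Even D) {i : Fin (D + 1)}
    (hi : i ≠ 0) : IsRowSolution V D fun _ => Pi.single i 1 where
  analytic j := differentiableOn_const _
  boundary _ _ x _ _ := by
    refine ⟨Pi.single i 1, ?_, tendsto_const_nhds⟩
    rw [vecMul_jump hD hDe]
    simp only [Pi.single_eq_of_ne hi.symm, zero_mul, add_zero]
    exact tendsto_const_nhds
  bounded_near_zero := by
    refine ⟨1, one_pos, 1, fun z _ _ j => ?_⟩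
    rw [Pi.single_apply]
    split_ifs <;> simp

theorem IsEvenSolution.isRowSolution {V : ℝ[X]} {D n : ℕ}
    {A : ℂ → Matrix (Fin (D + 1)) (Fin (D + 1)) ℂ} (hA : IsEvenSolution V D n A) (hD : 2 ≤ D)
    (i : Fin (D + 1)) : IsRowSolution V D fun z => A z i where
  analytic j := hA.analytic i j
  boundary k hk x hx hx0 := by
    obtain ⟨Ap, Am, -, -, hlim, hjump⟩ := hA.boundary
    obtain ⟨hplus, hminus⟩ := hlim k hk x hx hx0
    refine ⟨Am x i, ?_, tendsto_pi_nhds.1 hminus i⟩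
    rw [hjump x ⟨(mem_contour_iff hD).2 ⟨k, hk, hx⟩, hx0⟩] at hplus
    exact tendsto_pi_nhds.1 hplus i
  bounded_near_zero := by
    obtain ⟨ρ, hρ, C, hC⟩ := hA.bounded_near_zero
    exact ⟨ρ, hρ, C, fun z hz hzρ j => hC z hz hzρ i j⟩

/-! ### Assembling a solution from its rows -/

theorem ray_mem_nhdsWithin_contour {D k : ℕ} (hD : 2 ≤ D) (hk : k < D) {x : ℂ}
    (hx : x ∈ ray D k) (hx0 : x ≠ 0) : ray D k ∈ 𝓝[contour D] x := by
  have half_plane : {z : ℂ | 0 < (z / dir D k).re} ∈ 𝓝 x :=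
    (isOpen_lt continuous_const (by fun_prop)).mem_nhds (div_dir_re_pos hx hx0)
  filter_upwards [self_mem_nhdsWithin, nhdsWithin_le_nhds half_plane,
    nhdsWithin_le_nhds (eventually_mem_contour_iff hD hk hx hx0)] with z hz hre hiff
  exact mem_ray_iff.2 ⟨le_of_lt hre, hiff.1 hz⟩

theorem exists_continuousOn_boundary_values {Y : Type*} [TopologicalSpace Y] [RegularSpace Y]
    [Nonempty Y] {D : ℕ} (hD : 2 ≤ D) (S : ℕ → Set ℂ) {A : ℂ → Y}
    (hS : ∀ k < D, ∀ x ∈ ray D k, x ≠ 0 → (𝓝[S k] x).NeBot)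
    (h : ∀ k < D, ∀ x ∈ ray D k, x ≠ 0 → ∃ M, Tendsto A (𝓝[S k] x) (𝓝 M)) :
    ∃ Ap : ℂ → Y, ContinuousOn Ap (contour D \ {0}) ∧
      ∀ k < D, ∀ x ∈ ray D k, x ≠ 0 → Tendsto A (𝓝[S k] x) (𝓝 (Ap x)) := by
  classical
  inhabit Y
  let Ap : ℂ → Y := fun x =>
    if hx : ∃ k < D, x ∈ ray D k then extendFrom (S hx.choose) A x else default
  have hAp : ∀ k < D, ∀ x ∈ ray D k, x ≠ 0 → Ap x = extendFrom (S k) A x := by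
    intro k hk x hx hx0
    have hex : ∃ k < D, x ∈ ray D k := ⟨k, hk, hx⟩
    have choose_eq : hex.choose = k :=
      eq_of_mem_ray (by omega) hex.choose_spec.1 hk hx0 hex.choose_spec.2 hx
    simp only [Ap, dif_pos hex, choose_eq]
  refine ⟨Ap, fun x hx => ?_, fun k hk x hx hx0 => ?_⟩
  · obtain ⟨k, hk, hxk⟩ := (mem_contour_iff hD).1 hx.1
    have continuousOn_ray : ContinuousOn (extendFrom (S k) A) (ray D k \ {0}) :=
      continuousOn_extendFrom
        (fun y hy => mem_closure_iff_nhdsWithin_neBot.2 (hS k hk y hy.1 hy.2))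
        fun y hy => h k hk y hy.1 hy.2
    have ray_mem : ray D k \ {0} ∈ 𝓝[contour D \ {0}] x :=
      Filter.inter_mem (nhdsWithin_mono x Set.sdiff_subset
        (ray_mem_nhdsWithin_contour hD hk hxk hx.2))
        (mem_of_superset self_mem_nhdsWithin fun y hy => hy.2)
    refine ((continuousOn_ray x ⟨hxk, hx.2⟩).mono_of_mem_nhdsWithin ray_mem).congr_of_eventuallyEq
      ?_ (hAp k hk x hxk hx.2)
    filter_upwards [ray_mem] with y hy using hAp k hk y hy.1 hy.2
  · rw [hAp k hk x hx hx0]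
    exact tendsto_extendFrom (h k hk x hx hx0)

theorem exists_boundary_of_rows {V : ℝ[X]} {D : ℕ} (hD : 2 ≤ D)
    {A : ℂ → Matrix (Fin (D + 1)) (Fin (D + 1)) ℂ} (hA : ∀ i, IsRowSolution V D fun z => A z i) :
    ∃ Ap Am : ℂ → Matrix (Fin (D + 1)) (Fin (D + 1)) ℂ,
      ContinuousOn Ap (contour D \ {0}) ∧ ContinuousOn Am (contour D \ {0}) ∧
      (∀ k < D, ∀ x ∈ ray D k, x ≠ 0 →
        IsPlusValue D k A x (Ap x) ∧ IsMinusValue D k A x (Am x)) ∧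
      ∀ x ∈ contour D \ {0}, Ap x = Am x * jump V D x := by
  have : RegularSpace (Matrix (Fin (D + 1)) (Fin (D + 1)) ℂ) :=
    inferInstanceAs (RegularSpace (Fin (D + 1) → Fin (D + 1) → ℂ))
  have hlim : ∀ k < D, ∀ x ∈ ray D k, x ≠ 0 → ∃ M : Matrix (Fin (D + 1)) (Fin (D + 1)) ℂ,
      IsPlusValue D k A x (M * jump V D x) ∧ IsMinusValue D k A x M := by
    intro k hk x hx hx0
    choose b hleft hright using fun i => (hA i).boundary k hk x hx hx0
    exact ⟨b, tendsto_pi_nhds.2 hleft, tendsto_pi_nhds.2 hright⟩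
  obtain ⟨Ap, hAp_cont, hAp⟩ := exists_continuousOn_boundary_values (A := A) hD
    (fun k => leftSide D k \ contour D) (fun k hk x => neBot_nhdsWithin_leftSide hD hk)
    fun k hk x hx hx0 => (hlim k hk x hx hx0).imp' _ fun M hM => hM.1
  obtain ⟨Am, hAm_cont, hAm⟩ := exists_continuousOn_boundary_values (A := A) hD
    (fun k => rightSide D k \ contour D) (fun k hk x => neBot_nhdsWithin_rightSide hD hk)
    fun k hk x hx hx0 => (hlim k hk x hx hx0).imp fun M hM => hM.2
  refine ⟨Ap, Am, hAp_cont, hAm_cont,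
    fun k hk x hx hx0 => ⟨hAp k hk x hx hx0, hAm k hk x hx hx0⟩, ?_⟩
  rintro x ⟨hxc, hx0⟩
  obtain ⟨k, hk, hx⟩ := (mem_contour_iff hD).1 hxc
  obtain ⟨M, hplus, hminus⟩ := hlim k hk x hx hx0
  have := neBot_nhdsWithin_leftSide hD hk hx hx0
  have := neBot_nhdsWithin_rightSide hD hk hx hx0
  rw [tendsto_nhds_unique (hAp k hk x hx hx0) hplus,
    tendsto_nhds_unique (hAm k hk x hx hx0) hminus]

theorem isEvenSolution_of_rows {V : ℝ[X]} {D n : ℕ} (hD : 2 ≤ D)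
    {A : ℂ → Matrix (Fin (D + 1)) (Fin (D + 1)) ℂ}
    (hA : ∀ i, IsRowSolution V D fun z => A z i)
    (hn : ∃ E : ℂ → Matrix (Fin (D + 1)) (Fin (D + 1)) ℂ,
      (∀ i j, (fun z => E z i j)
        =O[Bornology.cobounded ℂ ⊓ 𝓟 (contour D)ᶜ] (fun z : ℂ => z⁻¹)) ∧
      ∀ᶠ z in Bornology.cobounded ℂ ⊓ 𝓟 (contour D)ᶜ, A z = (1 + E z) * growth D n z) :
    IsEvenSolution V D n A where
  analytic i j := (hA i).analytic j
  boundary := exists_boundary_of_rows hD hA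
  bounded_near_zero := by
    obtain ⟨ρ, hρ, C, hC⟩ := exists_forall_norm_le_near_zero (ι := Fin (D + 1) × Fin (D + 1))
      (f := fun i z => A z i.1 i.2) (S := contour D) fun i =>
        (hA i.1).bounded_near_zero.imp fun ρ h => h.imp_right fun h =>
          h.imp fun C hC z hz hzρ => hC z hz hzρ i.2
    exact ⟨ρ, hρ, C, fun z hz hzρ i j => hC z hz hzρ (i, j)⟩
  normalised := hn

/-! ### Products of row solutions with the adjugate -/

theorem differentiableOn_det {𝕜 ι : Type*} [NontriviallyNormedField 𝕜] [Fintype ι]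
    [DecidableEq ι] {A : 𝕜 → Matrix ι ι 𝕜} {S : Set 𝕜}
    (h : ∀ i j, DifferentiableOn 𝕜 (fun z => A z i j) S) :
    DifferentiableOn 𝕜 (fun z => (A z).det) S := by
  simp only [Matrix.det_apply']
  exact DifferentiableOn.fun_sum fun σ _ =>
    (DifferentiableOn.fun_finsetProd fun i _ => h (σ i) i).const_mul _

theorem differentiableOn_adjugate {𝕜 ι : Type*} [NontriviallyNormedField 𝕜] [Fintype ι]
    [DecidableEq ι] {A : 𝕜 → Matrix ι ι 𝕜} {S : Set 𝕜}
    (h : ∀ i j, DifferentiableOn 𝕜 (fun z => A z i j) S) (i j : ι) :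
    DifferentiableOn 𝕜 (fun z => (A z).adjugate i j) S := by
  simp only [Matrix.adjugate_apply]
  refine differentiableOn_det fun a b => ?_
  rcases eq_or_ne a j with rfl | ha
  · simp only [Matrix.updateRow_self]
    exact differentiableOn_const _
  · simp only [Matrix.updateRow_ne ha]
    exact h a b

theorem exists_norm_le_of_continuous {ι 𝕜 E : Type*} [NormedRing 𝕜] [ProperSpace 𝕜]
    [SeminormedAddCommGroup E] {F : (ι → 𝕜) × Matrix ι ι 𝕜 → E}
    (hF : Continuous F) (C : ℝ) : ∃ B, ∀ (r : ι → 𝕜) (M : Matrix ι ι 𝕜),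
      (∀ j, ‖r j‖ ≤ C) → (∀ i j, ‖M i j‖ ≤ C) → ‖F (r, M)‖ ≤ B := by
  have rows_compact : IsCompact (Set.univ.pi fun _ : ι => Metric.closedBall (0 : 𝕜) C) :=
    isCompact_univ_pi fun _ => isCompact_closedBall 0 C
  have matrices_compact : IsCompact (X := Matrix ι ι 𝕜)
      (Set.univ.pi fun _ : ι => Set.univ.pi fun _ : ι => Metric.closedBall (0 : 𝕜) C) :=
    isCompact_univ_pi fun _ => rows_compact
  obtain ⟨B, hB⟩ :=
    (rows_compact.prod matrices_compact).exists_bound_of_continuousOn hF.continuousOn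
  exact ⟨B, fun r M hr hM => hB (r, M) ⟨fun j _ => mem_closedBall_zero_iff.2 (hr j),
    fun i _ j _ => mem_closedBall_zero_iff.2 (hM i j)⟩⟩

theorem vecMul_mul_adjugate_mul {R ι : Type*} [CommRing R] [Fintype ι] [DecidableEq ι]
    (b : ι → R) (M J : Matrix ι ι R) (hJ : J.det = 1) :
    Matrix.vecMul (Matrix.vecMul b J) (M * J).adjugate = Matrix.vecMul b M.adjugate := by
  rw [Matrix.adjugate_mul_distrib, Matrix.vecMul_vecMul, ← Matrix.mul_assoc, Matrix.mul_adjugate,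
    hJ, one_smul, Matrix.one_mul]

theorem continuous_vecMul_adjugate {R ι : Type*} [CommRing R] [TopologicalSpace R]
    [IsTopologicalRing R] [Fintype ι] [DecidableEq ι] (i : ι) :
    Continuous fun p : (ι → R) × Matrix ι ι R => Matrix.vecMul p.1 p.2.adjugate i :=
  (continuous_apply i).comp (continuous_fst.matrix_vecMul continuous_snd.matrix_adjugate)

theorem IsRowSolution.exists_entire {V : ℝ[X]} {D n : ℕ} {r : ℂ → Fin (D + 1) → ℂ}
    (hr : IsRowSolution V D r) {A : ℂ → Matrix (Fin (D + 1)) (Fin (D + 1)) ℂ}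
    (hA : IsEvenSolution V D n A) (hD : 2 ≤ D) (hDe : Even D) (i : Fin (D + 1)) :
    ∃ g : ℂ → ℂ, Differentiable ℂ g ∧
      ∀ z, z ∉ contour D → Matrix.vecMul (r z) (A z).adjugate i = g z := by
  have hF := continuous_vecMul_adjugate (R := ℂ) i
  refine exists_entire_of_no_jump hD (f := fun z => Matrix.vecMul (r z) (A z).adjugate i) ?_ ?_ ?_
  · simp only [Matrix.vecMul, dotProduct]
    exact DifferentiableOn.fun_sum fun k _ =>
      (hr.analytic k).mul (differentiableOn_adjugate hA.analytic k i)
  · intro k hk x hx hx0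
    obtain ⟨b, hr_left, hr_right⟩ := hr.boundary k hk x hx hx0
    obtain ⟨Ap, Am, -, -, hlim, hjump⟩ := hA.boundary
    obtain ⟨hA_left, hA_right⟩ := hlim k hk x hx hx0
    have hjump_x := hjump x ⟨(mem_contour_iff hD).2 ⟨k, hk, hx⟩, hx0⟩
    have hleft := (hF.tendsto _).comp (hr_left.prodMk_nhds hA_left)
    simp only [hjump_x, vecMul_mul_adjugate_mul _ _ _ (det_jump hD hDe x)] at hleft
    exact ⟨_, hleft, (hF.tendsto _).comp (hr_right.prodMk_nhds hA_right)⟩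
  · obtain ⟨ρ, hρ, C, hC⟩ := hr.bounded_near_zero
    obtain ⟨ρ', hρ', C', hC'⟩ := hA.bounded_near_zero
    obtain ⟨B, hB⟩ := exists_norm_le_of_continuous hF (max C C')
    refine ⟨min ρ ρ', lt_min hρ hρ', B, fun z hz hzρ => hB (r z) (A z) (fun j => ?_) fun a b => ?_⟩
    · exact (hC z hz (hzρ.trans_le (min_le_left _ _)) j).trans (le_max_left _ _)
    · exact (hC' z hz (hzρ.trans_le (min_le_right _ _)) a b).trans (le_max_right _ _)

/-! ### Behaviour at infinity -/

/-- The exponents of the growth matrix `diag (z^{2n+D-1}, z^{-2n}, z^{-1}, …, z^{-1})`. -/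
def growthExp (D n : ℕ) (i : Fin (D + 1)) : ℤ :=
  if i = 0 then 2 * (n : ℤ) + D - 1 else if i = 1 then -2 * (n : ℤ) else -1

theorem growth_eq (D n : ℕ) (z : ℂ) :
    growth D n z = Matrix.diagonal fun i => z ^ growthExp D n i := by
  rw [growth]
  congr 1
  ext i
  unfold growthExp
  split_ifs <;> rfl

theorem sum_growthExp {D : ℕ} (hD : 2 ≤ D) (n : ℕ) : ∑ i, growthExp D n i = 0 := by
  obtain ⟨d, rfl⟩ := Nat.exists_eq_add_of_le' (by omega : 1 ≤ D)
  have succ_succ_ne_one (i : Fin d) : i.succ.succ ≠ (1 : Fin (d + 1 + 1)) := fun h => by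
    simpa using congrArg Fin.val h
  rw [Fin.sum_univ_succ, Fin.sum_univ_succ]
  simp only [growthExp, Fin.succ_ne_zero, if_false, if_true, succ_succ_ne_one,
    Fin.succ_zero_eq_one, one_ne_zero, Finset.sum_const, Finset.card_univ, Fintype.card_fin,
    nsmul_eq_mul]
  push_cast
  ring

theorem prod_zpow_eq_zpow_sum {G₀ ι : Type*} [CommGroupWithZero G₀] {a : G₀} (ha : a ≠ 0)
    (s : Finset ι) (f : ι → ℤ) : ∏ i ∈ s, a ^ f i = a ^ ∑ i ∈ s, f i := by
  induction s using Finset.cons_induction with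
  | empty => simp
  | cons i s hi ih => rw [Finset.prod_cons, Finset.sum_cons, zpow_add₀ ha, ih]

theorem det_growth {D n : ℕ} (hD : 2 ≤ D) {z : ℂ} (hz : z ≠ 0) : (growth D n z).det = 1 := by
  rw [growth_eq, Matrix.det_diagonal, prod_zpow_eq_zpow_sum hz, sum_growthExp hD, zpow_zero]

theorem adjugate_growth {D n : ℕ} (hD : 2 ≤ D) {z : ℂ} (hz : z ≠ 0) :
    (growth D n z).adjugate = Matrix.diagonal fun i => z ^ (-growthExp D n i) := by
  have growth_mul : growth D n z * (Matrix.diagonal fun i => z ^ (-growthExp D n i)) = 1 := by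
    simp only [growth_eq, Matrix.diagonal_mul_diagonal, ← zpow_add₀ hz, add_neg_cancel, zpow_zero,
      Matrix.diagonal_one]
  rw [← Matrix.inv_eq_right_inv growth_mul, Matrix.inv_def, det_growth hD hz, Ring.inverse_one,
    one_smul]

section infinity

variable {V : ℝ[X]} {D n : ℕ} {A : ℂ → Matrix (Fin (D + 1)) (Fin (D + 1)) ℂ}

theorem tendsto_one_add_of_isBigO_inv {ι 𝕜 : Type*} [DecidableEq ι] [NormedField 𝕜]
    {l : Filter 𝕜} (hl : l ≤ Bornology.cobounded 𝕜) {E : 𝕜 → Matrix ι ι 𝕜}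
    (hE : ∀ i j, (fun z => E z i j) =O[l] (fun z : 𝕜 => z⁻¹)) :
    Tendsto (fun z => 1 + E z) l (𝓝 1) := by
  have tendsto_zero : Tendsto E l (𝓝 0) := tendsto_pi_nhds.2 fun i => tendsto_pi_nhds.2 fun j =>
    (hE i j).trans_tendsto (tendsto_inv₀_cobounded.mono_left hl)
  simpa only [add_zero] using tendsto_const_nhds.add tendsto_zero

theorem IsEvenSolution.exists_adjugate_eq (hA : IsEvenSolution V D n A) :
    ∃ F G : ℂ → Matrix (Fin (D + 1)) (Fin (D + 1)) ℂ,
      Tendsto F (Bornology.cobounded ℂ ⊓ 𝓟 (contour D)ᶜ) (𝓝 1) ∧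
      Tendsto G (Bornology.cobounded ℂ ⊓ 𝓟 (contour D)ᶜ) (𝓝 1) ∧
      ∀ᶠ z in Bornology.cobounded ℂ ⊓ 𝓟 (contour D)ᶜ, z ≠ 0 ∧ A z = F z * growth D n z ∧
        (A z).adjugate = (growth D n z).adjugate * G z := by
  obtain ⟨E, hE, hAE⟩ := hA.normalised
  have tendsto_one := tendsto_one_add_of_isBigO_inv inf_le_left hE
  refine ⟨fun z => 1 + E z, fun z => (1 + E z).adjugate, tendsto_one, ?_, ?_⟩
  · have adjugate_cont : Continuous fun M : Matrix (Fin (D + 1)) (Fin (D + 1)) ℂ => M.adjugate :=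
      continuous_id.matrix_adjugate
    have := (adjugate_cont.tendsto 1).comp tendsto_one
    rwa [Matrix.adjugate_one] at this
  · filter_upwards [hAE, (Bornology.eventually_ne_cobounded (0 : ℂ)).filter_mono inf_le_left]
      with z hz hz0
    exact ⟨hz0, hz, by rw [hz, Matrix.adjugate_mul_distrib]⟩

theorem IsEvenSolution.mul_adjugate_eq_one {B : ℂ → Matrix (Fin (D + 1)) (Fin (D + 1)) ℂ}
    (hB : IsEvenSolution V D n B) (hA : IsEvenSolution V D n A) (hD : 2 ≤ D) (hDe : Even D)
    {z : ℂ} (hz : z ∉ contour D) : B z * (A z).adjugate = 1 := by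
  obtain ⟨F, _, hF, _, hBF⟩ := hB.exists_adjugate_eq
  obtain ⟨_, G, _, hG, hAG⟩ := hA.exists_adjugate_eq
  have hlim : Tendsto (fun z => B z * (A z).adjugate)
      (Bornology.cobounded ℂ ⊓ 𝓟 (contour D)ᶜ) (𝓝 1) := by
    have hFG := hF.mul hG
    rw [Matrix.one_mul] at hFG
    refine hFG.congr' ?_
    filter_upwards [hBF, hAG] with w hwB hwA
    rw [hwB.2.1, hwA.2.2, Matrix.mul_assoc, ← Matrix.mul_assoc (growth D n w), Matrix.mul_adjugate,
      det_growth hD hwB.1, one_smul, Matrix.one_mul]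
  ext i j
  obtain ⟨g, hg, hgB⟩ := (hB.isRowSolution hD i).exists_entire hA hD hDe j
  replace hgB : ∀ w, w ∉ contour D → (B w * (A w).adjugate) i j = g w := hgB
  rw [hgB z hz]
  refine eq_const_of_tendsto_cobounded_inf hg (dense_compl_contour hD) ?_ z
  refine (tendsto_pi_nhds.1 (tendsto_pi_nhds.1 hlim i) j).congr' ?_
  rw [EventuallyEq, eventually_inf_principal]
  exact Eventually.of_forall hgB

theorem IsEvenSolution.det_eq_one (hA : IsEvenSolution V D n A) (hD : 2 ≤ D) (hDe : Even D)
    {z : ℂ} (hz : z ∉ contour D) : (A z).det = 1 := by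
  have h := hA.mul_adjugate_eq_one hA hD hDe hz
  rw [Matrix.mul_adjugate] at h
  simpa using congrFun (congrFun h 0) 0

theorem IsEvenSolution.inv_eq_adjugate (hA : IsEvenSolution V D n A) (hD : 2 ≤ D) (hDe : Even D)
    {z : ℂ} (hz : z ∉ contour D) : (A z)⁻¹ = (A z).adjugate := by
  rw [Matrix.inv_def, hA.det_eq_one hD hDe hz, Ring.inverse_one, one_smul]

theorem IsEvenSolution.unique {B : ℂ → Matrix (Fin (D + 1)) (Fin (D + 1)) ℂ}
    (hA : IsEvenSolution V D n A) (hB : IsEvenSolution V D n B) (hD : 2 ≤ D) (hDe : Even D)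
    {z : ℂ} (hz : z ∉ contour D) : A z = B z :=
  calc A z = A z * ((B z).adjugate * B z) := by
        rw [Matrix.adjugate_mul, hB.det_eq_one hD hDe hz, one_smul, Matrix.mul_one]
    _ = B z := by
        rw [← Matrix.mul_assoc, hA.mul_adjugate_eq_one hB hD hDe hz, Matrix.one_mul]

end infinity

/-! ### Existence of the solution -/

section existence

variable {V : ℝ[X]} {D : ℕ}

theorem isBigO_inv_of_degree_lt {q : ℂ[X]} {M : ℕ} (hM : 1 ≤ M) (hq : q.degree < (M : ℕ)) :
    (fun z => q.eval z * (z ^ M)⁻¹) =O[Bornology.cobounded ℂ] fun z => z⁻¹ := by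
  obtain ⟨N, rfl⟩ := Nat.exists_eq_add_of_le' hM
  have hN : q.natDegree ≤ N := natDegree_le_of_degree_le (Order.lt_succ_iff.1 hq)
  obtain ⟨B, hB, hbound⟩ := exists_norm_eval_le q hN
  refine Asymptotics.IsBigO.of_bound (B * 2 ^ N) ?_
  filter_upwards [tendsto_norm_cobounded_atTop.eventually_ge_atTop 1] with z hz
  have : 0 < ‖z‖ := by linarith
  have one_add_le : 1 + ‖z‖ ≤ 2 * ‖z‖ := by linarith
  rw [norm_mul, norm_inv, norm_inv, norm_pow]
  calc ‖q.eval z‖ * (‖z‖ ^ (N + 1))⁻¹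
      ≤ B * (2 * ‖z‖) ^ N * (‖z‖ ^ (N + 1))⁻¹ := by
        gcongr
        exact (hbound z).trans (by gcongr)
    _ = B * 2 ^ N * ‖z‖⁻¹ := by
        rw [mul_pow, pow_succ]
        field_simp

/- Dividing the Cauchy kernel by powers of `z` peels off one moment at a time, so the first moment
that does not vanish is the leading coefficient at infinity. -/
theorem arcCauchy_mul_pow_sub_isBigO_inv {U : ℂ[X]} (hU : IsPotential D U) (hD : 2 ≤ D) {j : ℕ}
    (hj : j < D) {p : ℂ[X]} {M : ℕ} {c : ℂ} (hc : M = 0 → c = 0)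
    (h : ∀ m < M, arcMoment hU hD j (X ^ m * p)
      = if m + 1 = M then -(2 * Real.pi * Complex.I * c) else 0) :
    (fun z => arcCauchy D j (weighted U p) z * z ^ M - c)
      =O[Bornology.cobounded ℂ ⊓ 𝓟 (contour D)ᶜ] fun z => z⁻¹ := by
  refine (arcCauchy_isBigO_inv hU hD hj (X ^ M * p)).congr' ?_ EventuallyEq.rfl
  rw [EventuallyEq, eventually_inf_principal]
  refine Eventually.of_forall fun z hz => ?_
  have hz0 : z ≠ 0 := ne_zero_of_notMem_contour hD hz
  rcases M with _ | N
  · simp [hc rfl]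
  · have low_moments : ∀ m < N, arcMoment hU hD j (X ^ m * p) = 0 := fun m hm => by
      rw [h m (by omega), if_neg (by omega)]
    rw [arcCauchy_eq_pow hU hD hj p hz N low_moments, pow_succ' X, mul_assoc X,
      arcCauchy_eq hU hD hj (X ^ N * p) hz, h N N.lt_succ_self, if_pos rfl, pow_succ', inv_pow]
    have := Complex.two_pi_I_ne_zero
    field_simp
    ring

theorem cauchyRow_one (V : ℝ[X]) (hD : 2 ≤ D) (p : ℂ[X]) (z : ℂ) :
    cauchyRow V D p z 1 = arcCauchy D (D / 2) (weighted (C 2 * toC V) p) z := by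
  simp only [cauchyRow, if_neg (fin_one_ne_zero hD), colArc, colPot, if_true]

theorem cauchyRow_of_ne_one (V : ℝ[X]) (p : ℂ[X]) (z : ℂ) {j : Fin (D + 1)} (hj0 : j ≠ 0)
    (hj1 : j ≠ 1) : cauchyRow V D p z j = arcCauchy D (j - 1) (weighted (toC V) p) z := by
  simp only [cauchyRow, if_neg hj0, colArc, colPot, if_neg hj1]

theorem growthExp_zero (n : ℕ) (hD : 1 ≤ D) :
    growthExp D n 0 = ((2 * n + (D - 1) : ℕ) : ℤ) := by
  simp only [growthExp, if_true]
  push_cast [Nat.cast_sub hD]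
  ring

theorem growthExp_one (hD : 2 ≤ D) (n : ℕ) : growthExp D n 1 = -((2 * n : ℕ) : ℤ) := by
  simp only [growthExp, if_neg (fin_one_ne_zero hD), if_true]
  push_cast
  ring

theorem growthExp_of_ne_one (n : ℕ) {j : Fin (D + 1)} (hj0 : j ≠ 0) (hj1 : j ≠ 1) :
    growthExp D n j = -((1 : ℕ) : ℤ) := by
  simp only [growthExp, if_neg hj0, if_neg hj1, Nat.cast_one]

theorem exists_polynomial_of_row (hU : IsPotential D (toC V)) (hD : 2 ≤ D) (hDe : Even D) (n : ℕ)
    (e : Fin (D + 1) → ℂ) : ∃ p : ℂ[X],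
      (p - C (e 0) * X ^ (2 * n + (D - 1))).degree < ((2 * n + (D - 1) : ℕ) : WithBot ℕ) ∧
      (∀ m < 2 * n, arcMoment hU.two_mul hD (D / 2) (X ^ m * p)
        = if m + 1 = 2 * n then -(2 * Real.pi * Complex.I * e 1) else 0) ∧
      ∀ j : Fin (D + 1), j ≠ 0 → j ≠ 1 →
        arcMoment hU hD (j - 1) p = -(2 * Real.pi * Complex.I * e j) := by
  set leading : ℂ[X] := C (e 0) * X ^ (2 * n + (D - 1))
  obtain ⟨q, hq, hline, harc⟩ := exists_moments hU hD hDe n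
    (fun m => (if m + 1 = 2 * n then -(2 * Real.pi * Complex.I * e 1) else 0)
      - arcMoment hU.two_mul hD (D / 2) (X ^ m * leading))
    (fun k => -(2 * Real.pi * Complex.I * e (Fin.ofNat (D + 1) (k + 1)))
      - arcMoment hU hD k leading)
  refine ⟨q + leading, by rwa [add_sub_cancel_right], fun m hm => ?_, fun j hj0 hj1 => ?_⟩
  · rw [mul_add, map_add, hline m hm, sub_add_cancel]
  · have hj0' : (j : ℕ) ≠ 0 := fun h => hj0 (Fin.ext h)
    have hj1' : (j : ℕ) ≠ 1 := fun h => hj1 ((fin_eq_one_iff hD j).2 h)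
    rw [map_add, harc _ (by omega) (by omega), sub_add_cancel,
      Nat.sub_add_cancel (by omega : 1 ≤ (j : ℕ)), Fin.ofNat_val_eq_self]

theorem exists_cauchyRow_isBigO_inv (hU : IsPotential D (toC V)) (hD : 2 ≤ D) (hDe : Even D)
    {n : ℕ} {e : Fin (D + 1) → ℂ} (he : n = 0 → e 1 = 0) :
    ∃ p : ℂ[X], ∀ j, (fun z => cauchyRow V D p z j * z ^ (-growthExp D n j) - e j)
      =O[Bornology.cobounded ℂ ⊓ 𝓟 (contour D)ᶜ] fun z => z⁻¹ := by
  obtain ⟨p, hdeg, hline, harc⟩ := exists_polynomial_of_row hU hD hDe n e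
  refine ⟨p, fun j => ?_⟩
  rcases eq_or_ne j 0 with rfl | hj0
  · refine ((isBigO_inv_of_degree_lt (by omega) hdeg).mono inf_le_left).congr' ?_ EventuallyEq.rfl
    filter_upwards [(Bornology.eventually_ne_cobounded (0 : ℂ)).filter_mono inf_le_left] with z hz
    rw [growthExp_zero n (by omega), zpow_neg, zpow_natCast, cauchyRow, if_pos rfl, eval_sub,
      eval_mul, eval_C, eval_pow, eval_X, sub_mul, mul_assoc (e 0),
      mul_inv_cancel₀ (pow_ne_zero _ hz), mul_one]
  rcases eq_or_ne j 1 with rfl | hj1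
  · simp only [growthExp_one hD n, neg_neg, zpow_natCast, cauchyRow_one V hD]
    exact arcCauchy_mul_pow_sub_isBigO_inv hU.two_mul hD (by omega) (fun h => he (by omega)) hline
  · simp only [growthExp_of_ne_one n hj0 hj1, neg_neg, zpow_natCast,
      cauchyRow_of_ne_one V p _ hj0 hj1]
    refine arcCauchy_mul_pow_sub_isBigO_inv hU hD (by omega) (fun h => absurd h one_ne_zero)
      fun m hm => ?_
    obtain rfl : m = 0 := by omega
    rw [pow_zero, one_mul, zero_add, if_pos rfl, harc j hj0 hj1]

theorem exists_isRowSolution_isBigO_inv (hU : IsPotential D (toC V)) (hD : 2 ≤ D) (hDe : Even D)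
    (n : ℕ) (i : Fin (D + 1)) : ∃ r, IsRowSolution V D r ∧
      ∀ j, (fun z => r z j * z ^ (-growthExp D n j)
          - (1 : Matrix (Fin (D + 1)) (Fin (D + 1)) ℂ) i j)
        =O[Bornology.cobounded ℂ ⊓ 𝓟 (contour D)ᶜ] fun z => z⁻¹ := by
  by_cases hi : n = 0 ∧ i = 1
  · obtain ⟨rfl, rfl⟩ := hi
    have hne := fin_one_ne_zero hD
    refine ⟨_, isRowSolution_single hD hDe hne, fun j => ?_⟩
    have entry_eq_zero : ∀ z : ℂ, (Pi.single 1 1 : Fin (D + 1) → ℂ) j * z ^ (-growthExp D 0 j)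
        - (1 : Matrix (Fin (D + 1)) (Fin (D + 1)) ℂ) 1 j = 0 := fun z => by
      rcases eq_or_ne j 1 with rfl | hj
      · simp [growthExp, hne]
      · rw [Pi.single_eq_of_ne hj, Matrix.one_apply_ne hj.symm, zero_mul, sub_zero]
    simp only [entry_eq_zero]
    exact Asymptotics.isBigO_zero _ _
  · obtain ⟨p, hp⟩ := exists_cauchyRow_isBigO_inv hU hD hDe
      (e := (1 : Matrix (Fin (D + 1)) (Fin (D + 1)) ℂ) i)
      fun hn => Matrix.one_apply_ne fun h => hi ⟨hn, h⟩
    exact ⟨_, isRowSolution_cauchyRow hU hD hDe p, hp⟩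

theorem exists_isEvenSolution (hU : IsPotential D (toC V)) (hD : 2 ≤ D) (hDe : Even D) (n : ℕ) :
    ∃ A, IsEvenSolution V D n A := by
  choose r hr hrinf using exists_isRowSolution_isBigO_inv hU hD hDe n
  refine ⟨fun z i => r i z, isEvenSolution_of_rows hD hr
    ⟨fun z => Matrix.of fun i j => r i z j * z ^ (-growthExp D n j)
      - (1 : Matrix (Fin (D + 1)) (Fin (D + 1)) ℂ) i j, hrinf, ?_⟩⟩
  filter_upwards [(Bornology.eventually_ne_cobounded (0 : ℂ)).filter_mono inf_le_left] with z hz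
  ext i j
  rw [growth_eq, Matrix.mul_diagonal, Matrix.add_apply, Matrix.of_apply, add_sub_cancel, mul_assoc,
    ← zpow_add₀ hz, neg_add_cancel, zpow_zero, mul_one]

end existence

/-! ### The Christoffel-Darboux formula -/

section linear

variable {D j : ℕ} {U : ℂ[X]}

theorem rayCauchy_add (hU : IsPotential D U) (hD : 2 ≤ D) (k : ℕ) (p q : ℂ[X]) {z : ℂ}
    (hz : z ∉ ray D k) :
    rayCauchy D k (weighted U (p + q)) z
      = rayCauchy D k (weighted U p) z + rayCauchy D k (weighted U q) z := by
  have hz' : z / dir D k ∉ halfAxis := mt div_dir_mem_halfAxis_iff.1 hz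
  have integrable : ∀ p, IntegrableOn (fun t : ℝ => weighted U p (t * dir D k) / (t - z / dir D k))
      (Set.Ioi 0) := fun p =>
    integrableOn_halfCauchy (f := fun u => weighted U p (u * dir D k)) (hU.stripDecay hD k p)
      ((continuous_weighted U p).comp (continuous_id.mul continuous_const)) hz'
  rw [rayCauchy, rayCauchy, rayCauchy, halfCauchy, halfCauchy, halfCauchy,
    ← integral_add (integrable p) (integrable q)]
  congr 1
  ext t
  simp only [weighted, eval_add]
  ring

theorem rayCauchy_smul (k : ℕ) (c : ℂ) (p : ℂ[X]) (z : ℂ) :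
    rayCauchy D k (weighted U (c • p)) z = c * rayCauchy D k (weighted U p) z := by
  rw [rayCauchy, rayCauchy, halfCauchy, halfCauchy, ← integral_const_mul]
  congr 1
  ext t
  simp only [weighted, eval_smul, smul_eq_mul]
  ring

/-- The Cauchy transform over an arc, at a fixed point, as a linear functional on polynomials. -/
def arcCauchyLinear (hU : IsPotential D U) (hD : 2 ≤ D) (hj : j < D) {z : ℂ}
    (hz : z ∉ contour D) : ℂ[X] →ₗ[ℂ] ℂ where
  toFun p := arcCauchy D j (weighted U p) z
  map_add' p q := by
    rw [arcCauchy, arcCauchy, arcCauchy,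
      rayCauchy_add hU hD 0 p q (notMem_ray_of_notMem_contour hD (by omega) hz),
      rayCauchy_add hU hD j p q (notMem_ray_of_notMem_contour hD hj hz)]
    ring
  map_smul' c p := by
    rw [arcCauchy, arcCauchy, rayCauchy_smul, rayCauchy_smul, RingHom.id_apply, smul_eq_mul]
    ring

theorem arcCauchyLinear_apply (hU : IsPotential D U) (hD : 2 ≤ D) (hj : j < D) {z : ℂ}
    (hz : z ∉ contour D) (p : ℂ[X]) :
    arcCauchyLinear hU hD hj hz p = arcCauchy D j (weighted U p) z := rfl

theorem arcCauchyLinear_X_mul (hU : IsPotential D U) (hD : 2 ≤ D) (hj : j < D) {z : ℂ}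
    (hz : z ∉ contour D) (p : ℂ[X]) :
    arcCauchyLinear hU hD hj hz (X * p)
      = z * arcCauchyLinear hU hD hj hz p + (2 * Real.pi * Complex.I)⁻¹ * arcMoment hU hD j p := by
  have h := arcCauchy_eq hU hD hj p hz
  rw [eq_inv_mul_iff_mul_eq₀ (ne_zero_of_notMem_contour hD hz)] at h
  rw [arcCauchyLinear_apply, arcCauchyLinear_apply, h, sub_add_cancel]

theorem arcCauchyLinear_X_sub_C_mul (hU : IsPotential D U) (hD : 2 ≤ D) (hj : j < D) {z : ℂ}
    (hz : z ∉ contour D) (p : ℂ[X]) :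
    arcCauchyLinear hU hD hj hz ((X - C z) * p)
      = (2 * Real.pi * Complex.I)⁻¹ * arcMoment hU hD j p := by
  rw [sub_mul, ← smul_eq_C_mul, map_sub, map_smul, smul_eq_mul, arcCauchyLinear_X_mul,
    add_sub_cancel_left]

theorem exists_polynomial_arcCauchyLinear_mul (hU : IsPotential D U) (hD : 2 ≤ D) (hj : j < D)
    (p b : ℂ[X]) : ∃ S : ℂ[X], ∀ z (hz : z ∉ contour D),
      b.eval z * arcCauchyLinear hU hD hj hz p - arcCauchyLinear hU hD hj hz (b * p)
        = S.eval z := by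
  induction b using Polynomial.induction_on with
  | C a =>
    refine ⟨0, fun z hz => ?_⟩
    rw [← smul_eq_C_mul, map_smul, eval_C, smul_eq_mul, sub_self, eval_zero]
  | add b b' h h' =>
    obtain ⟨S, hS⟩ := h
    obtain ⟨S', hS'⟩ := h'
    refine ⟨S + S', fun z hz => ?_⟩
    rw [eval_add, eval_add, add_mul, add_mul, map_add, ← hS z hz, ← hS' z hz]
    ring
  | monomial m a h =>
    obtain ⟨S, hS⟩ := h
    refine ⟨X * S - C ((2 * Real.pi * Complex.I)⁻¹ * arcMoment hU hD j (C a * X ^ m * p)),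
      fun z hz => ?_⟩
    have peel_X : C a * X ^ (m + 1) * p = X * (C a * X ^ m * p) := by ring
    rw [peel_X, arcCauchyLinear_X_mul, eval_sub (p := X * S), eval_mul (p := X), ← hS z hz]
    simp only [eval_mul, eval_C, eval_pow, eval_X]
    ring

end linear

section formula

variable {V : ℝ[X]} {D n : ℕ} {A : ℂ → Matrix (Fin (D + 1)) (Fin (D + 1)) ℂ}

theorem IsEvenSolution.exists_adjugate_row (hA : IsEvenSolution V D n A) (hD : 2 ≤ D)
    (hDe : Even D) (k : Fin (D + 1)) : ∃ b : ℂ[X], b.natDegree ≤ 2 * n ∧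
      ∀ z, z ∉ contour D → (A z).adjugate 1 k = b.eval z := by
  obtain ⟨g, hg, hgA⟩ :=
    (isRowSolution_single (V := V) hD hDe (fin_one_ne_zero hD)).exists_entire hA hD hDe k
  simp only [Matrix.single_one_vecMul, Matrix.row_apply] at hgA
  obtain ⟨_, G, _, hG, hAG⟩ := hA.exists_adjugate_eq
  have entry_tendsto : Tendsto (fun z => G z 1 k) (Bornology.cobounded ℂ ⊓ 𝓟 (contour D)ᶜ)
      (𝓝 ((1 : Matrix (Fin (D + 1)) (Fin (D + 1)) ℂ) 1 k)) :=
    tendsto_pi_nhds.1 (tendsto_pi_nhds.1 hG 1) k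
  have hO : g =O[Bornology.cobounded ℂ ⊓ 𝓟 (contour D)ᶜ] fun z => z ^ (2 * n) := by
    have hmul := (Asymptotics.isBigO_refl (fun z : ℂ => z ^ (2 * n)) _).mul
      (entry_tendsto.isBigO_one ℂ)
    simp only [mul_one] at hmul
    refine hmul.congr' ?_ EventuallyEq.rfl
    filter_upwards [hAG, mem_inf_of_right (mem_principal_self _)] with z ⟨hz0, _, hzG⟩ hz
    rw [← hgA z hz, hzG, adjugate_growth hD hz0, Matrix.diagonal_mul, growthExp_one hD, neg_neg,
      zpow_natCast]
  obtain ⟨b, hb, hgb⟩ :=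
    exists_polynomial_of_isBigO_cobounded_inf (dense_compl_contour hD) hg hO
  exact ⟨b, hb, fun z hz => by rw [hgA z hz, hgb]⟩

theorem tendsto_cauchyRow_twist_mul_zpow (hU : IsPotential D (toC V)) (hD : 2 ≤ D) {q : ℂ[X]}
    (hq : q.degree < (2 * n : ℕ)) {i : Fin (D + 1)} (hi : i ≠ 1) :
    Tendsto (fun z => cauchyRow V D (twist (toC V) q) z i * z ^ (-growthExp D n i))
      (Bornology.cobounded ℂ ⊓ 𝓟 (contour D)ᶜ) (𝓝 0) := by
  have inv_tendsto : Tendsto (fun z : ℂ => z⁻¹) (Bornology.cobounded ℂ ⊓ 𝓟 (contour D)ᶜ) (𝓝 0) :=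
    tendsto_inv₀_cobounded.mono_left inf_le_left
  refine Asymptotics.IsBigO.trans_tendsto ?_ inv_tendsto
  rcases eq_or_ne i 0 with rfl | hi0
  · have hdeg : (twist (toC V) q).degree < (2 * n + (D - 1) : ℕ) := by
      have := (degree_twist_lt_iff (by rw [hU.natDegree_eq]; omega)).2 hq
      rwa [hU.natDegree_eq] at this
    simp only [growthExp_zero n (by omega : 1 ≤ D), zpow_neg, zpow_natCast, cauchyRow, if_true]
    exact (isBigO_inv_of_degree_lt (by omega) hdeg).mono inf_le_left
  · have hO := arcCauchy_mul_pow_sub_isBigO_inv hU hD (j := i - 1) (by omega)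
      (p := twist (toC V) q) (M := 1) (c := 0) (fun _ => rfl) fun m hm => by
        obtain rfl : m = 0 := by omega
        rw [pow_zero, one_mul, arcMoment_twist, mul_zero, neg_zero, ite_self]
    simpa only [growthExp_of_ne_one n hi0 hi, neg_neg, zpow_natCast,
      cauchyRow_of_ne_one V _ _ hi0 hi, sub_zero] using hO

theorem IsEvenSolution.vecMul_cauchyRow_twist (hA : IsEvenSolution V D n A)
    (hU : IsPotential D (toC V)) (hD : 2 ≤ D) (hDe : Even D) {q : ℂ[X]}
    (hq : q.degree < (2 * n : ℕ)) (k : Fin (D + 1)) {b : ℂ[X]}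
    (hb : ∀ z, z ∉ contour D → (A z).adjugate 1 k = b.eval z) {z : ℂ} (hz : z ∉ contour D) :
    Matrix.vecMul (cauchyRow V D (twist (toC V) q) z) (A z).adjugate k
      = b.eval z * arcCauchy D (D / 2) (weighted (C 2 * toC V) (twist (toC V) q)) z
        - arcCauchy D (D / 2) (weighted (C 2 * toC V) (b * twist (toC V) q)) z := by
  set p := twist (toC V) q
  have hj : D / 2 < D := by omega
  obtain ⟨g, hg, hgA⟩ := (isRowSolution_cauchyRow hU hD hDe p).exists_entire hA hD hDe k
  obtain ⟨S, hS⟩ := exists_polynomial_arcCauchyLinear_mul hU.two_mul hD hj p b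
  simp only [arcCauchyLinear_apply] at hS
  obtain ⟨_, G, _, hG, hAG⟩ := hA.exists_adjugate_eq
  have other_columns : Tendsto (fun z => ∑ i ∈ Finset.univ.erase (1 : Fin (D + 1)),
      cauchyRow V D p z i * z ^ (-growthExp D n i) * G z i k)
      (Bornology.cobounded ℂ ⊓ 𝓟 (contour D)ᶜ) (𝓝 0) := by
    have := tendsto_finsetSum (Finset.univ.erase (1 : Fin (D + 1))) fun i hi =>
      (tendsto_cauchyRow_twist_mul_zpow hU hD hq (Finset.ne_of_mem_erase hi)).mul
        (tendsto_pi_nhds.1 (tendsto_pi_nhds.1 hG i) k)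
    simpa only [zero_mul, Finset.sum_const_zero] using this
  have remainder : Tendsto (arcCauchy D (D / 2) (weighted (C 2 * toC V) (b * p)))
      (Bornology.cobounded ℂ ⊓ 𝓟 (contour D)ᶜ) (𝓝 0) :=
    (arcCauchy_isBigO_inv hU.two_mul hD hj (b * p)).trans_tendsto
      (tendsto_inv₀_cobounded.mono_left inf_le_left)
  have hlim : Tendsto (fun z => g z - S.eval z) (Bornology.cobounded ℂ ⊓ 𝓟 (contour D)ᶜ)
      (𝓝 0) := by
    rw [← add_zero (0 : ℂ)]
    refine (other_columns.add remainder).congr' ?_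
    filter_upwards [hAG, mem_inf_of_right (mem_principal_self _)] with w ⟨hw0, _, hwG⟩ hw
    rw [← hgA w hw, ← hS w hw, Matrix.vecMul, dotProduct,
      ← Finset.add_sum_erase _ _ (Finset.mem_univ (1 : Fin (D + 1))), hb w hw,
      cauchyRow_one V hD, hwG, adjugate_growth hD hw0]
    simp only [Matrix.diagonal_mul, ← mul_assoc]
    ring
  rw [hgA z hz, hS z hz, ← sub_eq_zero]
  exact eq_const_of_tendsto_cobounded_inf (hg.sub S.differentiable) (dense_compl_contour hD) hlim z

theorem IsEvenSolution.eval_twist_eq (hA : IsEvenSolution V D n A) (hU : IsPotential D (toC V))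
    (hD : 2 ≤ D) (hDe : Even D) {b : Fin (D + 1) → ℂ[X]}
    (hb : ∀ k z, z ∉ contour D → (A z).adjugate 1 k = (b k).eval z) {y : ℂ} (hy : y ∉ contour D)
    (hj : D / 2 < D) {q : ℂ[X]} (hq : q.degree < (2 * n : ℕ)) :
    (twist (toC V) q).eval y
      = (∑ k, A y k 0 • b k).eval y * arcCauchyLinear hU.two_mul hD hj hy (twist (toC V) q)
        - arcCauchyLinear hU.two_mul hD hj hy ((∑ k, A y k 0 • b k) * twist (toC V) q) := by
  set T := arcCauchyLinear hU.two_mul hD hj hy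
  have adjugate_mul_self : (A y).adjugate * A y = 1 := by
    rw [Matrix.adjugate_mul, hA.det_eq_one hD hDe hy, one_smul]
  calc (twist (toC V) q).eval y
      = Matrix.vecMul
          (Matrix.vecMul (cauchyRow V D (twist (toC V) q) y) (A y).adjugate) (A y) 0 := by
        rw [Matrix.vecMul_vecMul, adjugate_mul_self, Matrix.vecMul_one, cauchyRow, if_pos rfl]
    _ = ∑ k, ((b k).eval y * T (twist (toC V) q) - T (b k * twist (toC V) q)) * A y k 0 :=
        Finset.sum_congr (s₁ := Finset.univ) rfl fun k _ =>
          congrArg (· * A y k 0) (hA.vecMul_cauchyRow_twist hU hD hDe hq k (hb k) hy)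
    _ = _ := by
        rw [eval_finsetSum, Finset.sum_mul, Finset.sum_mul, map_sum, ← Finset.sum_sub_distrib]
        refine Finset.sum_congr rfl fun k _ => ?_
        rw [smul_mul_assoc, map_smul, eval_smul, smul_eq_mul, smul_eq_mul]
        ring

/- For fixed `y`, the kernel is characterised by its degree and by how it pairs with every `q`
under the skew form; `e^{V(x) + V(y)} S_n(x, y)` has the same two properties up to a constant. -/
theorem IsEvenSolution.exists_kernel (hA : IsEvenSolution V D n A) (hU : IsPotential D (toC V))
    (hD : 2 ≤ D) (hDe : Even D) {y : ℂ} (hy : y ∉ contour D) :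
    ∃ K : ℂ[X], K.degree < (2 * n : ℕ) ∧
      (∀ x, x ∉ contour D → ((A x)⁻¹ * A y) 1 0 = (x - y) * K.eval x) ∧
      ∀ q : ℂ[X], q.degree < (2 * n : ℕ) →
        cskew hU hD K q = -(2 * Real.pi * Complex.I) * (twist (toC V) q).eval y := by
  choose b hbdeg hb using hA.exists_adjugate_row hD hDe
  set F : ℂ[X] := ∑ k, A y k 0 • b k with hF
  have eval_F : ∀ x, x ∉ contour D → ((A x)⁻¹ * A y) 1 0 = F.eval x := fun x hx => by
    rw [hA.inv_eq_adjugate hD hDe hx, Matrix.mul_apply, hF, eval_finsetSum]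
    refine Finset.sum_congr rfl fun k _ => ?_
    rw [hb k x hx, eval_smul, smul_eq_mul, mul_comm]
  have F_root : F.eval y = 0 := by
    rw [← eval_F y hy, Matrix.nonsing_inv_mul _ (by simp [hA.det_eq_one hD hDe hy]),
      Matrix.one_apply_ne (fin_one_ne_zero hD)]
  obtain ⟨K, hK⟩ := dvd_iff_isRoot.2 F_root
  have F_degree : F.natDegree ≤ 2 * n := natDegree_sum_le_of_forall_le _ _ fun k _ =>
    (natDegree_smul_le _ _).trans (hbdeg k)
  refine ⟨K, ?_, fun x hx => by rw [eval_F x hx, hK, eval_mul, eval_sub, eval_X, eval_C],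
    fun q hq => ?_⟩
  · rcases eq_or_ne K 0 with rfl | hK0
    · exact WithBot.bot_lt_coe _
    · rw [hK, natDegree_mul (X_sub_C_ne_zero y) hK0, natDegree_X_sub_C] at F_degree
      rw [← natDegree_lt_iff_degree_lt hK0]
      omega
  · rw [hA.eval_twist_eq hU hD hDe hb hy (by omega) hq, ← hF, F_root, hK, mul_assoc (X - C y),
      arcCauchyLinear_X_sub_C_mul, ← cskew_apply, zero_mul, zero_sub, neg_mul_neg,
      mul_inv_cancel_left₀ Complex.two_pi_I_ne_zero]

end formula

section kernel

variable {V : ℝ[X]} {D n : ℕ} {A : ℂ → Matrix (Fin (D + 1)) (Fin (D + 1)) ℂ} {P : ℕ → ℝ[X]}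

/-- The polynomial `x ↦ e^{V(x) + V(y)} S_n(x, y)`. -/
def kernelPoly (V : ℝ[X]) (P : ℕ → ℝ[X]) (n : ℕ) (y : ℂ) : ℂ[X] :=
  ∑ k ∈ Finset.range n, (2 * (skewNorm V P k : ℂ))⁻¹ •
    ((twist (toC V) (toC (P (2 * k + 1)))).eval y • toC (P (2 * k))
      - (twist (toC V) (toC (P (2 * k)))).eval y • toC (P (2 * k + 1)))

theorem deriv_aeval_mul_exp (V P : ℝ[X]) (y : ℂ) :
    deriv (fun t : ℂ => aeval t P * Complex.exp (-aeval t V)) y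
      = (twist (toC V) (toC P)).eval y * Complex.exp (-aeval y V) := by
  simp only [aeval_eq_eval_toC]
  exact congrFun (deriv_weighted (toC V) (toC P)) y

theorem preKernelC_eq (V : ℝ[X]) (P : ℕ → ℝ[X]) (n : ℕ) (x y : ℂ) :
    preKernelC V P n x y
      = Complex.exp (-aeval x V - aeval y V) * (kernelPoly V P n y).eval x := by
  rw [preKernelC, kernelPoly, eval_finsetSum, Finset.mul_sum]
  refine Finset.sum_congr rfl fun k _ => ?_
  rw [deriv_aeval_mul_exp, deriv_aeval_mul_exp, sub_eq_add_neg (-aeval x V), Complex.exp_add]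
  simp only [eval_smul, eval_sub, smul_eq_mul, aeval_eq_eval_toC]
  ring

theorem continuous_preKernelC (V : ℝ[X]) (P : ℕ → ℝ[X]) (n : ℕ) :
    Continuous fun p : ℂ × ℂ => preKernelC V P n p.1 p.2 := by
  simp only [preKernelC_eq, kernelPoly, eval_finsetSum, eval_smul, eval_sub, smul_eq_mul,
    aeval_eq_eval_toC]
  fun_prop

theorem ofReal_preKernel (V : ℝ[X]) (P : ℕ → ℝ[X]) (n : ℕ) (x y : ℝ) :
    (preKernel V P n x y : ℂ) = preKernelC V P n x y := by
  have aeval_ofReal : ∀ (Q : ℝ[X]) (t : ℝ), aeval (t : ℂ) Q = ((Q.eval t : ℝ) : ℂ) := fun Q t => by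
    rw [aeval_eq_eval_toC, eval_toC_ofReal]
  have deriv_ofReal : ∀ Q : ℝ[X], deriv (fun t : ℂ => aeval t Q * Complex.exp (-aeval t V)) y
      = ((deriv (fun t : ℝ => Q.eval t * Real.exp (-V.eval t)) y : ℝ) : ℂ) := fun Q => by
    have real_deriv : deriv (fun t : ℝ => Q.eval t * Real.exp (-V.eval t)) y = _ :=
      ((Q.hasDerivAt y).mul ((V.hasDerivAt y).fun_neg.exp)).deriv
    rw [real_deriv, deriv_aeval_mul_exp, aeval_ofReal, twist_apply, eval_sub, eval_mul, toC, toC,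
      derivative_map, derivative_map, eval_toC_ofReal, eval_toC_ofReal, eval_toC_ofReal]
    push_cast
    ring
  rw [preKernel, preKernelC]
  simp only [deriv_ofReal, aeval_ofReal]
  push_cast
  rfl

theorem sum_range_two_mul {M : Type*} [AddCommMonoid M] (f : ℕ → M) (n : ℕ) :
    ∑ j ∈ Finset.range (2 * n), f j = ∑ k ∈ Finset.range n, (f (2 * k) + f (2 * k + 1)) := by
  induction n with
  | zero => rfl
  | succ n ih =>
    rw [mul_add, mul_one, Finset.sum_range_succ, Finset.sum_range_succ, Finset.sum_range_succ, ih,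
      add_assoc]

theorem IsSkewOrthogonal.degree_kernelPoly_lt (hP : IsSkewOrthogonal V P) (n : ℕ) (y : ℂ) :
    (kernelPoly V P n y).degree < (2 * n : ℕ) := by
  have basis_mem : ∀ m < 2 * n, toC (P m) ∈ degreeLT ℂ (2 * n) := fun m hm => by
    rw [mem_degreeLT, degree_toC, hP.degree_eq]
    exact_mod_cast hm
  rw [← mem_degreeLT]
  refine Submodule.sum_mem _ fun k hk => ?_
  have hkn := Finset.mem_range.1 hk
  exact Submodule.smul_mem _ _ (Submodule.sub_mem _
    (Submodule.smul_mem _ _ (basis_mem _ (by omega)))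
    (Submodule.smul_mem _ _ (basis_mem _ (by omega))))

theorem IsSkewOrthogonal.cskew_kernelPoly (hP : IsSkewOrthogonal V P) (hU : IsPotential D (toC V))
    (hD : 2 ≤ D) (hDe : Even D) (y : ℂ) {q : ℂ[X]} (hq : q.degree < (2 * n : ℕ)) :
    cskew hU hD (kernelPoly V P n y) q = 2⁻¹ * (twist (toC V) q).eval y := by
  obtain ⟨c, rfl⟩ := hP.exists_eq_sum hq
  have eval_twist_sum :
      (twist (toC V) (∑ j ∈ Finset.range (2 * n), c j • toC (P j))).eval y
        = ∑ k ∈ Finset.range n, (c (2 * k) * (twist (toC V) (toC (P (2 * k)))).eval y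
          + c (2 * k + 1) * (twist (toC V) (toC (P (2 * k + 1)))).eval y) := by
    simp only [sum_range_two_mul, map_sum, map_add, map_smul, eval_finsetSum, eval_add, eval_smul,
      smul_eq_mul]
  rw [eval_twist_sum, kernelPoly, map_sum (cskew hU hD), LinearMap.sum_apply, Finset.mul_sum]
  refine Finset.sum_congr rfl fun k hk => ?_
  have hkn := Finset.mem_range.1 hk
  have skewNorm_ne_zero : (skewNorm V P k : ℂ) ≠ 0 :=
    Complex.ofReal_ne_zero.2 (hP.skewNorm_pos hU hD hDe k).ne'
  simp only [map_smul, map_sub, LinearMap.smul_apply, LinearMap.sub_apply,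
    hP.cskew_even_sum hU hD hDe hkn, hP.cskew_odd_sum hU hD hDe hkn, smul_eq_mul]
  field_simp
  ring

theorem IsEvenSolution.preKernelC_eq_cdRHS (hA : IsEvenSolution V D n A)
    (hP : IsSkewOrthogonal V P) (hU : IsPotential D (toC V)) (hD : 2 ≤ D) (hDe : Even D) {x y : ℂ}
    (hx : x ∉ contour D) (hy : y ∉ contour D) (hxy : x ≠ y) :
    preKernelC V P n x y = cdRHS V D x y (A x) (A y) := by
  obtain ⟨K, hKdeg, hKA, hK⟩ := hA.exists_kernel hU hD hDe hy
  set c : ℂ := (4 * Real.pi * Complex.I)⁻¹ with hc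
  have hdeg : (kernelPoly V P n y + c • K).degree < (2 * n : ℕ) := by
    rw [← mem_degreeLT]
    exact Submodule.add_mem _ (mem_degreeLT.2 (hP.degree_kernelPoly_lt n y))
      (Submodule.smul_mem _ _ (mem_degreeLT.2 hKdeg))
  have kernelPoly_add : kernelPoly V P n y + c • K = 0 := by
    refine eq_zero_of_cskew_eq_zero hU hD hDe hdeg fun p hp => ?_
    rw [cskew_swap, neg_eq_zero, map_add, map_smul, LinearMap.add_apply, LinearMap.smul_apply,
      hP.cskew_kernelPoly hU hD hDe y hp, hK p hp, hc, smul_eq_mul]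
    have hpi : (Real.pi : ℂ) ≠ 0 := Complex.ofReal_ne_zero.2 Real.pi_ne_zero
    field_simp
    ring
  rw [preKernelC_eq, eq_neg_of_add_eq_zero_left kernelPoly_add, cdRHS, hKA x hx,
    mul_div_cancel_left₀ _ (sub_ne_zero.2 hxy), eval_neg, eval_smul, smul_eq_mul, hc, one_div]
  ring

theorem IsEvenSolution.tendsto_cdRHS (hA : IsEvenSolution V D n A)
    (hP : IsSkewOrthogonal V P) (hU : IsPotential D (toC V)) (hD : 2 ≤ D) (hDe : Even D) {x y : ℂ}
    (hxy : x ≠ y) {l : Filter (ℂ × ℂ)} (hl : l ≤ 𝓝 (x, y))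
    (hlc : ∀ᶠ p in l, p.1 ∉ contour D ∧ p.2 ∉ contour D) :
    Tendsto (fun p : ℂ × ℂ => cdRHS V D p.1 p.2 (A p.1) (A p.2)) l
      (𝓝 (preKernelC V P n x y)) := by
  refine (((continuous_preKernelC V P n).tendsto (x, y)).mono_left hl).congr' ?_
  have off_diagonal : ∀ᶠ p in l, p.1 ≠ p.2 :=
    hl ((isOpen_ne_fun continuous_fst continuous_snd).mem_nhds hxy)
  filter_upwards [off_diagonal, hlc] with p hp hpc
  exact hA.preKernelC_eq_cdRHS hP hU hD hDe hpc.1 hpc.2 hp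

theorem tendsto_cdRHS_of_tendsto (V : ℝ[X]) {x y : ℂ} (hxy : x ≠ y)
    {M N : Matrix (Fin (D + 1)) (Fin (D + 1)) ℂ} (hdet : IsUnit M.det) {l l' : Filter ℂ}
    (hl : l ≤ 𝓝 x) (hl' : l' ≤ 𝓝 y) (hM : Tendsto A l (𝓝 M)) (hN : Tendsto A l' (𝓝 N)) :
    Tendsto (fun p : ℂ × ℂ => cdRHS V D p.1 p.2 (A p.1) (A p.2)) (l ×ˢ l')
      (𝓝 (cdRHS V D x y M N)) := by
  have hle : l ×ˢ l' ≤ 𝓝 (x, y) := nhds_prod_eq (X := ℂ) (Y := ℂ) ▸ Filter.prod_mono hl hl'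
  obtain ⟨u, hu⟩ := hdet
  have inv_tendsto : Tendsto (fun z => (A z)⁻¹) l (𝓝 M⁻¹) :=
    (continuousAt_matrix_inv M (hu ▸ NormedRing.inverse_continuousAt u)).tendsto.comp hM
  have entry_tendsto : Tendsto (fun p : ℂ × ℂ => ((A p.1)⁻¹ * A p.2) 1 0) (l ×ˢ l')
      (𝓝 ((M⁻¹ * N) 1 0)) :=
    tendsto_pi_nhds.1 (tendsto_pi_nhds.1
      ((inv_tendsto.comp tendsto_fst).mul (hN.comp tendsto_snd)) 1) 0
  have exp_tendsto : Tendsto (fun p : ℂ × ℂ => Complex.exp (-aeval p.1 V - aeval p.2 V)) (l ×ˢ l')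
      (𝓝 (Complex.exp (-aeval x V - aeval y V))) := by
    have : Continuous fun p : ℂ × ℂ => Complex.exp (-aeval p.1 V - aeval p.2 V) := by
      simp only [aeval_eq_eval_toC]
      fun_prop
    exact (this.tendsto (x, y)).mono_left hle
  have sub_tendsto : Tendsto (fun p : ℂ × ℂ => p.1 - p.2) (l ×ˢ l') (𝓝 (x - y)) :=
    ((continuous_fst.sub continuous_snd).tendsto (x, y)).mono_left hle
  exact (exp_tendsto.const_mul _).mul (entry_tendsto.div sub_tendsto (sub_ne_zero.2 hxy))

theorem IsBoundaryValue.exists_tendsto {x : ℂ} {M : Matrix (Fin (D + 1)) (Fin (D + 1)) ℂ}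
    (h : IsBoundaryValue D A x M) (hD : 2 ≤ D) :
    ∃ l : Filter ℂ, l.NeBot ∧ l ≤ 𝓝 x ∧ (∀ᶠ z in l, z ∉ contour D) ∧ Tendsto A l (𝓝 M) := by
  obtain ⟨k, hk, hx, hx0, hplus | hminus⟩ := h
  · exact ⟨_, neBot_nhdsWithin_leftSide hD hk hx hx0, inf_le_left,
      eventually_nhdsWithin_of_forall fun z hz => hz.2, hplus⟩
  · exact ⟨_, neBot_nhdsWithin_rightSide hD hk hx hx0, inf_le_left,
      eventually_nhdsWithin_of_forall fun z hz => hz.2, hminus⟩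

theorem IsEvenSolution.det_eq_one_of_tendsto (hA : IsEvenSolution V D n A) (hD : 2 ≤ D)
    (hDe : Even D) {l : Filter ℂ} [l.NeBot] (hl : ∀ᶠ z in l, z ∉ contour D)
    {M : Matrix (Fin (D + 1)) (Fin (D + 1)) ℂ} (hM : Tendsto A l (𝓝 M)) : M.det = 1 := by
  have det_tendsto : Tendsto (fun z => (A z).det) l (𝓝 M.det) :=
    (continuous_id.matrix_det.tendsto M).comp hM
  refine tendsto_nhds_unique det_tendsto (tendsto_const_nhds.congr' ?_)
  filter_upwards [hl] with z hz using (hA.det_eq_one hD hDe hz).symm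

theorem IsEvenSolution.preKernelC_eq_cdRHS_boundary (hA : IsEvenSolution V D n A)
    (hP : IsSkewOrthogonal V P) (hU : IsPotential D (toC V)) (hD : 2 ≤ D) (hDe : Even D) {x y : ℂ}
    (hxy : x ≠ y) {M N : Matrix (Fin (D + 1)) (Fin (D + 1)) ℂ}
    (hM : IsBoundaryValue D A x M) (hN : IsBoundaryValue D A y N) :
    IsUnit M.det ∧ preKernelC V P n x y = cdRHS V D x y M N := by
  obtain ⟨l, _, hl, hlc, hlM⟩ := hM.exists_tendsto hD
  obtain ⟨l', _, hl', hlc', hlN⟩ := hN.exists_tendsto hD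
  have hdet : IsUnit M.det := by
    rw [hA.det_eq_one_of_tendsto hD hDe hlc hlM]
    exact isUnit_one
  have hle : l ×ˢ l' ≤ 𝓝 (x, y) := nhds_prod_eq (X := ℂ) (Y := ℂ) ▸ Filter.prod_mono hl hl'
  exact ⟨hdet, tendsto_nhds_unique (hA.tendsto_cdRHS hP hU hD hDe hxy hle (hlc.prod_mk hlc'))
    (tendsto_cdRHS_of_tendsto V hxy hdet hl hl' hlM hlN)⟩

end kernel

end SkewRH

end

theorem mainTheorem1 (V : ℝ[X]) (D : ℕ) (hD : V.natDegree = D) (hD_even : Even D) (hD_two : 2 ≤ D)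
    (hV : 0 < V.leadingCoeff) (n : ℕ) :
    -- skew-orthogonal polynomials exist and have positive skew norms
    (∃ P : ℕ → ℝ[X], SkewRH.IsSkewOrthogonal V P) ∧
    (∀ P : ℕ → ℝ[X], SkewRH.IsSkewOrthogonal V P → ∀ k, 0 < SkewRH.skewNorm V P k) ∧
    -- the even Riemann-Hilbert problem has exactly one solution, and it is invertible
    (∃ A, SkewRH.IsEvenSolution V D n A) ∧
    (∀ A B, SkewRH.IsEvenSolution V D n A → SkewRH.IsEvenSolution V D n B →
      Set.EqOn A B (SkewRH.contour D)ᶜ) ∧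
    (∀ A, SkewRH.IsEvenSolution V D n A → ∀ z, z ∉ SkewRH.contour D → IsUnit (A z).det) ∧
    ∀ P : ℕ → ℝ[X], SkewRH.IsSkewOrthogonal V P →
    ∀ A, SkewRH.IsEvenSolution V D n A →
      -- the formula off the contour
      (∀ x y : ℂ, x ∉ SkewRH.contour D → y ∉ SkewRH.contour D → x ≠ y →
        SkewRH.preKernelC V P n x y = SkewRH.cdRHS V D x y (A x) (A y)) ∧
      -- the formula for real points, with either boundary value of `A` at each point
      (∀ x y : ℝ, x ≠ 0 → y ≠ 0 → x ≠ y → ∀ M N,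
        SkewRH.IsBoundaryValue D A x M → SkewRH.IsBoundaryValue D A y N →
        IsUnit M.det ∧ (SkewRH.preKernel V P n x y : ℂ) = SkewRH.cdRHS V D x y M N) ∧
      -- the formula for all real points (including `0`), the right-hand side being extended by
      -- continuity from the complement of the contour
      (∀ x y : ℝ, x ≠ y →
        Tendsto (fun p : ℂ × ℂ => SkewRH.cdRHS V D p.1 p.2 (A p.1) (A p.2))
          (𝓝[(SkewRH.contour D)ᶜ ×ˢ (SkewRH.contour D)ᶜ] ((x : ℂ), (y : ℂ)))
          (𝓝 (SkewRH.preKernel V P n x y : ℂ))) := by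
  have hU := SkewRH.isPotential_toC hD hV
  refine ⟨SkewRH.exists_isSkewOrthogonal hU hD_two hD_even,
    fun P hP k => hP.skewNorm_pos hU hD_two hD_even k,
    SkewRH.exists_isEvenSolution hU hD_two hD_even n,
    fun A B hA hB z hz => hA.unique hB hD_two hD_even hz,
    fun A hA z hz => by rw [hA.det_eq_one hD_two hD_even hz]; exact isUnit_one,
    fun P hP A hA => ⟨fun x y hx hy hxy => hA.preKernelC_eq_cdRHS hP hU hD_two hD_even hx hy hxy,
      fun x y _ _ hxy M N hM hN => ?_, fun x y hxy => ?_⟩⟩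
  · rw [SkewRH.ofReal_preKernel]
    exact hA.preKernelC_eq_cdRHS_boundary hP hU hD_two hD_even (by exact_mod_cast hxy) hM hN
  · rw [SkewRH.ofReal_preKernel]
    exact hA.tendsto_cdRHS hP hU hD_two hD_even (by exact_mod_cast hxy) inf_le_left
      self_mem_nhdsWithin
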